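/- Let $\partial=d/dx$, $\theta=x\partial$. For $e=(e_1,\dots,e_9)\in\mathbb C^9$ put $s_{11}=e_1+e_2+e_3$, $s_{12}=e_4+e_5+e_6$, $s_{13}=e_7+e_8+e_9$, $s_{21}=e_1e_2+e_1e_3+e_2e_3$, $s_{22}=e_4e_5+e_4e_6+e_5e_6$, $s_{23}=e_7e_8+e_7e_9+e_8e_9$, $s_{31}=e_1e_2e_3$, $s_{32}=e_4e_5e_6$, $s_{33}=e_7e_8e_9$, $s=-(s_{11}+s_{12}+s_{13}-6)/3$, and $$\begin{aligned} T_{13}&=-3,\quad T_{23}=3,\quad T_{12}=-9+s_{11}-2s_{13},\quad T_{22}=18+s_{13}-2s_{11},\\ T_{11}&=-8+\tfrac13(s_{11}^2+2s_{11}s_{13}-s_{12}^2+s_{13}^2)+s_{11}-5s_{13}-s_{21}+s_{22}-2s_{23},\\ T_{21}&=35+\tfrac13(-s_{11}^2-2s_{11}s_{13}+s_{12}^2-s_{13}^2)-7s_{11}+5s_{13}+2s_{21}-s_{22}+s_{23},\\ 2T_{10}&=\tfrac13(2s_{11}+s_{11}^2+2s_{11}s_{13}-s_{12}^2+s_{13}^2-s_{11}s_{21}+2s_{11}s_{23}+s_{12}s_{22}-2s_{13}s_{21}+2s_{13}s_{22}+s_{13}s_{23}-14s_{13})\\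 &\quad+\tfrac29(s_{11}^2s_{13}-s_{12}^2s_{13})+\tfrac2{27}(s_{11}^3-s_{12}^3)-5-s_{21}+s_{31}+s_{22}-s_{32}-5s_{23}-3s_{33},\\ T_{20}&=-T_{10}+19+\tfrac19(s_{11}^2s_{13}-s_{11}s_{12}^2+s_{11}s_{13}^2-s_{12}^2s_{13})+\tfrac1{27}(s_{13}^3+s_{11}^3-2s_{12}^3)\\ &\quad+\tfrac13(-2s_{11}^2-4s_{11}s_{13}+s_{11}s_{22}+2s_{12}^2+s_{22}s_{12}-2s_{13}^2+s_{22}s_{13})-5s_{11}+4s_{13}+3s_{21}-2s_{22}-s_{31}-s_{32}-s_{33}. \end{aligned}$$ Let $E_6(e)=T_0(\theta)+T_1(\theta)\partial+T_2(\theta)\partial^2+T_3(\theta)\partial^3$, an operator of order $6$, where $T_0=(\theta+s+2)(\theta+s+1)(\theta+s)(\theta+e_7)(\theta+e_8)(\theta+e_9)$, $T_1=(\theta+s+2)(\theta+s+1)(T_{13}\theta^3+T_{12}\theta^2+T_{11}\theta+T_{10})$, $T_2=(\theta+s+2)(T_{23}\theta^3+T_{22}\theta^2+T_{21}\theta+T_{20})$,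 $T_3=-(\theta+3-e_1)(\theta+3-e_2)(\theta+3-e_3)$. Let $S\!E_6(a,b,c,g,p,q,r)$ be $E_6(e)$ with $$\begin{aligned} &e_1=p+r+1,\quad e_2=a+c+p+r+2,\quad e_3=2a+2c+g+p+r+3,\\ &e_4=q+r+1,\quad e_5=b+c+q+r+2,\quad e_6=2b+2c+g+q+r+3,\\ &e_7=-2c-p-q-r-1,\quad e_8=-a-b-2c-p-q-r-g-2,\quad e_9=-2a-2b-2c-p-q-r-g-3. \end{aligned}$$ **Theorem.** Write $t=(a,b,c,g,p,q,r)$ and let $t\mapsto t+v$ be any one of the shifts $$a\to a\pm1,\quad b\to b\pm1,\quad c\to c\pm1,\quad g\to g\pm2,\quad p\to p\pm1,\quad q\to q\pm1,\quad r\to r\pm1,$$ $$(c,p,q)\to(c\pm1,p\mp1,q\mp1),\quad (c,g)\to(c\pm1,g\mp2).$$ Then $S\!E_6$ admits a shift operator for this shift: 1. There are nonzero operators $P=\sum_{i<6}P_i\partial^i$ and $Q=\sum_{i<6}Q_i\partial^i$, whose coefficients $P_i,Q_i$ are polynomials in $a,b,c,g,p,q,r$ over $\mathbb C(x)$ and where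 the $P_i$ have no nonconstant common factor in $\mathbb C[a,b,c,g,p,q,r]$, such that for all $t\in\mathbb C^7$ $$S\!E_6(t+v)\circ P(t)=Q(t)\circ S\!E_6(t).$$ 2. For every $t\in\mathbb C^7$ there are nonzero operators $P,Q\in\mathbb C(x)[\partial]$ of order lower than $6$ with $S\!E_6(t+v)\circ P=Q\circ S\!E_6(t)$. -/

import Mathlib

open Polynomial

namespace SE6

/-! ## Differential operators with coefficients in `ℂ(x)` -/

/-- The derivative `d/dx` of a rational function, by the quotient rule. -/
noncomputable def ratDeriv (f : RatFunc ℂ) : RatFunc ℂ :=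
  algebraMap ℂ[X] (RatFunc ℂ) (derivative f.num * f.denom - f.num * derivative f.denom) /
    algebraMap ℂ[X] (RatFunc ℂ) (f.denom ^ 2)

/-- The quotient rule holds for every representation of a rational function as a fraction. -/
theorem ratDeriv_div (p q : ℂ[X]) (hq : q ≠ 0) :
    ratDeriv (algebraMap ℂ[X] (RatFunc ℂ) p / algebraMap ℂ[X] (RatFunc ℂ) q) =
      algebraMap ℂ[X] (RatFunc ℂ) (derivative p * q - p * derivative q) /
        algebraMap ℂ[X] (RatFunc ℂ) (q ^ 2) := by
  have key : ∀ (n d : ℂ[X]), d ≠ 0 → n * q = p * d →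
      algebraMap ℂ[X] (RatFunc ℂ) (derivative n * d - n * derivative d) /
        algebraMap ℂ[X] (RatFunc ℂ) (d ^ 2) =
      algebraMap ℂ[X] (RatFunc ℂ) (derivative p * q - p * derivative q) /
        algebraMap ℂ[X] (RatFunc ℂ) (q ^ 2) := by
    intro n d hd h
    have h1 : algebraMap ℂ[X] (RatFunc ℂ) (d ^ 2) ≠ 0 :=
      RatFunc.algebraMap_ne_zero (pow_ne_zero 2 hd)
    have h2 : algebraMap ℂ[X] (RatFunc ℂ) (q ^ 2) ≠ 0 :=
      RatFunc.algebraMap_ne_zero (pow_ne_zero 2 hq)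
    rw [div_eq_div_iff h1 h2, ← map_mul, ← map_mul]
    refine congrArg _ ?_
    have h' := congrArg derivative h
    rw [derivative_mul, derivative_mul] at h'
    generalize derivative n = n' at *
    generalize derivative d = d' at *
    generalize derivative p = p' at *
    generalize derivative q = q' at *
    linear_combination (d * q) * h' - (d' * q + d * q') * h
  refine key _ _ (RatFunc.denom_ne_zero _) ?_
  have h := RatFunc.num_div_denom
    (algebraMap ℂ[X] (RatFunc ℂ) p / algebraMap ℂ[X] (RatFunc ℂ) q)
  rw [div_eq_div_iff (RatFunc.algebraMap_ne_zero (RatFunc.denom_ne_zero _))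
    (RatFunc.algebraMap_ne_zero hq), ← map_mul, ← map_mul] at h
  exact RatFunc.algebraMap_injective ℂ h

/-- Every rational function is a fraction of polynomials. -/
theorem exists_frac (f : RatFunc ℂ) : ∃ p q : ℂ[X], q ≠ 0 ∧
    f = algebraMap ℂ[X] (RatFunc ℂ) p / algebraMap ℂ[X] (RatFunc ℂ) q :=
  ⟨f.num, f.denom, RatFunc.denom_ne_zero f, (RatFunc.num_div_denom f).symm⟩

theorem ratDeriv_add (f g : RatFunc ℂ) : ratDeriv (f + g) = ratDeriv f + ratDeriv g := by
  obtain ⟨p, q, hq, rfl⟩ := exists_frac f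
  obtain ⟨r, s, hs, rfl⟩ := exists_frac g
  have h1 : algebraMap ℂ[X] (RatFunc ℂ) q ≠ 0 := RatFunc.algebraMap_ne_zero hq
  have h2 : algebraMap ℂ[X] (RatFunc ℂ) s ≠ 0 := RatFunc.algebraMap_ne_zero hs
  have h : algebraMap ℂ[X] (RatFunc ℂ) p / algebraMap ℂ[X] (RatFunc ℂ) q +
      algebraMap ℂ[X] (RatFunc ℂ) r / algebraMap ℂ[X] (RatFunc ℂ) s =
      algebraMap ℂ[X] (RatFunc ℂ) (p * s + q * r) / algebraMap ℂ[X] (RatFunc ℂ) (q * s) := by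
    simp only [map_add, map_mul]
    field_simp
  rw [h, ratDeriv_div _ _ (mul_ne_zero hq hs), ratDeriv_div _ _ hq, ratDeriv_div _ _ hs]
  simp only [map_add, map_mul, map_sub, map_pow, derivative_mul]
  field_simp
  ring

theorem ratDeriv_mul (f g : RatFunc ℂ) :
    ratDeriv (f * g) = f * ratDeriv g + g * ratDeriv f := by
  obtain ⟨p, q, hq, rfl⟩ := exists_frac f
  obtain ⟨r, s, hs, rfl⟩ := exists_frac g
  have h1 : algebraMap ℂ[X] (RatFunc ℂ) q ≠ 0 := RatFunc.algebraMap_ne_zero hq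
  have h2 : algebraMap ℂ[X] (RatFunc ℂ) s ≠ 0 := RatFunc.algebraMap_ne_zero hs
  have h : algebraMap ℂ[X] (RatFunc ℂ) p / algebraMap ℂ[X] (RatFunc ℂ) q *
      (algebraMap ℂ[X] (RatFunc ℂ) r / algebraMap ℂ[X] (RatFunc ℂ) s) =
      algebraMap ℂ[X] (RatFunc ℂ) (p * r) / algebraMap ℂ[X] (RatFunc ℂ) (q * s) := by
    simp only [map_mul]
    field_simp
  rw [h, ratDeriv_div _ _ (mul_ne_zero hq hs), ratDeriv_div _ _ hq, ratDeriv_div _ _ hs]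
  simp only [map_add, map_mul, map_sub, map_pow, derivative_mul]
  field_simp
  ring

theorem ratDeriv_algebraMap (p : ℂ[X]) :
    ratDeriv (algebraMap ℂ[X] (RatFunc ℂ) p) = algebraMap ℂ[X] (RatFunc ℂ) (derivative p) := by
  have h := ratDeriv_div p 1 one_ne_zero
  simpa using h

theorem ratDeriv_smul (c : ℂ) (f : RatFunc ℂ) : ratDeriv (c • f) = c • ratDeriv f := by
  have h : ∀ g : RatFunc ℂ, c • g = algebraMap ℂ[X] (RatFunc ℂ) (C c) * g := fun g => by
    rw [Algebra.smul_def, IsScalarTower.algebraMap_apply ℂ ℂ[X] (RatFunc ℂ)]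
    rfl
  rw [h, h, ratDeriv_mul, ratDeriv_algebraMap]
  simp

/-- The differential operators act on `ℂ(x)`; the product of this ring is composition. -/
abbrev Op : Type := Module.End ℂ (RatFunc ℂ)

/-- The operator `∂ = d/dx`. -/
noncomputable def D : Op where
  toFun := ratDeriv
  map_add' := ratDeriv_add
  map_smul' := ratDeriv_smul

/-- The operator of multiplication by a rational function. -/
noncomputable def mulOp (f : RatFunc ℂ) : Op := LinearMap.mulLeft ℂ f

/-- The Euler operator `θ = x∂`. -/
noncomputable def theta : Op := mulOp RatFunc.X * D

/-- The element `∑_{i<n} a_i(x) ∂^i` of `ℂ(x)[∂]`; these are the differential operators of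
order lower than `n`. -/
noncomputable def ofCoeffs {n : ℕ} (a : Fin n → RatFunc ℂ) : Op :=
  ∑ i : Fin n, mulOp (a i) * D ^ (i : ℕ)

theorem D_pow_apply_X_pow (i k : ℕ) :
    (D ^ i) (algebraMap ℂ[X] (RatFunc ℂ) (X ^ k)) =
      algebraMap ℂ[X] (RatFunc ℂ) (derivative^[i] (X ^ k)) := by
  induction i with
  | zero => simp
  | succ i ih =>
    rw [pow_succ', Module.End.mul_apply, ih, Function.iterate_succ_apply']
    exact ratDeriv_algebraMap _

/-- `ℂ(x)[∂]` acts faithfully on `ℂ(x)`: an operator determines its coefficients. -/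
theorem ofCoeffs_injective {n : ℕ} (a : Fin n → RatFunc ℂ) (h : ofCoeffs a = 0) : a = 0 := by
  have hk : ∀ (k : ℕ) (hk : k < n), a ⟨k, hk⟩ = 0 := by
    intro k
    induction k using Nat.strong_induction_on with
    | _ k ih =>
      intro hk
      have h1 := LinearMap.congr_fun h (algebraMap ℂ[X] (RatFunc ℂ) (X ^ k))
      simp only [ofCoeffs, LinearMap.sum_apply, Module.End.mul_apply, mulOp,
        LinearMap.mulLeft_apply, LinearMap.zero_apply, D_pow_apply_X_pow] at h1
      rw [Finset.sum_eq_single (⟨k, hk⟩ : Fin n)] at h1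
      · have h2 : (derivative^[k] (X ^ k : ℂ[X])) ≠ 0 := by
          rw [iterate_derivative_X_pow_eq_C_mul]
          simp [Nat.descFactorial_self, Nat.factorial_ne_zero]
        rcases mul_eq_zero.mp h1 with h3 | h3
        · exact h3
        · exact absurd h3 (RatFunc.algebraMap_ne_zero h2)
      · intro j _ hj
        rcases lt_or_gt_of_ne (fun hh => hj (Fin.ext hh) : (j : ℕ) ≠ k) with h3 | h3
        · rw [show a j = 0 from ih j h3 j.2, zero_mul]
        · rw [iterate_derivative_X_pow_eq_C_mul, Nat.descFactorial_of_lt h3]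
          simp
      · intro h3
        exact absurd (Finset.mem_univ _) h3
  funext i
  exact hk i i.2

/-! ## The equation `E_6`

The exponents `e_1, …, e_9` are `e 0, …, e 8`. -/

noncomputable def s11 (e : Fin 9 → ℂ) : ℂ := e 0 + e 1 + e 2
noncomputable def s12 (e : Fin 9 → ℂ) : ℂ := e 3 + e 4 + e 5
noncomputable def s13 (e : Fin 9 → ℂ) : ℂ := e 6 + e 7 + e 8
noncomputable def s21 (e : Fin 9 → ℂ) : ℂ := e 0 * e 1 + e 0 * e 2 + e 1 * e 2
noncomputable def s22 (e : Fin 9 → ℂ) : ℂ := e 3 * e 4 + e 3 * e 5 + e 4 * e 5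
noncomputable def s23 (e : Fin 9 → ℂ) : ℂ := e 6 * e 7 + e 6 * e 8 + e 7 * e 8
noncomputable def s31 (e : Fin 9 → ℂ) : ℂ := e 0 * e 1 * e 2
noncomputable def s32 (e : Fin 9 → ℂ) : ℂ := e 3 * e 4 * e 5
noncomputable def s33 (e : Fin 9 → ℂ) : ℂ := e 6 * e 7 * e 8

/-- The exponent `s` at infinity, from the Fuchs relation `e_1 + ⋯ + e_9 + 3 s = 6`. -/
noncomputable def sInf (e : Fin 9 → ℂ) : ℂ := -(s11 e + s12 e + s13 e - 6) / 3

noncomputable def t12 (e : Fin 9 → ℂ) : ℂ := -9 + s11 e - 2 * s13 e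

noncomputable def t22 (e : Fin 9 → ℂ) : ℂ := 18 + s13 e - 2 * s11 e

noncomputable def t11 (e : Fin 9 → ℂ) : ℂ :=
  -8 + (s11 e ^ 2 + 2 * s11 e * s13 e - s12 e ^ 2 + s13 e ^ 2) / 3
    + s11 e - 5 * s13 e - s21 e + s22 e - 2 * s23 e

noncomputable def t21 (e : Fin 9 → ℂ) : ℂ :=
  35 + (-s11 e ^ 2 - 2 * s11 e * s13 e + s12 e ^ 2 - s13 e ^ 2) / 3
    - 7 * s11 e + 5 * s13 e + 2 * s21 e - s22 e + s23 e

noncomputable def t10 (e : Fin 9 → ℂ) : ℂ :=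
  ((2 * s11 e + s11 e ^ 2 + 2 * s11 e * s13 e - s12 e ^ 2 + s13 e ^ 2 - s11 e * s21 e
      + 2 * s11 e * s23 e + s12 e * s22 e - 2 * s13 e * s21 e + 2 * s13 e * s22 e
      + s13 e * s23 e - 14 * s13 e) / 3
    + 2 * (s11 e ^ 2 * s13 e - s12 e ^ 2 * s13 e) / 9
    + 2 * (s11 e ^ 3 - s12 e ^ 3) / 27
    - 5 - s21 e + s31 e + s22 e - s32 e - 5 * s23 e - 3 * s33 e) / 2

noncomputable def t20 (e : Fin 9 → ℂ) : ℂ :=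
  -t10 e + 19
    + (s11 e ^ 2 * s13 e - s11 e * s12 e ^ 2 + s11 e * s13 e ^ 2 - s12 e ^ 2 * s13 e) / 9
    + (s13 e ^ 3 + s11 e ^ 3 - 2 * s12 e ^ 3) / 27
    + (-2 * s11 e ^ 2 - 4 * s11 e * s13 e + s11 e * s22 e + 2 * s12 e ^ 2 + s22 e * s12 e
      - 2 * s13 e ^ 2 + s22 e * s13 e) / 3
    - 5 * s11 e + 4 * s13 e + 3 * s21 e - 2 * s22 e - s31 e - s32 e - s33 e

/-! The coefficients of the `(θ, ∂)`-form, as polynomials in the variable `X` standing for `θ`. -/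

noncomputable def B0 (e : Fin 9 → ℂ) : ℂ[X] := (X + C (e 6)) * (X + C (e 7)) * (X + C (e 8))

noncomputable def B1 (e : Fin 9 → ℂ) : ℂ[X] :=
  C (-3) * X ^ 3 + C (t12 e) * X ^ 2 + C (t11 e) * X + C (t10 e)

noncomputable def B2 (e : Fin 9 → ℂ) : ℂ[X] :=
  C 3 * X ^ 3 + C (t22 e) * X ^ 2 + C (t21 e) * X + C (t20 e)

noncomputable def T0 (e : Fin 9 → ℂ) : ℂ[X] :=
  (X + C (sInf e + 2)) * (X + C (sInf e + 1)) * (X + C (sInf e)) * B0 e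

noncomputable def T1 (e : Fin 9 → ℂ) : ℂ[X] :=
  (X + C (sInf e + 2)) * (X + C (sInf e + 1)) * B1 e

noncomputable def T2 (e : Fin 9 → ℂ) : ℂ[X] := (X + C (sInf e + 2)) * B2 e

noncomputable def T3 (e : Fin 9 → ℂ) : ℂ[X] :=
  -((X + C (3 - e 0)) * (X + C (3 - e 1)) * (X + C (3 - e 2)))

/-- The operator `E_6(e_1, …, e_9) = T_0(θ) + T_1(θ) ∂ + T_2(θ) ∂² + T_3(θ) ∂³`. -/
noncomputable def opE6 (e : Fin 9 → ℂ) : Op :=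
  aeval theta (T0 e) + aeval theta (T1 e) * D + aeval theta (T2 e) * D ^ 2 +
    aeval theta (T3 e) * D ^ 3

/-! ## The specialization `SE_6` -/

/-- The names of the seven parameters of `SE_6`. -/
inductive Par : Type
  | a | b | c | g | p | q | r
  deriving DecidableEq

/-- The exponents `e_1, …, e_9` in terms of the values `t` of the seven parameters. -/
noncomputable def exponents (t : Par → ℂ) : Fin 9 → ℂ :=
  ![t .p + t .r + 1,
    t .a + t .c + t .p + t .r + 2,
    2 * t .a + 2 * t .c + t .g + t .p + t .r + 3,
    t .q + t .r + 1,
    t .b + t .c + t .q + t .r + 2,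
    2 * t .b + 2 * t .c + t .g + t .q + t .r + 3,
    -2 * t .c - (t .p + t .q + t .r) - 1,
    -t .a - t .b - 2 * t .c - (t .p + t .q + t .r + t .g) - 2,
    -2 * t .a - 2 * t .b - 2 * t .c - (t .p + t .q + t .r + t .g) - 3]

/-- The operator `SE_6(a, b, c, g, p, q, r)`. -/
noncomputable def opSE6 (t : Par → ℂ) : Op := opE6 (exponents t)

/-! ## Shift operators -/

/-- The values at `t` of coefficients that are polynomials in the parameters over `ℂ(x)`. -/
noncomputable def specialize {n : ℕ} (P : Fin n → MvPolynomial Par (RatFunc ℂ)) (t : Par → ℂ) :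
    Fin n → RatFunc ℂ :=
  fun i => MvPolynomial.eval (fun k => algebraMap ℂ (RatFunc ℂ) (t k)) (P i)

/-- The coefficients have no common factor in `ℂ[a, b, c, g, p, q, r]`, apart from constants. -/
def NoCommonFactor {n : ℕ} (P : Fin n → MvPolynomial Par (RatFunc ℂ)) : Prop :=
  ∀ d : MvPolynomial Par ℂ,
    (∀ i, MvPolynomial.map (algebraMap ℂ (RatFunc ℂ)) d ∣ P i) → IsUnit d

/-- `(P, Q)` is a shift operator from `E` to `E'` (both of order `n`): nonzero operators in
`ℂ(x)[∂]` of order lower than `n` with `E' ∘ P = Q ∘ E`. -/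
def IsShiftOperator (n : ℕ) (E E' P Q : Op) : Prop :=
  (∃ u : Fin n → RatFunc ℂ, P = ofCoeffs u) ∧ (∃ w : Fin n → RatFunc ℂ, Q = ofCoeffs w) ∧
    P ≠ 0 ∧ Q ≠ 0 ∧ E' * P = Q * E

/-- The family `E` of operators of order `n` admits shift operators for the shift `t → t + v` of
the parameters: there is a pair `(P, Q)` depending polynomially on the parameters, the
coefficients of `P` having no common factor, and at every value of the parameters, also where
this `P` may vanish, there is a shift operator. -/
def AdmitsShift (n : ℕ) (E : (Par → ℂ) → Op) (v : Par → ℂ) : Prop :=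
  (∃ P Q : Fin n → MvPolynomial Par (RatFunc ℂ),
    P ≠ 0 ∧ Q ≠ 0 ∧ NoCommonFactor P ∧
      ∀ t : Par → ℂ, E (t + v) * ofCoeffs (specialize P t) = ofCoeffs (specialize Q t) * E t) ∧
  ∀ t : Par → ℂ, ∃ P Q : Op, IsShiftOperator n (E t) (E (t + v)) P Q

end SE6

/-!
The operator `SE_6` has shift operators of order one that shift only `p`, `q`, `r`, and shift
operators of order four that shift `a`, `b`, `c` or `g` as well; those required are obtained from
compositions of these.

*Forms.* In terms of `s = -r` the operator is
`∑_{k ≤ 3} (θ + s + k) ⋯ (θ + s + 2) c_k(θ) ∂^k` with cubic polynomials `c_k` (`opSE6_eq_form`).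
Operators of this shape multiply by a twisted convolution of their coefficients (`form_mul`), so
that a relation `E(t + v) P = Q E(t)` between such operators amounts to a few polynomial identities.
In the coordinates `gap0`, `gap1`, `gapInf`, `halfG`, `offset`, taken relative to the exponents, the
`c_k` are short and the symmetries `symC` and `symA` of the family, which exchange the outer
exponents at two of the singular points, are visible.

*Order one.* The operators `∂`, `θ + s` and `θ + s - ∂` are shift operators for `r - 1`,
`(p + 1, r - 1)` and `(q + 1, r - 1)`. Each is of the form `F = g ∂ + s` with `g' = 1` or `g = 1`,
and `u E` commutes with `F` up to the shift for a suitable `u`. Writing `u E = A F + ρ` one finds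
that `ρ` does not depend on `x` and that `A` is a shift operator inverse to `F` modulo `E`
(`hasInvShift_of_first_order`). All integral shifts of `p`, `q`, `r` are therefore invertible.

*Order four.* The polynomials `coefA`, `coefC`, `coefG`, `coefH` give shift operators for `a + 1`,
`c + 1`, `(c - 1, g + 2, p + 1, q + 1)` and `(c + 1, g - 2)`, each together with `r - 2`. Conjugation
with the symmetries gives those for `a - 1`, `b ± 1` and `c - 1`, up to shifts of `c`, `p`, `q`, `r`.
The composition of the operators for `c + 1` and `c - 1` is, modulo `E`, a nonzero constant times a
product of operators of order one (`coefC_mul_coefC`), so the shifts of `c` are invertible as well.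

*Composition.* A nonzero operator of order lower than six is not a left multiple of `E`, and it
stays so when an invertible shift operator is applied before it (`HasInvShift.add_hasShift`). Thus
for every shift in question there is a shift operator, of some order, that is not a left multiple
of `E`. Right division by `E`, whose leading coefficient `x³ (x - 1)³` does not involve the
parameters, lowers the order below six (`HasShift.admitsShift`). A solution of minimal degree in the
parameters has no common factor (`exists_noCommonFactor`). At a parameter value where this solution
vanishes one restricts it to a line through that value and divides by a power of the coordinate
(`exists_isShiftOperator`).
-/

namespace SE6

/-! ### Commutation rules -/

theorem mulOp_mul (f g : RatFunc ℂ) : mulOp (f * g) = mulOp f * mulOp g :=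
  LinearMap.ext fun h => mul_assoc f g h

theorem mulOp_add (f g : RatFunc ℂ) : mulOp (f + g) = mulOp f + mulOp g :=
  LinearMap.ext fun h => add_mul f g h

theorem mulOp_sub (f g : RatFunc ℂ) : mulOp (f - g) = mulOp f - mulOp g :=
  LinearMap.ext fun h => sub_mul f g h

theorem mulOp_neg (f : RatFunc ℂ) : mulOp (-f) = -mulOp f :=
  LinearMap.ext fun h => neg_mul f h

@[simp] theorem mulOp_zero : mulOp 0 = 0 := LinearMap.ext fun h => zero_mul h

@[simp] theorem mulOp_one : mulOp 1 = 1 := LinearMap.ext fun h => one_mul h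

theorem mulOp_comm (f g : RatFunc ℂ) : mulOp f * mulOp g = mulOp g * mulOp f := by
  rw [← mulOp_mul, ← mulOp_mul, mul_comm]

theorem mulOp_injective {f g : RatFunc ℂ} (h : mulOp f = mulOp g) : f = g := by
  simpa [mulOp] using LinearMap.congr_fun h 1

/-- The Leibniz rule, as a commutation rule of operators. -/
theorem D_mul_mulOp (f : RatFunc ℂ) : D * mulOp f = mulOp f * D + mulOp (ratDeriv f) := by
  refine LinearMap.ext fun h => ?_
  change ratDeriv (f * h) = f * ratDeriv h + ratDeriv f * h
  rw [ratDeriv_mul, mul_comm h]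

theorem ratDeriv_algebraMap_const (c : ℂ) : ratDeriv (algebraMap ℂ (RatFunc ℂ) c) = 0 := by
  rw [IsScalarTower.algebraMap_apply ℂ ℂ[X] (RatFunc ℂ), ratDeriv_algebraMap]
  simp

theorem algebraMap_op (c : ℂ) : algebraMap ℂ Op c = mulOp (algebraMap ℂ (RatFunc ℂ) c) :=
  LinearMap.ext fun h => by
    rw [Module.algebraMap_end_apply, Algebra.smul_def]
    rfl

/-- Multiplication by a rational function with zero derivative commutes with `D`. -/
theorem commute_D_mulOp {f : RatFunc ℂ} (hf : ratDeriv f = 0) : Commute (mulOp f) D := by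
  rw [Commute, SemiconjBy, D_mul_mulOp, hf, mulOp_zero, add_zero]

/-! ### Families of differential operators -/

/-- A ring of coefficients: a ring of families of rational functions, indexed by `T`, that
contains the constant families and is closed under `d/dx`. -/
class IsDiffClosed {T : Type*} (K : Subring (T → RatFunc ℂ)) : Prop where
  const_mem : ∀ f : RatFunc ℂ, (fun _ => f) ∈ K
  deriv_mem : ∀ f ∈ K, (fun t => ratDeriv (f t)) ∈ K

/-- `F` is a family of differential operators of order lower than `n` with coefficients in `K`. -/
def OrdLT {T : Type*} (K : Subring (T → RatFunc ℂ)) (n : ℕ) (F : T → Op) : Prop :=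
  ∃ f : ℕ → T → RatFunc ℂ, (∀ i, f i ∈ K) ∧
    ∀ t, F t = ∑ i ∈ Finset.range n, mulOp (f i t) * D ^ i

/-- `F` is a family of differential operators of order at most `n` with coefficients in `K`,
and `l` is the coefficient of `D ^ n`. -/
def Lead {T : Type*} (K : Subring (T → RatFunc ℂ)) (n : ℕ) (l : T → RatFunc ℂ) (F : T → Op) :
    Prop :=
  l ∈ K ∧ OrdLT K n (fun t => F t - mulOp (l t) * D ^ n)

/-- `F` is a family of differential operators with coefficients in `K`. -/
def OpFam {T : Type*} (K : Subring (T → RatFunc ℂ)) (F : T → Op) : Prop := ∃ n, OrdLT K n F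

section

variable {T : Type*} {K : Subring (T → RatFunc ℂ)}

theorem OrdLT.zero (n : ℕ) : OrdLT K n (fun _ => 0) :=
  ⟨fun _ _ => 0, fun _ => K.zero_mem, fun t => by simp⟩

theorem OrdLT.eq_zero {F : T → Op} (h : OrdLT K 0 F) (t : T) : F t = 0 := by
  obtain ⟨f, -, hf⟩ := h
  simp [hf]

theorem OrdLT.mono {m n : ℕ} {F : T → Op} (h : OrdLT K m F) (hmn : m ≤ n) : OrdLT K n F := by
  obtain ⟨f, hK, hf⟩ := h
  refine ⟨fun i => if i < m then f i else 0, fun i => ?_, fun t => ?_⟩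
  · dsimp only
    split_ifs
    exacts [hK i, K.zero_mem]
  · rw [hf, ← Finset.sum_subset (Finset.range_subset_range.mpr hmn)]
    · refine Finset.sum_congr rfl fun i hi => ?_
      simp only [if_pos (Finset.mem_range.mp hi)]
    · intro i _ hi
      simp [if_neg (fun h => hi (Finset.mem_range.mpr h))]

theorem OrdLT.add {n : ℕ} {F G : T → Op} (hF : OrdLT K n F) (hG : OrdLT K n G) :
    OrdLT K n (fun t => F t + G t) := by
  obtain ⟨f, hfK, hf⟩ := hF
  obtain ⟨g, hgK, hg⟩ := hG
  refine ⟨fun i => f i + g i, fun i => K.add_mem (hfK i) (hgK i), fun t => ?_⟩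
  simp only [hf, hg, Pi.add_apply, mulOp_add, add_mul, Finset.sum_add_distrib]

theorem OrdLT.mulOp_mul {n : ℕ} {g : T → RatFunc ℂ} {F : T → Op} (hg : g ∈ K)
    (hF : OrdLT K n F) : OrdLT K n (fun t => mulOp (g t) * F t) := by
  obtain ⟨f, hfK, hf⟩ := hF
  refine ⟨fun i => g * f i, fun i => K.mul_mem hg (hfK i), fun t => ?_⟩
  simp only [hf, Pi.mul_apply, SE6.mulOp_mul, Finset.mul_sum, mul_assoc]

theorem OrdLT.neg {n : ℕ} {F : T → Op} (hF : OrdLT K n F) : OrdLT K n (fun t => -F t) := by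
  obtain ⟨f, hfK, hf⟩ := hF
  refine ⟨fun i => -f i, fun i => K.neg_mem (hfK i), fun t => ?_⟩
  simp only [hf, Pi.neg_apply, mulOp_neg, neg_mul, Finset.sum_neg_distrib]

theorem OrdLT.sub {n : ℕ} {F G : T → Op} (hF : OrdLT K n F) (hG : OrdLT K n G) :
    OrdLT K n (fun t => F t - G t) := by
  simpa only [sub_eq_add_neg] using hF.add hG.neg

theorem OrdLT.single {n i : ℕ} (hi : i < n) {g : T → RatFunc ℂ} (hg : g ∈ K) :
    OrdLT K n (fun t => mulOp (g t) * D ^ i) := by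
  refine ⟨fun j => if j = i then g else 0, fun j => ?_, fun t => ?_⟩
  · dsimp only
    split_ifs
    exacts [hg, K.zero_mem]
  · rw [Finset.sum_eq_single i]
    · simp
    · intro j _ hj
      simp [hj]
    · intro h
      exact absurd (Finset.mem_range.mpr hi) h

theorem OrdLT.sum {ι : Type*} {n : ℕ} (s : Finset ι) {F : ι → T → Op}
    (h : ∀ i ∈ s, OrdLT K n (F i)) : OrdLT K n (fun t => ∑ i ∈ s, F i t) := by
  classical
  induction s using Finset.induction_on with
  | empty => simpa using OrdLT.zero n
  | insert i s hi ih =>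
    simp only [Finset.sum_insert hi]
    exact (h i (Finset.mem_insert_self i s)).add
      (ih fun j hj => h j (Finset.mem_insert_of_mem hj))

theorem OrdLT.congr {n : ℕ} {F G : T → Op} (hF : OrdLT K n F) (h : ∀ t, G t = F t) :
    OrdLT K n G := (funext h : G = F) ▸ hF

theorem OrdLT.D_mul [IsDiffClosed K] {n : ℕ} {F : T → Op} (hF : OrdLT K n F) :
    OrdLT K (n + 1) (fun t => D * F t) := by
  obtain ⟨f, hfK, hf⟩ := hF
  refine (OrdLT.sum (K := K) (Finset.range n)
    (F := fun i t => mulOp (f i t) * D ^ (i + 1) + mulOp (ratDeriv (f i t)) * D ^ i)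
    fun i hi => ?_).congr fun t => ?_
  · have := Finset.mem_range.mp hi
    exact (OrdLT.single (by omega) (hfK i)).add
      (OrdLT.single (by omega) (IsDiffClosed.deriv_mem _ (hfK i)))
  · rw [hf, Finset.mul_sum]
    refine Finset.sum_congr rfl fun i _ => ?_
    rw [← mul_assoc, D_mul_mulOp, add_mul, mul_assoc, ← pow_succ']

theorem OrdLT.D_pow_mul [IsDiffClosed K] {n : ℕ} {F : T → Op} (hF : OrdLT K n F) (k : ℕ) :
    OrdLT K (n + k) (fun t => D ^ k * F t) := by
  induction k with
  | zero => simpa using hF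
  | succ k ih =>
    refine ih.D_mul.congr fun t => ?_
    rw [← mul_assoc, ← pow_succ']

theorem OrdLT.mul_D_pow {n : ℕ} {F : T → Op} (hF : OrdLT K n F) (k : ℕ) :
    OrdLT K (n + k) (fun t => F t * D ^ k) := by
  obtain ⟨f, hfK, hf⟩ := hF
  refine (OrdLT.sum (K := K) (Finset.range n) (F := fun i t => mulOp (f i t) * D ^ (i + k))
    fun i hi => ?_).congr fun t => ?_
  · have := Finset.mem_range.mp hi
    exact OrdLT.single (by omega) (hfK i)
  · simp only [hf, Finset.sum_mul, mul_assoc, pow_add]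

theorem OrdLT.mul [IsDiffClosed K] {n m : ℕ} {F G : T → Op} (hF : OrdLT K n F)
    (hG : OrdLT K (m + 1) G) : OrdLT K (n + m) (fun t => F t * G t) := by
  obtain ⟨f, hfK, hf⟩ := hF
  refine (OrdLT.sum (K := K) (Finset.range n) (F := fun i t => mulOp (f i t) * (D ^ i * G t))
    fun i hi => ?_).congr fun t => ?_
  · have := Finset.mem_range.mp hi
    exact ((hG.D_pow_mul i).mono (by omega)).mulOp_mul (hfK i)
  · simp only [hf, Finset.sum_mul, mul_assoc]

/-- The coefficients of a family of differential operators are unique. -/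
theorem OrdLT.coeff_eq_zero {n : ℕ} {l : T → RatFunc ℂ}
    (h : OrdLT K n (fun t => mulOp (l t) * D ^ n)) (t : T) : l t = 0 := by
  obtain ⟨f, -, hf⟩ := h
  have h1 := ofCoeffs_injective (n := n + 1) (fun i => if (i : ℕ) = n then l t else -f i t) (by
    rw [ofCoeffs, Fin.sum_univ_castSucc]
    simp only [Fin.val_castSucc, Fin.val_last, if_true, hf t]
    rw [Finset.sum_range, ← Finset.sum_add_distrib]
    refine Finset.sum_eq_zero fun i _ => ?_
    rw [if_neg (by have := i.2; omega), mulOp_neg, neg_mul, neg_add_cancel])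
  simpa using congrFun h1 (Fin.last n)

theorem OrdLT.exists_lead {n : ℕ} {F : T → Op} (h : OrdLT K (n + 1) F) :
    ∃ l, Lead K n l F := by
  obtain ⟨f, hfK, hf⟩ := h
  refine ⟨f n, hfK n, f, hfK, fun t => ?_⟩
  simp only [hf, Finset.sum_range_succ, add_sub_cancel_right]

theorem Lead.ordLT {n : ℕ} {l : T → RatFunc ℂ} {F : T → Op} (h : Lead K n l F) :
    OrdLT K (n + 1) F :=
  ((h.2.mono (Nat.le_succ n)).add (OrdLT.single (Nat.lt_succ_self n) h.1)).congr
    fun _ => (sub_add_cancel _ _).symm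

theorem Lead.eq_zero {n : ℕ} {l : T → RatFunc ℂ} {F : T → Op} (h : Lead K n l F)
    (hF : OrdLT K n F) (t : T) : l t = 0 :=
  OrdLT.coeff_eq_zero ((hF.sub h.2).congr fun _ => (sub_sub_cancel _ _).symm) t

theorem Lead.ordLT_of_eq_zero {n : ℕ} {l : T → RatFunc ℂ} {F : T → Op} (h : Lead K n l F)
    (hl : ∀ t, l t = 0) : OrdLT K n F :=
  h.2.congr fun t => by rw [hl, mulOp_zero, zero_mul, sub_zero]

theorem Lead.of_ordLT {n : ℕ} {F : T → Op} (h : OrdLT K n F) : Lead K n (fun _ => 0) F :=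
  ⟨K.zero_mem, h.congr fun t => by simp⟩

theorem Lead.add {n : ℕ} {l m : T → RatFunc ℂ} {F G : T → Op} (hF : Lead K n l F)
    (hG : Lead K n m G) : Lead K n (fun t => l t + m t) (fun t => F t + G t) :=
  ⟨K.add_mem hF.1 hG.1, (hF.2.add hG.2).congr fun t => by
    rw [mulOp_add, add_mul, add_sub_add_comm]⟩

theorem Lead.congr {n : ℕ} {l m : T → RatFunc ℂ} {F G : T → Op} (hF : Lead K n l F)
    (hm : ∀ t, m t = l t) (h : ∀ t, G t = F t) : Lead K n m G :=
  (funext hm : m = l) ▸ (funext h : G = F) ▸ hF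

theorem Lead.mulOp_mul {n : ℕ} {g l : T → RatFunc ℂ} {F : T → Op} (hg : g ∈ K)
    (hF : Lead K n l F) : Lead K n (fun t => g t * l t) (fun t => mulOp (g t) * F t) :=
  ⟨K.mul_mem hg hF.1, (hF.2.mulOp_mul hg).congr fun t => by
    rw [SE6.mulOp_mul, mul_sub, mul_assoc]⟩

theorem ordLT_commutator [IsDiffClosed K] {g : T → RatFunc ℂ} (hg : g ∈ K) (n : ℕ) :
    OrdLT K n (fun t => D ^ n * mulOp (g t) - mulOp (g t) * D ^ n) := by
  induction n with
  | zero => exact (OrdLT.zero 0).congr fun t => by simp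
  | succ n ih =>
    refine (ih.D_mul.add (OrdLT.single (Nat.lt_succ_self n)
      (IsDiffClosed.deriv_mem _ hg))).congr fun t => ?_
    rw [pow_succ', mul_sub, mul_assoc, ← mul_assoc D (mulOp (g t)), D_mul_mulOp, add_mul]
    noncomm_ring

theorem Lead.mul [IsDiffClosed K] {n m : ℕ} {k l : T → RatFunc ℂ} {F G : T → Op}
    (hF : Lead K n k F) (hG : Lead K m l G) :
    Lead K (n + m) (fun t => k t * l t) (fun t => F t * G t) := by
  refine ⟨K.mul_mem hF.1 hG.1, ((((ordLT_commutator hG.1 n).mulOp_mul hF.1).mul_D_pow m).add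
    ((((hG.2.D_pow_mul n).mono (Nat.add_comm m n).le).mulOp_mul hF.1).add
      (hF.2.mul hG.ordLT))).congr fun t => ?_⟩
  rw [SE6.mulOp_mul, pow_add]
  noncomm_ring

theorem Lead.D_pow [IsDiffClosed K] (n : ℕ) : Lead K n (fun _ => 1) (fun _ => D ^ n) :=
  ⟨K.one_mem, (OrdLT.zero n).congr fun t => by simp⟩

/-- Right division by a family whose leading coefficient does not depend on the parameters. -/
theorem OrdLT.exists_div [IsDiffClosed K] {n : ℕ} {l : RatFunc ℂ} (hl : l ≠ 0) {E : T → Op}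
    (hE : Lead K n (fun _ => l) E) {m : ℕ} {F : T → Op} (hF : OrdLT K m F) :
    ∃ S R : T → Op, OpFam K S ∧ OrdLT K n R ∧ ∀ t, F t = S t * E t + R t := by
  induction m generalizing F with
  | zero =>
    exact ⟨fun _ => 0, F, ⟨0, OrdLT.zero 0⟩, hF.mono (Nat.zero_le n), fun t => by simp⟩
  | succ m ih =>
    rcases Nat.lt_or_ge m n with h | h
    · exact ⟨fun _ => 0, F, ⟨0, OrdLT.zero 0⟩, hF.mono h, fun t => by simp⟩
    · obtain ⟨f, hf⟩ := hF.exists_lead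
      have hg : (fun t => f t * l⁻¹) ∈ K := K.mul_mem hf.1 (IsDiffClosed.const_mem l⁻¹)
      have h1 := ((Lead.D_pow (K := K) (m - n)).mul hE).mulOp_mul hg
      rw [Nat.sub_add_cancel h] at h1
      obtain ⟨S, R, ⟨k, hS⟩, hR, h2⟩ := ih ((hf.2.sub h1.2).congr
        (G := fun t => F t - mulOp (f t * l⁻¹) * (D ^ (m - n) * E t)) fun t => by
          simp only [one_mul, inv_mul_cancel_right₀ hl]
          abel)
      refine ⟨fun t => S t + mulOp (f t * l⁻¹) * D ^ (m - n), R,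
        ⟨max k (m - n + 1), (hS.mono (le_max_left _ _)).add
          (OrdLT.single (lt_of_lt_of_le (Nat.lt_succ_self _) (le_max_right _ _)) hg)⟩, hR,
        fun t => ?_⟩
      rw [add_mul, mul_assoc, add_right_comm, ← h2 t, sub_add_cancel]

/-- Comparison of orders: the order of a left factor is the difference of the orders. -/
theorem OrdLT.of_mul_right [IsDiffClosed K] {n : ℕ} {l : RatFunc ℂ} (hl : l ≠ 0) {E : T → Op}
    (hE : Lead K n (fun _ => l) E) {k m : ℕ} {X : T → Op} (hX : OrdLT K k X)
    (h : OrdLT K (m + n) (fun t => X t * E t)) : OrdLT K m X := by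
  induction k with
  | zero => exact hX.mono (Nat.zero_le m)
  | succ k ih =>
    rcases Nat.lt_or_ge k m with hkm | hkm
    · exact hX.mono hkm
    · obtain ⟨f, hf⟩ := hX.exists_lead
      refine ih (hf.ordLT_of_eq_zero fun t => ?_)
      exact (mul_eq_zero.mp ((hf.mul hE).eq_zero (h.mono (by omega)) t)).resolve_right hl

theorem OpFam.eq_zero_of_mul_right [IsDiffClosed K] {n : ℕ} {l : RatFunc ℂ} (hl : l ≠ 0)
    {E : T → Op} (hE : Lead K n (fun _ => l) E) {X : T → Op} (hX : OpFam K X)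
    (h : OrdLT K n (fun t => X t * E t)) (t : T) : X t = 0 := by
  obtain ⟨k, hk⟩ := hX
  exact OrdLT.eq_zero (OrdLT.of_mul_right hl hE (m := 0) hk (h.mono (Nat.zero_add n).ge)) t

theorem OrdLT.eq_zero_of_mul_left [IsDiffClosed K] {n : ℕ} {l : RatFunc ℂ} (hl : l ≠ 0)
    {E : T → Op} (hE : Lead K n (fun _ => l) E) {k : ℕ} {X : T → Op} (hX : OrdLT K k X)
    (h : ∀ t, E t * X t = 0) (t : T) : X t = 0 := by
  induction k with
  | zero => exact hX.eq_zero t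
  | succ k ih =>
    obtain ⟨f, hf⟩ := hX.exists_lead
    refine ih (hf.ordLT_of_eq_zero fun t => ?_)
    exact (mul_eq_zero.mp ((hE.mul hf).eq_zero ((OrdLT.zero _).congr h) t)).resolve_left hl

theorem OpFam.add {F G : T → Op} (hF : OpFam K F) (hG : OpFam K G) :
    OpFam K (fun t => F t + G t) := by
  obtain ⟨n, hn⟩ := hF
  obtain ⟨m, hm⟩ := hG
  exact ⟨max n m, (hn.mono (le_max_left n m)).add (hm.mono (le_max_right n m))⟩

theorem OpFam.neg {F : T → Op} (hF : OpFam K F) : OpFam K (fun t => -F t) := by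
  obtain ⟨n, hn⟩ := hF
  exact ⟨n, hn.neg⟩

theorem OpFam.sub {F G : T → Op} (hF : OpFam K F) (hG : OpFam K G) :
    OpFam K (fun t => F t - G t) := by
  simpa only [sub_eq_add_neg] using hF.add hG.neg

theorem OpFam.mul [IsDiffClosed K] {F G : T → Op} (hF : OpFam K F) (hG : OpFam K G) :
    OpFam K (fun t => F t * G t) := by
  obtain ⟨n, hn⟩ := hF
  obtain ⟨m, hm⟩ := hG
  exact ⟨n + m, hn.mul (hm.mono (Nat.le_succ m))⟩

theorem OpFam.mulOp {g : T → RatFunc ℂ} (hg : g ∈ K) : OpFam K (fun t => mulOp (g t)) :=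
  ⟨1, (OrdLT.single Nat.zero_lt_one hg).congr fun t => by simp⟩

theorem OpFam.mulOp_const [IsDiffClosed K] (g : RatFunc ℂ) : OpFam K (fun _ => SE6.mulOp g) :=
  OpFam.mulOp (IsDiffClosed.const_mem g)

theorem OpFam.D_pow [IsDiffClosed K] (n : ℕ) : OpFam K (fun _ => D ^ n) :=
  ⟨_, (Lead.D_pow n).ordLT⟩

theorem OrdLT.opFam {n : ℕ} {F : T → Op} (h : OrdLT K n F) : OpFam K F := ⟨n, h⟩

theorem Lead.opFam {n : ℕ} {l : T → RatFunc ℂ} {F : T → Op} (h : Lead K n l F) : OpFam K F :=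
  ⟨_, h.ordLT⟩

theorem OpFam.commute_mulOp {F : T → Op} (hF : OpFam K F) {g : RatFunc ℂ} (hg : ratDeriv g = 0)
    (t : T) : Commute (SE6.mulOp g) (F t) := by
  obtain ⟨n, f, -, hf⟩ := hF
  rw [hf]
  exact Commute.sum_right _ _ _ fun i _ =>
    Commute.mul_right (mulOp_comm g (f i t)) ((commute_D_mulOp hg).pow_right i)

theorem OrdLT.comp {T' : Type*} {K' : Subring (T' → RatFunc ℂ)} {φ : T' → T}
    (hφ : ∀ f ∈ K, (fun t => f (φ t)) ∈ K') {n : ℕ} {F : T → Op} (hF : OrdLT K n F) :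
    OrdLT K' n (fun t => F (φ t)) := by
  obtain ⟨f, hfK, hf⟩ := hF
  exact ⟨fun i t => f i (φ t), fun i => hφ _ (hfK i), fun t => hf (φ t)⟩

theorem Lead.comp {T' : Type*} {K' : Subring (T' → RatFunc ℂ)} {φ : T' → T}
    (hφ : ∀ f ∈ K, (fun t => f (φ t)) ∈ K') {n : ℕ} {l : T → RatFunc ℂ} {F : T → Op}
    (hF : Lead K n l F) : Lead K' n (fun t => l (φ t)) (fun t => F (φ t)) :=
  ⟨hφ _ hF.1, hF.2.comp hφ⟩

theorem OpFam.comp {T' : Type*} {K' : Subring (T' → RatFunc ℂ)} {φ : T' → T}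
    (hφ : ∀ f ∈ K, (fun t => f (φ t)) ∈ K') {F : T → Op} (hF : OpFam K F) :
    OpFam K' (fun t => F (φ t)) := by
  obtain ⟨n, hn⟩ := hF
  exact ⟨n, hn.comp hφ⟩

end

/-! ### Polynomial families of operators -/

/-- The coefficient ring of the families that are polynomial in the seven parameters. -/
noncomputable def paramRing : Subring ((Par → ℂ) → RatFunc ℂ) :=
  (RingHom.pi fun t : Par → ℂ =>
    MvPolynomial.eval fun k => algebraMap ℂ (RatFunc ℂ) (t k)).range

theorem mem_paramRing {f : (Par → ℂ) → RatFunc ℂ} :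
    f ∈ paramRing ↔ ∃ P : MvPolynomial Par (RatFunc ℂ),
      ∀ t : Par → ℂ, MvPolynomial.eval (fun k => algebraMap ℂ (RatFunc ℂ) (t k)) P = f t :=
  ⟨fun ⟨P, h⟩ => ⟨P, fun t => congrFun h t⟩, fun ⟨P, h⟩ => ⟨P, funext h⟩⟩

/-- The coefficient ring of the families over `ℂ` that are polynomial in the parameter. -/
noncomputable def lineRing : Subring (ℂ → RatFunc ℂ) :=
  (RingHom.pi fun z : ℂ => Polynomial.evalRingHom (algebraMap ℂ (RatFunc ℂ) z)).range

theorem mem_lineRing {f : ℂ → RatFunc ℂ} :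
    f ∈ lineRing ↔ ∃ P : (RatFunc ℂ)[X], ∀ z : ℂ, P.eval (algebraMap ℂ (RatFunc ℂ) z) = f z :=
  ⟨fun ⟨P, h⟩ => ⟨P, fun t => congrFun h t⟩, fun ⟨P, h⟩ => ⟨P, funext h⟩⟩

theorem const_mem_paramRing (f : RatFunc ℂ) : (fun _ => f) ∈ paramRing :=
  mem_paramRing.mpr ⟨MvPolynomial.C f, fun t => by simp⟩

theorem coord_mem_paramRing (k : Par) :
    (fun t : Par → ℂ => algebraMap ℂ (RatFunc ℂ) (t k)) ∈ paramRing :=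
  mem_paramRing.mpr ⟨MvPolynomial.X k, fun t => by simp⟩

theorem const_mem_lineRing (f : RatFunc ℂ) : (fun _ => f) ∈ lineRing :=
  mem_lineRing.mpr ⟨Polynomial.C f, fun t => by simp⟩

instance : IsDiffClosed paramRing where
  const_mem := const_mem_paramRing
  deriv_mem := by
    intro f hf
    obtain ⟨P, hP⟩ := mem_paramRing.mp hf
    obtain rfl := funext hP
    clear hP hf
    induction P using MvPolynomial.induction_on with
    | C a =>
      simp only [MvPolynomial.eval_C]
      exact const_mem_paramRing _
    | add p q hp hq =>
      simp only [map_add, ratDeriv_add]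
      exact paramRing.add_mem hp hq
    | mul_X p k hp =>
      simp only [map_mul, MvPolynomial.eval_X, ratDeriv_mul, ratDeriv_algebraMap_const, mul_zero,
        zero_add]
      exact paramRing.mul_mem (coord_mem_paramRing k) hp

instance : IsDiffClosed lineRing where
  const_mem := const_mem_lineRing
  deriv_mem := by
    intro f hf
    obtain ⟨P, hP⟩ := mem_lineRing.mp hf
    obtain rfl := funext hP
    refine mem_lineRing.mpr ⟨P.sum fun i a => monomial i (ratDeriv a), fun z => ?_⟩
    change _ = D (P.eval _)
    rw [Polynomial.sum, Polynomial.eval_finsetSum, Polynomial.eval_eq_sum, Polynomial.sum,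
      map_sum]
    refine Finset.sum_congr rfl fun i _ => ?_
    rw [eval_monomial]
    change _ = ratDeriv _
    rw [← map_pow, ratDeriv_mul, ratDeriv_algebraMap_const, mul_zero, zero_add, mul_comm]

instance {T : Type*} : IsDiffClosed (⊤ : Subring (T → RatFunc ℂ)) where
  const_mem _ := Subring.mem_top _
  deriv_mem _ _ := Subring.mem_top _

/-- The ring of families `K` has no zero divisors. (The ring of all families has, which is why
constants cannot be cancelled without such a condition.) -/
def IsIntegral {T : Type*} (K : Subring (T → RatFunc ℂ)) : Prop :=
  ∀ f ∈ K, ∀ g ∈ K, (∀ t, f t * g t = 0) → (∀ t, f t = 0) ∨ ∀ t, g t = 0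

theorem infinite_range_algebraMap :
    (Set.range (algebraMap ℂ (RatFunc ℂ))).Infinite :=
  Set.infinite_range_of_injective (algebraMap ℂ (RatFunc ℂ)).injective

/-- A polynomial in the parameters over `ℂ(x)` is determined by its values at complex values of
the parameters. -/
theorem mvPolynomial_eq_zero {P : MvPolynomial Par (RatFunc ℂ)}
    (h : ∀ t : Par → ℂ, MvPolynomial.eval (fun k => algebraMap ℂ (RatFunc ℂ) (t k)) P = 0) :
    P = 0 := by
  refine MvPolynomial.funext_set (fun _ => Set.range (algebraMap ℂ (RatFunc ℂ)))
    (fun _ => infinite_range_algebraMap) fun x hx => ?_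
  choose t ht using fun k => hx k (Set.mem_univ k)
  obtain rfl : (fun k => algebraMap ℂ (RatFunc ℂ) (t k)) = x := funext ht
  rw [h t, map_zero]

theorem isIntegral_paramRing : IsIntegral paramRing := by
  intro f hf g hg h
  obtain ⟨P, hP⟩ := mem_paramRing.mp hf
  obtain ⟨Q, hQ⟩ := mem_paramRing.mp hg
  have : P * Q = 0 := mvPolynomial_eq_zero fun t => by rw [map_mul, hP, hQ, h]
  rcases mul_eq_zero.mp this with rfl | rfl
  · exact Or.inl fun t => by rw [← hP, map_zero]
  · exact Or.inr fun t => by rw [← hQ, map_zero]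

theorem isIntegral_lineRing : IsIntegral lineRing := by
  intro f hf g hg h
  obtain ⟨P, hP⟩ := mem_lineRing.mp hf
  obtain ⟨Q, hQ⟩ := mem_lineRing.mp hg
  have : P * Q = 0 := by
    refine Polynomial.eq_zero_of_infinite_isRoot _ (infinite_range_algebraMap.mono ?_)
    rintro _ ⟨z, rfl⟩
    change eval _ (P * Q) = 0
    rw [eval_mul, hP, hQ, h]
  rcases mul_eq_zero.mp this with rfl | rfl
  · exact Or.inl fun t => by rw [← hP, eval_zero]
  · exact Or.inr fun t => by rw [← hQ, eval_zero]

section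

variable {T : Type*} {K : Subring (T → RatFunc ℂ)}

theorem OrdLT.eq_zero_of_mulOp_mul (hK : IsIntegral K) {d : T → RatFunc ℂ} (hd : d ∈ K)
    (hd0 : ¬ ∀ t, d t = 0) {k : ℕ} {R : T → Op} (hR : OrdLT K k R)
    (h : ∀ t, mulOp (d t) * R t = 0) (t : T) : R t = 0 := by
  induction k with
  | zero => exact hR.eq_zero t
  | succ k ih =>
    obtain ⟨f, hf⟩ := hR.exists_lead
    refine ih (hf.ordLT_of_eq_zero ?_)
    exact (hK d hd f hf.1 fun t =>
      (hf.mulOp_mul hd).eq_zero ((OrdLT.zero k).congr h) t).resolve_left hd0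

/-- A constant factor `d` of `P` can be cancelled from the relation `E' * P = Q * E`, and the
cofactor has order lower than the order of `E`. -/
theorem exists_cofactor [IsDiffClosed K] (hK : IsIntegral K) {n : ℕ} {l : RatFunc ℂ} (hl : l ≠ 0)
    {E E' : T → Op} (hE : Lead K (n + 1) (fun _ => l) E) (hE' : Lead K (n + 1) (fun _ => l) E')
    {d : T → RatFunc ℂ} (hd : d ∈ K) (hd0 : ¬ ∀ t, d t = 0) (hd' : ∀ t, ratDeriv (d t) = 0)
    {P Q : T → Op} (hP : OrdLT K (n + 1) P) (hQ : OpFam K Q)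
    (h : ∀ t, E' t * (mulOp (d t) * P t) = Q t * E t) :
    ∃ Q', OrdLT K (n + 1) Q' ∧ ∀ t, E' t * P t = Q' t * E t := by
  have h1 : OrdLT K (n + 1 + (n + 1)) (fun t => E' t * P t) :=
    (hE'.ordLT.mul hP).mono (by omega)
  obtain ⟨S, R, hS, hR, h2⟩ := h1.exists_div hl hE
  have h3 : ∀ t, (Q t - mulOp (d t) * S t) * E t = mulOp (d t) * R t := fun t => by
    rw [sub_mul, ← h, ← mul_assoc, ← (hE'.opFam.commute_mulOp (hd' t) t).eq, mul_assoc, h2,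
      mul_add, mul_assoc, add_sub_cancel_left]
  have h4 := OpFam.eq_zero_of_mul_right hl hE (hQ.sub ((OpFam.mulOp hd).mul hS))
    ((hR.mulOp_mul hd).congr h3)
  have h5 : ∀ t, R t = 0 :=
    hR.eq_zero_of_mulOp_mul hK hd hd0 fun t => by rw [← h3, h4, zero_mul]
  have h6 : ∀ t, E' t * P t = S t * E t := fun t => by rw [h2, h5, add_zero]
  obtain ⟨k, hk⟩ := hS
  exact ⟨S, hk.of_mul_right hl hE (h1.congr fun t => (h6 t).symm), h6⟩

end

theorem ordLT_paramRing_iff {n : ℕ} {F : (Par → ℂ) → Op} :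
    OrdLT paramRing n F ↔ ∃ P : Fin n → MvPolynomial Par (RatFunc ℂ),
      ∀ t, F t = ofCoeffs (specialize P t) := by
  constructor
  · rintro ⟨f, hfK, hf⟩
    choose P hP using fun i => mem_paramRing.mp (hfK i)
    refine ⟨fun i => P i, fun t => ?_⟩
    simp only [hf, ofCoeffs, specialize, hP, Finset.sum_range]
  · rintro ⟨P, hP⟩
    refine ⟨fun i => if h : i < n then fun t => specialize P t ⟨i, h⟩ else 0, fun i => ?_,
      fun t => ?_⟩
    · dsimp only
      split_ifs
      · exact mem_paramRing.mpr ⟨_, fun t => rfl⟩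
      · exact paramRing.zero_mem
    · rw [hP, ofCoeffs, Finset.sum_range]
      simp

theorem specialize_eq_zero {n : ℕ} {P : Fin n → MvPolynomial Par (RatFunc ℂ)}
    (h : ∀ t, ofCoeffs (specialize P t) = 0) : P = 0 :=
  funext fun i => mvPolynomial_eq_zero fun t => congrFun (ofCoeffs_injective _ (h t)) i

theorem totalDegree_map_algebraMap (d : MvPolynomial Par ℂ) :
    (MvPolynomial.map (algebraMap ℂ (RatFunc ℂ)) d).totalDegree = d.totalDegree := by
  rw [MvPolynomial.totalDegree, MvPolynomial.totalDegree,
    MvPolynomial.support_map_of_injective _ (algebraMap ℂ (RatFunc ℂ)).injective]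

/-- The first part of the definition of admitting a shift, from a relation in which the
coefficients of `P` may have a common factor: a solution of minimal total degree has none. -/
theorem exists_noCommonFactor {n : ℕ} {l : RatFunc ℂ} (hl : l ≠ 0) {E E' : (Par → ℂ) → Op}
    (hE : Lead paramRing (n + 1) (fun _ => l) E) (hE' : Lead paramRing (n + 1) (fun _ => l) E')
    {P Q : (Par → ℂ) → Op} (hP : OrdLT paramRing (n + 1) P) (hQ : OpFam paramRing Q)
    (hP0 : ¬ ∀ t, P t = 0) (h : ∀ t, E' t * P t = Q t * E t) :
    ∃ P Q : Fin (n + 1) → MvPolynomial Par (RatFunc ℂ), P ≠ 0 ∧ Q ≠ 0 ∧ NoCommonFactor P ∧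
      ∀ t, E' t * ofCoeffs (specialize P t) = ofCoeffs (specialize Q t) * E t := by
  obtain ⟨P₀, hP₀⟩ := ordLT_paramRing_iff.mp hP
  let s : Set (Fin (n + 1) → MvPolynomial Par (RatFunc ℂ)) :=
    {P | P ≠ 0 ∧ ∃ Q, OpFam paramRing Q ∧ ∀ t, E' t * ofCoeffs (specialize P t) = Q t * E t}
  have hs : s.Nonempty := by
    refine ⟨P₀, ?_, Q, hQ, fun t => by rw [← hP₀, h]⟩
    rintro rfl
    exact hP0 fun t => by simp [hP₀, ofCoeffs, specialize]
  -- Dividing `P` by a nonconstant common factor of its coefficients would lower the degree.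
  obtain ⟨P, ⟨hPne, Q, hQ, hPQ⟩, hmin⟩ := WellFounded.has_min
    (InvImage.wf (fun P : Fin (n + 1) → MvPolynomial Par (RatFunc ℂ) =>
      ∑ i, (P i).totalDegree) Nat.lt_wfRel.wf) s hs
  obtain ⟨Q', hQ', hPQ'⟩ := exists_cofactor isIntegral_paramRing hl hE hE'
    (d := fun _ => 1) paramRing.one_mem (fun h => one_ne_zero (h 0))
    (fun _ => by simpa using ratDeriv_algebraMap_const 1)
    (ordLT_paramRing_iff.mpr ⟨P, fun t => rfl⟩) hQ fun t => by rw [mulOp_one, one_mul, hPQ]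
  obtain ⟨Q₀, hQ₀⟩ := ordLT_paramRing_iff.mp hQ'
  refine ⟨P, Q₀, hPne, ?_, fun d hd => ?_, fun t => by rw [hPQ', hQ₀]⟩
  · rintro rfl
    refine hPne (specialize_eq_zero fun t => ?_)
    refine OrdLT.eq_zero_of_mul_left hl hE' (ordLT_paramRing_iff.mpr ⟨P, fun t => rfl⟩)
      (fun t => ?_) t
    rw [hPQ', hQ₀]
    simp [ofCoeffs, specialize]
  · choose P' hP' using hd
    obtain ⟨i₀, hi₀⟩ : ∃ i, P i ≠ 0 := by
      by_contra! h0
      exact hPne (funext h0)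
    have hd0 : MvPolynomial.map (algebraMap ℂ (RatFunc ℂ)) d ≠ 0 := fun h0 => hi₀ (by
      rw [hP', h0, zero_mul])
    have heval : ∀ t : Par → ℂ, MvPolynomial.eval (fun k => algebraMap ℂ (RatFunc ℂ) (t k))
        (MvPolynomial.map (algebraMap ℂ (RatFunc ℂ)) d) =
          algebraMap ℂ (RatFunc ℂ) (MvPolynomial.eval t d) := fun t => by
      rw [MvPolynomial.eval_map, MvPolynomial.eval₂_comp]
      rfl
    obtain ⟨Q₁, hQ₁, hPQ₁⟩ := exists_cofactor isIntegral_paramRing hl hE hE'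
      (P := fun t => ofCoeffs (specialize P' t))
      (mem_paramRing.mpr ⟨MvPolynomial.map (algebraMap ℂ (RatFunc ℂ)) d, fun t => rfl⟩)
      (fun h0 => hd0 (mvPolynomial_eq_zero h0))
      (fun t => by rw [heval, ratDeriv_algebraMap_const])
      (ordLT_paramRing_iff.mpr ⟨P', fun t => rfl⟩) hQ fun t => by
        rw [← hPQ]
        congr 1
        simp only [ofCoeffs, specialize, Finset.mul_sum, ← mul_assoc, ← mulOp_mul]
        refine Finset.sum_congr rfl fun i _ => ?_
        rw [hP' i, map_mul]
    have hlt := hmin P' ⟨fun h0 => hi₀ (by rw [hP', h0, Pi.zero_apply, mul_zero]), Q₁,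
      hQ₁.opFam, hPQ₁⟩
    rw [MvPolynomial.isUnit_iff_totalDegree_of_isReduced]
    have hdeg : d.totalDegree = 0 := by
      by_contra hpos
      refine hlt (Finset.sum_lt_sum (fun i _ => ?_) ⟨i₀, Finset.mem_univ _, ?_⟩)
      · by_cases hi : P' i = 0
        · rw [hi, MvPolynomial.totalDegree_zero]
          exact Nat.zero_le _
        · rw [hP' i, MvPolynomial.totalDegree_mul_of_isDomain hd0 hi]
          exact Nat.le_add_left _ _
      · have hi : P' i₀ ≠ 0 := fun h0 => hi₀ (by rw [hP', h0, mul_zero])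
        rw [hP' i₀, MvPolynomial.totalDegree_mul_of_isDomain hd0 hi, totalDegree_map_algebraMap]
        omega
    refine ⟨?_, hdeg⟩
    rw [MvPolynomial.totalDegree_eq_zero_iff_eq_C.mp hdeg] at hd0 ⊢
    rw [MvPolynomial.coeff_C, if_pos rfl]
    refine isUnit_iff_ne_zero.mpr fun h0 => hd0 ?_
    rw [h0, map_zero, map_zero]

/-- The highest power of `X` can be divided out of a nonzero vector of polynomials. -/
theorem exists_X_pow_mul {n : ℕ} {p : Fin n → (RatFunc ℂ)[X]} (hp : p ≠ 0) :
    ∃ (k : ℕ) (q : Fin n → (RatFunc ℂ)[X]), (∀ i, p i = X ^ k * q i) ∧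
      ∃ i, (q i).eval 0 ≠ 0 := by
  obtain ⟨i₀, hi₀⟩ : ∃ i, p i ≠ 0 := by
    by_contra! h0
    exact hp (funext h0)
  clear hp
  induction hN : (p i₀).natDegree using Nat.strong_induction_on generalizing p with
  | _ N ih =>
    by_cases h : ∃ i, (p i).eval 0 ≠ 0
    · exact ⟨0, p, fun i => by simp, h⟩
    · push Not at h
      choose q hq using fun i => (X_dvd_iff (f := p i)).mpr (by
        rw [coeff_zero_eq_eval_zero]
        exact h i)
      have hq0 : q i₀ ≠ 0 := fun h0 => hi₀ (by rw [hq, h0, mul_zero])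
      have hlt : (q i₀).natDegree < N := by
        rw [← hN, hq i₀, natDegree_X_mul hq0]
        exact Nat.lt_succ_self _
      obtain ⟨k, r, hr, hr0⟩ := ih _ hlt hq0 rfl
      exact ⟨k + 1, r, fun i => by rw [hq, hr, pow_succ', mul_assoc], hr0⟩

/-- The second part of the definition of admitting a shift. At a zero `t₀` of `P` the relation is
restricted to a line through `t₀`, and divided by a power of the parameter of the line. -/
theorem exists_isShiftOperator {n : ℕ} {l : RatFunc ℂ} (hl : l ≠ 0) {E E' : (Par → ℂ) → Op}
    (hE : Lead paramRing (n + 1) (fun _ => l) E) (hE' : Lead paramRing (n + 1) (fun _ => l) E')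
    {P Q : Fin (n + 1) → MvPolynomial Par (RatFunc ℂ)} (hP0 : P ≠ 0)
    (h : ∀ t, E' t * ofCoeffs (specialize P t) = ofCoeffs (specialize Q t) * E t) (t₀ : Par → ℂ) :
    ∃ A B : Op, IsShiftOperator (n + 1) (E t₀) (E' t₀) A B := by
  obtain ⟨t₁, ht₁⟩ : ∃ t₁, specialize P t₁ ≠ 0 := by
    by_contra! h0
    exact hP0 (specialize_eq_zero fun t => by rw [h0]; simp [ofCoeffs])
  -- `P` does not vanish identically on the line `φ` through `t₀` and `t₁`; `ψ` restricts
  -- polynomials to this line.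
  let φ : ℂ → Par → ℂ := fun z => t₀ + z • (t₁ - t₀)
  let ψ : MvPolynomial Par (RatFunc ℂ) →+* (RatFunc ℂ)[X] := MvPolynomial.eval₂Hom Polynomial.C
    fun k => Polynomial.C (algebraMap ℂ (RatFunc ℂ) (t₀ k)) +
      Polynomial.X * Polynomial.C (algebraMap ℂ (RatFunc ℂ) (t₁ k - t₀ k))
  have hψ : ∀ (p : MvPolynomial Par (RatFunc ℂ)) (z : ℂ),
      (ψ p).eval (algebraMap ℂ (RatFunc ℂ) z) =
        MvPolynomial.eval (fun k => algebraMap ℂ (RatFunc ℂ) (φ z k)) p := by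
    intro p z
    induction p using MvPolynomial.induction_on with
    | C a => simp [ψ]
    | add p q hp hq => rw [map_add, eval_add, hp, hq, map_add]
    | mul_X p k hp =>
      rw [map_mul, eval_mul, hp, map_mul]
      simp [ψ, φ]
  have hφ : ∀ f ∈ paramRing, (fun z => f (φ z)) ∈ lineRing := by
    intro f hf
    obtain ⟨p, hp⟩ := mem_paramRing.mp hf
    exact mem_lineRing.mpr ⟨ψ p, fun z => by rw [hψ, hp]⟩
  have hne : (fun i => ψ (P i)) ≠ 0 := by
    intro h0
    refine ht₁ (funext fun i => ?_)
    have h1 := hψ (P i) 1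
    rw [show ψ (P i) = 0 from congrFun h0 i, eval_zero] at h1
    rw [Pi.zero_apply, h1]
    simp [specialize, φ]
  obtain ⟨k, q, hq, i₀, hi₀⟩ := exists_X_pow_mul hne
  have hqO : OrdLT lineRing (n + 1)
      (fun z => ofCoeffs fun i => (q i).eval (algebraMap ℂ (RatFunc ℂ) z)) := by
    refine ⟨fun i => if h : i < n + 1 then
      fun z => (q ⟨i, h⟩).eval (algebraMap ℂ (RatFunc ℂ) z) else 0, fun i => ?_, fun t => ?_⟩
    · dsimp only
      split_ifs
      · exact mem_lineRing.mpr ⟨_, fun t => rfl⟩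
      · exact lineRing.zero_mem
    · rw [Finset.sum_range]
      exact Finset.sum_congr rfl fun i _ => by simp only [dif_pos i.2]
  obtain ⟨Q', hQ', hPQ'⟩ := exists_cofactor isIntegral_lineRing hl (hE.comp hφ) (hE'.comp hφ)
    (d := fun z => algebraMap ℂ (RatFunc ℂ) (z ^ k))
    (mem_lineRing.mpr ⟨X ^ k, fun z => by rw [eval_pow, eval_X, map_pow]⟩)
    (fun h0 => by simpa using h0 1) (fun z => ratDeriv_algebraMap_const _) hqO
    ((OrdLT.comp hφ (ordLT_paramRing_iff.mpr ⟨Q, fun t => rfl⟩)).opFam) fun z => by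
      rw [← h]
      congr 1
      simp only [ofCoeffs, specialize, Finset.mul_sum, ← mul_assoc, ← mulOp_mul]
      refine Finset.sum_congr rfl fun i _ => ?_
      rw [← hψ, hq i, eval_mul, eval_pow, eval_X, map_pow]
  obtain ⟨w, -, hw⟩ := hQ'
  have h0 : φ 0 = t₀ := by simp [φ]
  have h1 := hPQ' 0
  simp only [h0] at h1
  have hA : (ofCoeffs fun i => (q i).eval (algebraMap ℂ (RatFunc ℂ) 0)) ≠ 0 := fun h2 =>
    hi₀ (by simpa using congrFun (ofCoeffs_injective _ h2) i₀)
  refine ⟨_, Q' 0, ⟨_, rfl⟩, ⟨fun i => w i 0, by rw [hw, Finset.sum_range]; rfl⟩, hA,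
    fun h2 => ?_, h1⟩
  rw [h2, zero_mul] at h1
  -- For a single value of the parameters the ring of all functions serves as coefficient ring.
  refine hA (OrdLT.eq_zero_of_mul_left (T := Unit) (K := ⊤) hl
    (E := fun _ => E' t₀) (hE'.comp (φ := fun _ => t₀) fun _ _ => Subring.mem_top _)
    (hqO.comp (φ := fun _ => 0) fun _ _ => Subring.mem_top _) (fun _ => h1) ())

/-! ### Polynomial functions of the parameters -/

/-- `c` is a polynomial function of the parameters (with coefficients in `ℂ(x)`, which is
harmless). -/
@[fun_prop]
def PolyFun (c : (Par → ℂ) → ℂ) : Prop :=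
  (fun t => algebraMap ℂ (RatFunc ℂ) (c t)) ∈ paramRing

@[fun_prop]
theorem PolyFun.const (c : ℂ) : PolyFun (fun _ => c) := const_mem_paramRing _

@[fun_prop]
theorem PolyFun.coord (k : Par) : PolyFun (fun t => t k) := coord_mem_paramRing k

@[fun_prop]
theorem PolyFun.add {c d : (Par → ℂ) → ℂ} (hc : PolyFun c) (hd : PolyFun d) :
    PolyFun (fun t => c t + d t) := by
  simp only [PolyFun, map_add]
  exact paramRing.add_mem hc hd

@[fun_prop]
theorem PolyFun.mul {c d : (Par → ℂ) → ℂ} (hc : PolyFun c) (hd : PolyFun d) :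
    PolyFun (fun t => c t * d t) := by
  simp only [PolyFun, map_mul]
  exact paramRing.mul_mem hc hd

@[fun_prop]
theorem PolyFun.neg {c : (Par → ℂ) → ℂ} (hc : PolyFun c) : PolyFun (fun t => -c t) := by
  simp only [PolyFun, map_neg]
  exact paramRing.neg_mem hc

@[fun_prop]
theorem PolyFun.sub {c d : (Par → ℂ) → ℂ} (hc : PolyFun c) (hd : PolyFun d) :
    PolyFun (fun t => c t - d t) := by
  simp only [PolyFun, map_sub]
  exact paramRing.sub_mem hc hd

@[fun_prop]
theorem PolyFun.pow {c : (Par → ℂ) → ℂ} (hc : PolyFun c) (n : ℕ) :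
    PolyFun (fun t => c t ^ n) := by
  simp only [PolyFun, map_pow]
  exact paramRing.pow_mem hc n

@[fun_prop]
theorem PolyFun.div_const {c : (Par → ℂ) → ℂ} (hc : PolyFun c) (k : ℂ) :
    PolyFun (fun t => c t / k) := by
  simp only [div_eq_mul_inv]
  fun_prop

/-- `paramRing` is stable under polynomial substitutions of the parameters. -/
theorem comp_mem_paramRing {φ : (Par → ℂ) → Par → ℂ} (hφ : ∀ k, PolyFun fun t => φ t k)
    (f : (Par → ℂ) → RatFunc ℂ) (hf : f ∈ paramRing) : (fun t => f (φ t)) ∈ paramRing := by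
  obtain ⟨P, hP⟩ := mem_paramRing.mp hf
  obtain rfl := funext hP
  clear hP hf
  induction P using MvPolynomial.induction_on with
  | C a =>
    simp only [MvPolynomial.eval_C]
    exact const_mem_paramRing a
  | add p q hp hq =>
    simp only [map_add]
    exact paramRing.add_mem hp hq
  | mul_X p k hp =>
    simp only [map_mul, MvPolynomial.eval_X]
    exact paramRing.mul_mem hp (hφ k)

theorem polyFun_add_const (v : Par → ℂ) (k : Par) : PolyFun fun t => (t + v) k :=
  (PolyFun.coord k).add (PolyFun.const (v k))

theorem OpFam.shift {F : (Par → ℂ) → Op} (hF : OpFam paramRing F) (v : Par → ℂ) :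
    OpFam paramRing (fun t => F (t + v)) :=
  hF.comp (comp_mem_paramRing (polyFun_add_const v))

/-! ### Composition of shifts -/

/-- The family `E` has a shift operator `P` for the shift by `v`, with values not all of which
are left multiples of `E`; there is no bound on the orders. -/
def HasShift (E : (Par → ℂ) → Op) (v : Par → ℂ) : Prop :=
  ∃ P Q : (Par → ℂ) → Op, OpFam paramRing P ∧ OpFam paramRing Q ∧
    (∀ t, E (t + v) * P t = Q t * E t) ∧ ¬ ∃ S, OpFam paramRing S ∧ ∀ t, P t = S t * E t

/-- `P` is a shift operator of `E` for the shift by `v`, and `B` is a shift operator in the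
opposite direction for which `P * B` is congruent to a nonzero constant `κ` (which may depend on
the parameters) modulo left multiples of the shifted `E`. -/
structure IsInvShift (E : (Par → ℂ) → Op) (v : Par → ℂ) (P Q B R S : (Par → ℂ) → Op)
    (κ : (Par → ℂ) → RatFunc ℂ) : Prop where
  famP : OpFam paramRing P
  famQ : OpFam paramRing Q
  famB : OpFam paramRing B
  famR : OpFam paramRing R
  famS : OpFam paramRing S
  mem : κ ∈ paramRing
  ne_zero : ¬ ∀ t, κ t = 0
  deriv_eq : ∀ t, ratDeriv (κ t) = 0
  shift : ∀ t, E (t + v) * P t = Q t * E t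
  shift_inv : ∀ t, E t * B t = R t * E (t + v)
  mul_inv : ∀ t, P t * B t = mulOp (κ t) + S t * E (t + v)

/-- The operators `P` that are part of an invertible shift operator. -/
def InvShift (E : (Par → ℂ) → Op) (v : Par → ℂ) (P : (Par → ℂ) → Op) : Prop :=
  ∃ Q B R S κ, IsInvShift E v P Q B R S κ

/-- The family `E` has an invertible shift operator for the shift by `v`. -/
def HasInvShift (E : (Par → ℂ) → Op) (v : Par → ℂ) : Prop := ∃ P, InvShift E v P

section

variable {E : (Par → ℂ) → Op} {v w : Par → ℂ}

theorem not_forall_shift {κ : (Par → ℂ) → RatFunc ℂ} (h : ¬ ∀ t, κ t = 0) (v : Par → ℂ) :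
    ¬ ∀ t, κ (t + v) = 0 := fun h0 => h fun t => by simpa using h0 (t - v)

theorem InvShift.mul {P₁ P₂ : (Par → ℂ) → Op} (h₁ : InvShift E v P₁) (h₂ : InvShift E w P₂) :
    InvShift E (v + w) (fun t => P₂ (t + v) * P₁ t) := by
  obtain ⟨Q₁, B₁, R₁, S₁, κ₁, h₁⟩ := h₁
  obtain ⟨Q₂, B₂, R₂, S₂, κ₂, h₂⟩ := h₂
  refine ⟨fun t => Q₂ (t + v) * Q₁ t, fun t => B₁ t * B₂ (t + v), fun t => R₁ t * R₂ (t + v),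
    fun t => mulOp (κ₁ t) * S₂ (t + v) + P₂ (t + v) * S₁ t * R₂ (t + v),
    fun t => κ₁ t * κ₂ (t + v), ?_⟩
  have hκ : (fun t => κ₂ (t + v)) ∈ paramRing :=
    comp_mem_paramRing (polyFun_add_const v) κ₂ h₂.mem
  exact
    { famP := (h₂.famP.shift v).mul h₁.famP
      famQ := (h₂.famQ.shift v).mul h₁.famQ
      famB := h₁.famB.mul (h₂.famB.shift v)
      famR := h₁.famR.mul (h₂.famR.shift v)
      famS := ((OpFam.mulOp h₁.mem).mul (h₂.famS.shift v)).add
        (((h₂.famP.shift v).mul h₁.famS).mul (h₂.famR.shift v))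
      mem := paramRing.mul_mem h₁.mem hκ
      ne_zero := fun h0 => (isIntegral_paramRing _ h₁.mem _ hκ h0).elim h₁.ne_zero
        (not_forall_shift h₂.ne_zero v)
      deriv_eq := fun t => by
        rw [ratDeriv_mul, h₁.deriv_eq, h₂.deriv_eq, mul_zero, mul_zero, add_zero]
      shift := fun t => by
        rw [← add_assoc, ← mul_assoc, h₂.shift, mul_assoc, h₁.shift, mul_assoc]
      shift_inv := fun t => by
        rw [← mul_assoc, h₁.shift_inv, mul_assoc, h₂.shift_inv, ← add_assoc, mul_assoc]
      mul_inv := fun t => by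
        have hc := h₂.famP.commute_mulOp (h₁.deriv_eq t) (t + v)
        calc P₂ (t + v) * P₁ t * (B₁ t * B₂ (t + v))
            = P₂ (t + v) * (P₁ t * B₁ t) * B₂ (t + v) := by noncomm_ring
          _ = P₂ (t + v) * mulOp (κ₁ t) * B₂ (t + v) +
                P₂ (t + v) * S₁ t * (E (t + v) * B₂ (t + v)) := by
              rw [h₁.mul_inv]
              noncomm_ring
          _ = mulOp (κ₁ t) * (P₂ (t + v) * B₂ (t + v)) +
                P₂ (t + v) * S₁ t * (E (t + v) * B₂ (t + v)) := by
              rw [← hc.eq, mul_assoc]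
          _ = _ := by
              rw [h₂.mul_inv, h₂.shift_inv, ← add_assoc, mulOp_mul]
              noncomm_ring }

theorem HasInvShift.add (h₁ : HasInvShift E v) (h₂ : HasInvShift E w) :
    HasInvShift E (v + w) := by
  obtain ⟨P₁, h₁⟩ := h₁
  obtain ⟨P₂, h₂⟩ := h₂
  exact ⟨_, h₁.mul h₂⟩

theorem hasInvShift_zero : HasInvShift E 0 :=
  ⟨fun _ => 1, fun _ => 1, fun _ => 1, fun _ => 1, fun _ => 0, fun _ => 1,
    { famP := by simpa using OpFam.D_pow (K := paramRing) 0
      famQ := by simpa using OpFam.D_pow (K := paramRing) 0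
      famB := by simpa using OpFam.D_pow (K := paramRing) 0
      famR := by simpa using OpFam.D_pow (K := paramRing) 0
      famS := ⟨0, OrdLT.zero 0⟩
      mem := paramRing.one_mem
      ne_zero := fun h => one_ne_zero (h 0)
      deriv_eq := fun _ => by simpa using ratDeriv_algebraMap_const 1
      shift := fun t => by simp
      shift_inv := fun t => by simp
      mul_inv := fun t => by simp }⟩

theorem HasInvShift.nsmul (h : HasInvShift E v) (n : ℕ) : HasInvShift E (n • v) := by
  induction n with
  | zero => simpa using hasInvShift_zero
  | succ n ih =>
    rw [succ_nsmul]
    exact ih.add h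

theorem HasInvShift.zsmul (h : HasInvShift E v) (h' : HasInvShift E (-v)) (n : ℤ) :
    HasInvShift E (n • v) := by
  obtain ⟨n, rfl | rfl⟩ := n.eq_nat_or_neg
  · rw [natCast_zsmul]
    exact h.nsmul n
  · rw [neg_smul, natCast_zsmul, ← smul_neg]
    exact h'.nsmul n

/-- A shift operator that is not a left multiple of `E` stays so when an invertible shift
operator is applied before it. -/
theorem HasInvShift.add_hasShift {n : ℕ} {l : RatFunc ℂ} (hl : l ≠ 0)
    (hE : Lead paramRing (n + 1) (fun _ => l) E) (h₁ : HasInvShift E v) {P Q : (Par → ℂ) → Op}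
    (hP : OrdLT paramRing (n + 1) P) (hQ : OpFam paramRing Q) (hP0 : ¬ ∀ t, P t = 0)
    (h : ∀ t, E (t + w) * P t = Q t * E t) : HasShift E (v + w) := by
  obtain ⟨P₁, Q₁, B₁, R₁, S₁, κ₁, h₁⟩ := h₁
  refine ⟨fun t => P (t + v) * P₁ t, fun t => Q (t + v) * Q₁ t,
    (hP.opFam.shift v).mul h₁.famP, (hQ.shift v).mul h₁.famQ, fun t => ?_, ?_⟩
  · rw [← add_assoc, ← mul_assoc, h, mul_assoc, h₁.shift, mul_assoc]
  · -- If `P * P₁` were a left multiple of `E`, so would be `P * P₁ * B₁`, which is `κ₁ * P` modulo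
    -- `E`; but the order of `κ₁ * P` is lower than that of `E`.
    rintro ⟨S, hS, hPS⟩
    have hsh := comp_mem_paramRing (polyFun_add_const v)
    have h2 : ∀ t, (S t * R₁ t - P (t + v) * S₁ t) * E (t + v) = mulOp (κ₁ t) * P (t + v) :=
      fun t => by
        have hc := hP.opFam.commute_mulOp (h₁.deriv_eq t) (t + v)
        rw [sub_mul, mul_assoc, ← h₁.shift_inv, ← mul_assoc, ← hPS, mul_assoc, h₁.mul_inv, hc.eq]
        noncomm_ring
    have h3 : OrdLT paramRing (n + 1) fun t => mulOp (κ₁ t) * P (t + v) :=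
      (hP.comp hsh).mulOp_mul h₁.mem
    have h4 := OpFam.eq_zero_of_mul_right hl (hE.comp hsh)
      ((hS.mul h₁.famR).sub ((hP.opFam.shift v).mul h₁.famS)) (h3.congr h2)
    refine hP0 fun t => ?_
    have h5 := (hP.comp hsh).eq_zero_of_mulOp_mul isIntegral_paramRing h₁.mem h₁.ne_zero
      (fun t => by rw [← h2, h4, zero_mul]) (t - v)
    simpa using h5

theorem HasInvShift.hasShift {n : ℕ} {l : RatFunc ℂ} (hl : l ≠ 0)
    (hE : Lead paramRing (n + 1) (fun _ => l) E) (h : HasInvShift E v) : HasShift E v := by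
  have h1 : OrdLT paramRing (n + 1) fun _ : Par → ℂ => (1 : Op) :=
    ((Lead.D_pow (K := paramRing) 0).ordLT.mono (by omega)).congr fun _ => by simp
  have := h.add_hasShift (w := 0) hl hE h1 h1.opFam (fun h0 => one_ne_zero (h0 0))
    fun t => by simp
  rwa [add_zero] at this

theorem HasShift.admitsShift {n : ℕ} {l : RatFunc ℂ} (hl : l ≠ 0)
    (hE : Lead paramRing (n + 1) (fun _ => l) E) (h : HasShift E v) :
    AdmitsShift (n + 1) E v := by
  obtain ⟨P, Q, ⟨k, hP⟩, hQ, hPQ, hne⟩ := h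
  obtain ⟨S, R, hS, hR, hPSR⟩ := hP.exists_div hl hE
  have hE' : Lead paramRing (n + 1) (fun _ => l) fun t => E (t + v) :=
    hE.comp (comp_mem_paramRing (polyFun_add_const v))
  have h1 : ∀ t, E (t + v) * R t = (Q t - E (t + v) * S t) * E t := fun t => by
    rw [sub_mul, ← hPQ, hPSR]
    noncomm_ring
  obtain ⟨P₀, Q₀, hP₀, hQ₀, hcf, h₀⟩ := exists_noCommonFactor hl hE hE' hR
    (hQ.sub (hE'.opFam.mul hS))
    (fun h0 => hne ⟨S, hS, fun t => by rw [hPSR, h0, add_zero]⟩) h1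
  exact ⟨⟨P₀, Q₀, hP₀, hQ₀, hcf, h₀⟩, fun t => exists_isShiftOperator hl hE hE' hP₀ h₀ t⟩

/-- A symmetry `σ` of the family `E` transports invertible shifts. -/
theorem HasInvShift.of_symm {σ : (Par → ℂ) → Par → ℂ} (hσ : ∀ k, PolyFun fun t => σ t k)
    (hσσ : ∀ t, σ (σ t) = t) (hE : ∀ t, E (σ t) = E t) (hv : ∀ t, σ (t + v) = σ t + w)
    (h : HasInvShift E w) : HasInvShift E v := by
  obtain ⟨P, Q, B, R, S, κ, h⟩ := h
  have hc := comp_mem_paramRing hσ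
  have hEv : ∀ t, E (t + v) = E (σ t + w) := fun t => by rw [← hv, hE]
  exact ⟨fun t => P (σ t), fun t => Q (σ t), fun t => B (σ t), fun t => R (σ t),
    fun t => S (σ t), fun t => κ (σ t),
    { famP := h.famP.comp hc
      famQ := h.famQ.comp hc
      famB := h.famB.comp hc
      famR := h.famR.comp hc
      famS := h.famS.comp hc
      mem := hc κ h.mem
      ne_zero := fun h0 => h.ne_zero fun t => by simpa only [hσσ] using h0 (σ t)
      deriv_eq := fun t => h.deriv_eq _
      shift := fun t => by rw [hEv, h.shift, hE]
      shift_inv := fun t => by rw [hEv, ← h.shift_inv, hE]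
      mul_inv := fun t => by rw [hEv, h.mul_inv] }⟩

/-- A first-order operator `F` for which `u * E` commutes past `F` up to the shift by `v` is an
invertible shift operator, and so is the quotient `A` of `u * E` by `F`: the remainder of this
division is constant, because `u * E = A * F + ρ` and `u * E (t + v) = F * A + ρ`. -/
theorem hasInvShift_of_first_order {n : ℕ} {l m u : RatFunc ℂ} (hm : m ≠ 0) (hu : u ≠ 0)
    (hE : Lead paramRing n (fun _ => l) E) {F : (Par → ℂ) → Op}
    (hF : Lead paramRing 1 (fun _ => m) F)
    (h : ∀ t, mulOp u * E (t + v) * F t = F t * (mulOp u * E t))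
    {t₀ : Par → ℂ} {f : RatFunc ℂ} (hFf : F t₀ f = 0) (hEf : E t₀ f ≠ 0) :
    InvShift E v F ∧ HasInvShift E (-v) := by
  have hsh := comp_mem_paramRing (polyFun_add_const v)
  have hshn := comp_mem_paramRing (polyFun_add_const (-v))
  have huE : OrdLT paramRing (n + 1) fun t => mulOp u * E t :=
    hE.ordLT.mulOp_mul (const_mem_paramRing u)
  obtain ⟨A, R, hA, hR, hEA⟩ := huE.exists_div hm hF
  obtain ⟨r, hr⟩ := hR.exists_lead
  have hRr : ∀ t, R t = mulOp (r t) := fun t => by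
    have := hr.2.eq_zero t
    rwa [pow_zero, mul_one, sub_eq_zero] at this
  simp only [hRr] at hEA
  -- `F` is a first-order operator, so its commutator with `mulOp (r t)` has order zero.
  have hFr : ∀ t, F t * mulOp (r t) = mulOp (r t) * F t + mulOp (m * ratDeriv (r t)) := by
    intro t
    obtain ⟨k, hk⟩ := hF.2.exists_lead
    have hFt : F t = mulOp m * D + mulOp (k t) := by
      have := hk.2.eq_zero t
      rw [pow_zero, mul_one, pow_one, sub_eq_zero, sub_eq_iff_eq_add] at this
      rw [this, add_comm]
    rw [hFt, add_mul, mul_assoc, D_mul_mulOp, mul_add, mul_add, mulOp_comm (k t), ← mul_assoc,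
      ← mul_assoc, mulOp_comm m (r t), mulOp_mul m]
    abel
  have h1 : ∀ t, (mulOp u * E (t + v) - F t * A t - mulOp (r t)) * F t =
      mulOp (m * ratDeriv (r t)) := by
    intro t
    rw [sub_mul, sub_mul, h, hEA, mul_add, hFr]
    noncomm_ring
  have hdr : (fun t => m * ratDeriv (r t)) ∈ paramRing :=
    paramRing.mul_mem (const_mem_paramRing m) (IsDiffClosed.deriv_mem r hr.1)
  have h2 : ∀ t, mulOp u * E (t + v) - F t * A t - mulOp (r t) = 0 :=
    OpFam.eq_zero_of_mul_right hm hF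
      ((((OpFam.mulOp_const u).mul (hE.opFam.shift v)).sub (hF.opFam.mul hA)).sub
        (OpFam.mulOp hr.1))
      ((OrdLT.single Nat.zero_lt_one hdr).congr fun t => by rw [h1, pow_zero, mul_one])
  have h3 : ∀ t, F t * A t = mulOp u * E (t + v) - mulOp (r t) := fun t => by
    have := h2 t
    rw [sub_eq_zero] at this
    rw [← this]
    abel
  have hr' : ∀ t, ratDeriv (r t) = 0 := fun t => by
    have h4 := h1 t
    rw [h2, zero_mul, ← mulOp_zero] at h4
    exact (mul_eq_zero.mp (mulOp_injective h4).symm).resolve_left hm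
  have hr0 : r t₀ ≠ 0 := fun h0 => by
    have h4 := LinearMap.congr_fun (hEA t₀) f
    rw [h0, mulOp_zero, add_zero, Module.End.mul_apply, Module.End.mul_apply, hFf,
      map_zero] at h4
    exact (mul_ne_zero hu hEf) h4
  have hAr : ∀ t, A t * mulOp (r t) = mulOp (r t) * A t := fun t =>
    (hA.commute_mulOp (hr' t) t).eq.symm
  have hui : mulOp u⁻¹ * mulOp u = 1 := by rw [← mulOp_mul, inv_mul_cancel₀ hu, mulOp_one]
  have hFE : ∀ t, E (t + v) * F t = mulOp u⁻¹ * F t * mulOp u * E t := fun t => by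
    rw [mul_assoc, mul_assoc, ← h, ← mul_assoc, ← mul_assoc, hui, one_mul]
  have hAE : ∀ t, E t * A t = mulOp u⁻¹ * A t * mulOp u * E (t + v) := fun t => by
    have h5 : mulOp u * E t * A t = A t * (mulOp u * E (t + v)) := by
      rw [hEA, add_mul, mul_assoc, h3, mul_sub, hAr]
      abel
    rw [mul_assoc, mul_assoc, ← h5, ← mul_assoc, ← mul_assoc, hui, one_mul]
  have hfu := OpFam.mulOp_const (K := paramRing) u
  have hfui := OpFam.mulOp_const (K := paramRing) u⁻¹
  refine ⟨⟨fun t => mulOp u⁻¹ * F t * mulOp u, A, fun t => mulOp u⁻¹ * A t * mulOp u,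
    fun _ => mulOp u, fun t => -r t,
    { famP := hF.opFam
      famQ := (hfui.mul hF.opFam).mul hfu
      famB := hA
      famR := (hfui.mul hA).mul hfu
      famS := hfu
      mem := paramRing.neg_mem hr.1
      ne_zero := fun h0 => hr0 (neg_eq_zero.mp (h0 t₀))
      deriv_eq := fun t => by
        change D _ = 0
        rw [map_neg, neg_eq_zero]
        exact hr' _
      shift := hFE
      shift_inv := hAE
      mul_inv := fun t => by rw [h3, mulOp_neg]; abel }⟩,
    fun t => A (t + -v), fun t => mulOp u⁻¹ * A (t + -v) * mulOp u, fun t => F (t + -v),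
    fun t => mulOp u⁻¹ * F (t + -v) * mulOp u, fun _ => mulOp u, fun t => -r (t + -v),
    { famP := hA.shift (-v)
      famQ := (hfui.mul (hA.shift (-v))).mul hfu
      famB := hF.opFam.shift (-v)
      famR := (hfui.mul (hF.opFam.shift (-v))).mul hfu
      famS := hfu
      mem := paramRing.neg_mem (hshn r hr.1)
      ne_zero := fun h0 => hr0 (by simpa using h0 (t₀ + v))
      deriv_eq := fun t => by
        change D _ = 0
        rw [map_neg, neg_eq_zero]
        exact hr' _
      shift := fun t => by simpa using hAE (t + -v)
      shift_inv := fun t => by simpa using hFE (t + -v)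
      mul_inv := fun t => by
        rw [mulOp_neg, hEA]
        abel }⟩

/-- If the product of a shift operator `N₂` for the shift by `w` and a shift operator `N₁` for the
shift by `v` is, up to a nonzero constant and modulo left multiples of `E`, an invertible shift
operator, then the shift by `w` is invertible. -/
theorem hasInvShift_of_mul_eq {Z N₁ Q₁ N₂ Q₂ S : (Par → ℂ) → Op} {κ : (Par → ℂ) → RatFunc ℂ}
    (hZ : InvShift E (v + w) Z) (hN₁ : OpFam paramRing N₁) (hQ₁ : OpFam paramRing Q₁)
    (hN₂ : OpFam paramRing N₂) (hQ₂ : OpFam paramRing Q₂) (hS : OpFam paramRing S)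
    (hκ : κ ∈ paramRing) (hκ0 : ¬ ∀ t, κ t = 0) (hκ' : ∀ t, ratDeriv (κ t) = 0)
    (h₁ : ∀ t, E (t + v) * N₁ t = Q₁ t * E t) (h₂ : ∀ t, E (t + w) * N₂ t = Q₂ t * E t)
    (h : ∀ t, N₂ (t + v) * N₁ t = mulOp (κ t) * Z t + S t * E t) : HasInvShift E w := by
  obtain ⟨Q, B, R, T, μ, hZ⟩ := hZ
  have hsh := comp_mem_paramRing (polyFun_add_const (-v))
  have key : ∀ t, E (t + v) * (N₁ t * B t) = Q₁ t * R t * E (t + (v + w)) ∧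
      N₂ (t + v) * (N₁ t * B t) =
        mulOp (κ t * μ t) + (mulOp (κ t) * T t + S t * R t) * E (t + (v + w)) := by
    intro t
    constructor
    · rw [← mul_assoc, h₁, mul_assoc, hZ.shift_inv, mul_assoc]
    · rw [← mul_assoc, h, add_mul, mul_assoc, mul_assoc, hZ.mul_inv, hZ.shift_inv, mulOp_mul]
      noncomm_ring
  -- The inverse of `N₂` is `N₁` after the inverse `B` of `Z`.
  have hvw : ∀ t, t + -v + (v + w) = t + w := fun t => by abel
  refine ⟨N₂, Q₂, fun t => N₁ (t + -v) * B (t + -v), fun t => Q₁ (t + -v) * R (t + -v),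
    fun t => mulOp (κ (t + -v)) * T (t + -v) + S (t + -v) * R (t + -v),
    fun t => κ (t + -v) * μ (t + -v),
    { famP := hN₂
      famQ := hQ₂
      famB := (hN₁.shift (-v)).mul (hZ.famB.shift (-v))
      famR := (hQ₁.shift (-v)).mul (hZ.famR.shift (-v))
      famS := ((OpFam.mulOp (hsh κ hκ)).mul (hZ.famS.shift (-v))).add
        ((hS.shift (-v)).mul (hZ.famR.shift (-v)))
      mem := paramRing.mul_mem (hsh κ hκ) (hsh μ hZ.mem)
      ne_zero := fun h0 => (isIntegral_paramRing _ (hsh κ hκ) _ (hsh μ hZ.mem) h0).elim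
        (not_forall_shift hκ0 (-v)) (not_forall_shift hZ.ne_zero (-v))
      deriv_eq := fun t => by rw [ratDeriv_mul, hκ', hZ.deriv_eq, mul_zero, mul_zero, add_zero]
      shift := h₂
      shift_inv := fun t => by simpa [hvw] using (key (t + -v)).1
      mul_inv := fun t => by simpa [hvw] using (key (t + -v)).2 }⟩

/-- A symmetry `σ` of the family `E` transports shift operators. -/
theorem shift_of_symm {σ : (Par → ℂ) → Par → ℂ} (hE : ∀ t, E (σ t) = E t)
    (hv : ∀ t, σ (t + v) = σ t + w) {P Q : (Par → ℂ) → Op}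
    (h : ∀ t, E (t + w) * P t = Q t * E t) (t : Par → ℂ) :
    E (t + v) * P (σ t) = Q (σ t) * E t := by
  rw [← hE (t + v), hv, h, hE]

end

/-! ### The calculus of `(θ, ∂)`-forms -/

theorem D_mul_theta : D * theta = (theta + 1) * D := by
  have hX : ratDeriv RatFunc.X = 1 := by
    rw [← RatFunc.algebraMap_X, ratDeriv_algebraMap]
    simp
  rw [theta, ← mul_assoc, D_mul_mulOp, hX, mulOp_one, add_mul]

theorem D_mul_aeval (f : ℂ[X]) :
    D * aeval theta f = aeval theta (f.comp (X + C 1)) * D := by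
  induction f using Polynomial.induction_on' with
  | add p q hp hq => rw [map_add, mul_add, hp, hq, add_comp, map_add, add_mul]
  | monomial n a =>
    have h : ∀ n : ℕ, D * theta ^ n = (theta + 1) ^ n * D := fun n => by
      induction n with
      | zero => simp
      | succ n ih => rw [pow_succ, ← mul_assoc, ih, mul_assoc, D_mul_theta, ← mul_assoc, pow_succ]
    rw [aeval_monomial, monomial_comp, map_mul, aeval_C, ← mul_assoc, ← Algebra.commutes a D,
      mul_assoc, h]
    simp [mul_assoc]

theorem D_pow_mul_aeval (i : ℕ) (f : ℂ[X]) :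
    D ^ i * aeval theta f = aeval theta (f.comp (X + C (i : ℂ))) * D ^ i := by
  induction i generalizing f with
  | zero => simp
  | succ i ih =>
    rw [pow_succ, mul_assoc, D_mul_aeval, ← mul_assoc, ih, mul_assoc, comp_assoc]
    congr 3
    simp [add_assoc]

/-- The product `(θ + s + k) (θ + s + k + 1) ⋯ (θ + s + d - 1)`, as a polynomial in `θ`. -/
noncomputable def shiftProd (s : ℂ) (k d : ℕ) : ℂ[X] := ∏ j ∈ Finset.Ico k d, (X + C (s + j))

theorem shiftProd_comp (s : ℂ) (k d i : ℕ) :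
    (shiftProd s k d).comp (X + C (i : ℂ)) = shiftProd s (k + i) (d + i) := by
  rw [shiftProd, shiftProd, ← Finset.prod_Ico_add', Polynomial.prod_comp]
  refine Finset.prod_congr rfl fun j _ => ?_
  simp only [add_comp, X_comp, C_comp, Nat.cast_add, map_add]
  ring

theorem shiftProd_add (s : ℂ) (k d i : ℕ) :
    shiftProd (s + i) k d = shiftProd s (k + i) (d + i) := by
  rw [shiftProd, shiftProd, ← Finset.prod_Ico_add']
  refine Finset.prod_congr rfl fun j _ => ?_
  simp only [Nat.cast_add, map_add]
  ring

theorem shiftProd_mul {s : ℂ} {k l d : ℕ} (hkl : k ≤ l) (hld : l ≤ d) :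
    shiftProd s k l * shiftProd s l d = shiftProd s k d :=
  Finset.prod_Ico_consecutive _ hkl hld

/-- The operator `∑_{k ≤ d} (θ + s + k) ⋯ (θ + s + d - 1) c_k(θ) ∂^k`. It equals
`∑ c_k(θ) y^{d - k} ∂^d` for `y = x + (s + d - 1) ∂⁻¹`, and `y` satisfies the commutation rule
`θ y = y (θ + 1)` of `x`; this is why operators of this shape are closed under multiplication. -/
noncomputable def form (d : ℕ) (s : ℂ) (c : ℕ → ℂ[X]) : Op :=
  ∑ k ∈ Finset.range (d + 1), aeval theta (shiftProd s k d * c k) * D ^ k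

/-- The coefficients of the product of two operators in the shape of `form`. -/
noncomputable def conv (d d' : ℕ) (c c' : ℕ → ℂ[X]) (m : ℕ) : ℂ[X] :=
  ∑ i ∈ Finset.range (d + 1), ∑ j ∈ Finset.range (d' + 1),
    if i + j = m then c i * (c' j).comp (X + C (i : ℂ)) else 0

theorem form_congr {d : ℕ} {s : ℂ} {c c' : ℕ → ℂ[X]} (h : ∀ k < d + 1, c k = c' k) :
    form d s c = form d s c' :=
  Finset.sum_congr rfl fun k hk => by rw [h k (Finset.mem_range.mp hk)]

theorem form_add (d : ℕ) (s : ℂ) (c c' : ℕ → ℂ[X]) :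
    form d s c + form d s c' = form d s (fun k => c k + c' k) := by
  simp only [form, mul_add, map_add, add_mul, Finset.sum_add_distrib]

theorem mulOp_mul_form (a : ℂ) (d : ℕ) (s : ℂ) (c : ℕ → ℂ[X]) :
    mulOp (algebraMap ℂ (RatFunc ℂ) a) * form d s c = form d s (fun k => C a * c k) := by
  rw [form, form, Finset.mul_sum]
  refine Finset.sum_congr rfl fun k _ => ?_
  rw [mul_left_comm, map_mul _ (C a), aeval_C, algebraMap_op, mul_assoc]

theorem form_mul (d d' : ℕ) (s : ℂ) (c c' : ℕ → ℂ[X]) :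
    form d (s + d') c * form d' s c' = form (d + d') s (conv d d' c c') := by
  have h : ∀ m ∈ Finset.range (d + d' + 1),
      aeval theta (shiftProd s m (d + d') * conv d d' c c' m) * D ^ m =
      ∑ i ∈ Finset.range (d + 1), ∑ j ∈ Finset.range (d' + 1), if i + j = m then
        aeval theta (shiftProd s m (d + d') * (c i * (c' j).comp (X + C (i : ℂ)))) * D ^ m
        else 0 := by
    intro m _
    simp only [conv, Finset.mul_sum, map_sum, Finset.sum_mul]
    refine Finset.sum_congr rfl fun i _ => Finset.sum_congr rfl fun j _ => ?_
    split_ifs <;> simp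
  have h1 : form (d + d') s (conv d d' c c') =
      ∑ i ∈ Finset.range (d + 1), ∑ j ∈ Finset.range (d' + 1),
        aeval theta (shiftProd s (i + j) (d + d') * (c i * (c' j).comp (X + C (i : ℂ)))) *
          D ^ (i + j) := by
    rw [form, Finset.sum_congr rfl h, Finset.sum_comm]
    refine Finset.sum_congr rfl fun i hi => ?_
    rw [Finset.sum_comm]
    refine Finset.sum_congr rfl fun j hj => ?_
    rw [Finset.mem_range] at hi hj
    rw [Finset.sum_ite_eq, if_pos (Finset.mem_range.mpr (by omega))]
  rw [h1, form, form, Finset.sum_mul]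
  refine Finset.sum_congr rfl fun i hi => ?_
  rw [Finset.mul_sum]
  refine Finset.sum_congr rfl fun j hj => ?_
  rw [Finset.mem_range] at hi hj
  have h2 : shiftProd s (i + j) (d + d') =
      shiftProd s (j + i) (d' + i) * shiftProd s (i + d') (d + d') := by
    rw [add_comm d' i, shiftProd_mul (by omega) (by omega), add_comm j i]
  have h3 : D ^ i * aeval theta (shiftProd s j d' * c' j) =
      aeval theta (shiftProd s (j + i) (d' + i) * (c' j).comp (X + C (i : ℂ))) * D ^ i := by
    rw [D_pow_mul_aeval, mul_comp, shiftProd_comp]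
  rw [h2, shiftProd_add, mul_assoc, ← mul_assoc (D ^ i), h3, mul_assoc, ← pow_add, ← mul_assoc,
    ← map_mul, mul_mul_mul_comm, mul_comm (shiftProd s (i + d') (d + d')), mul_mul_mul_comm]

theorem D_mul_form (d : ℕ) (s : ℂ) (c : ℕ → ℂ[X]) :
    D * form d s c = form d (s + 1) (fun k => (c k).comp (X + C 1)) * D := by
  rw [form, form, Finset.mul_sum, Finset.sum_mul]
  refine Finset.sum_congr rfl fun k _ => ?_
  have h := shiftProd_comp s k d 1
  have h' := shiftProd_add s k d 1
  rw [Nat.cast_one] at h h'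
  rw [← mul_assoc, D_mul_aeval, mul_comp, h, h', mul_assoc, mul_assoc, ← pow_succ, ← pow_succ']

/-- The relation `E' * P = Q * E` between operators of the shape of `form`, from the relations
between their coefficients. -/
theorem form_intertwine {d e : ℕ} {s : ℂ} {b b' c c' : ℕ → ℂ[X]}
    (h : ∀ m < e + d + 1, conv e d b' c m = conv d e c' b m) :
    form e (s + d) b' * form d s c = form d (s + e) c' * form e s b := by
  rw [form_mul, form_mul, add_comm d e]
  exact form_congr h

/-! ### Values of forms on powers of `x` -/

theorem aeval_theta_X_pow (f : ℂ[X]) (n : ℕ) :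
    aeval theta f (algebraMap ℂ[X] (RatFunc ℂ) (X ^ n)) =
      f.eval (n : ℂ) • algebraMap ℂ[X] (RatFunc ℂ) (X ^ n) := by
  have h : theta (algebraMap ℂ[X] (RatFunc ℂ) (X ^ n)) =
      (n : ℂ) • algebraMap ℂ[X] (RatFunc ℂ) (X ^ n) := by
    change RatFunc.X * ratDeriv _ = _
    rw [ratDeriv_algebraMap, Algebra.smul_def, IsScalarTower.algebraMap_apply ℂ ℂ[X] (RatFunc ℂ),
      ← RatFunc.algebraMap_X, ← map_mul, ← map_mul]
    congr 1
    cases n with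
    | zero => simp
    | succ n =>
      simp only [derivative_X_pow, Nat.add_sub_cancel, Polynomial.algebraMap_apply,
        Algebra.algebraMap_self, RingHom.id_apply]
      ring
  exact Module.End.aeval_apply_of_hasEigenvector
    ⟨Module.End.mem_eigenspace_iff.mpr h, RatFunc.algebraMap_ne_zero (pow_ne_zero n X_ne_zero)⟩

theorem form_X_pow (d : ℕ) (s : ℂ) (c : ℕ → ℂ[X]) (n : ℕ) :
    form d s c (algebraMap ℂ[X] (RatFunc ℂ) (X ^ n)) =
      ∑ k ∈ Finset.range (d + 1), ((n.descFactorial k : ℂ) * (∏ j ∈ Finset.Ico k d,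
        (((n - k : ℕ) : ℂ) + (s + j))) * (c k).eval ((n - k : ℕ) : ℂ)) •
          algebraMap ℂ[X] (RatFunc ℂ) (X ^ (n - k)) := by
  rw [form, LinearMap.sum_apply]
  refine Finset.sum_congr rfl fun k _ => ?_
  have h := map_smul (IsScalarTower.toAlgHom ℂ ℂ[X] (RatFunc ℂ)) (n.descFactorial k : ℂ)
    (X ^ (n - k))
  rw [IsScalarTower.coe_toAlgHom'] at h
  rw [Module.End.mul_apply, D_pow_apply_X_pow, iterate_derivative_X_pow_eq_smul, h, map_smul,
    aeval_theta_X_pow, smul_smul, eval_mul, shiftProd, eval_prod, mul_assoc]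
  simp only [eval_add, eval_X, eval_C]

theorem form_one (d : ℕ) (s : ℂ) (c : ℕ → ℂ[X]) :
    form d s c 1 = algebraMap ℂ (RatFunc ℂ) ((∏ j ∈ Finset.range d, (s + j)) * (c 0).eval 0) := by
  have h := form_X_pow d s c 0
  rw [Finset.sum_range_succ', Finset.sum_eq_zero] at h
  · simpa [Algebra.smul_def] using h
  · intro k _
    simp

/-! ### Families of `(θ, ∂)`-forms -/

/-- `f` is a family of polynomials in `θ` that depends polynomially on the parameters. -/
@[fun_prop]
def PolyFam (f : (Par → ℂ) → ℂ[X]) : Prop := OpFam paramRing fun t => aeval theta (f t)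

theorem opFam_algebraMap {c : (Par → ℂ) → ℂ} (hc : PolyFun c) :
    OpFam paramRing fun t => algebraMap ℂ Op (c t) := by
  simp only [algebraMap_op]
  exact OpFam.mulOp hc

theorem lead_theta {K : Subring ((Par → ℂ) → RatFunc ℂ)} [IsDiffClosed K] :
    Lead K 1 (fun _ => RatFunc.X) fun _ => theta :=
  ⟨IsDiffClosed.const_mem _, (OrdLT.zero 1).congr fun _ => by rw [pow_one, theta, sub_self]⟩

theorem opFam_theta : OpFam paramRing fun _ => theta := lead_theta.opFam

@[fun_prop]
theorem PolyFam.add {f g : (Par → ℂ) → ℂ[X]} (hf : PolyFam f) (hg : PolyFam g) :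
    PolyFam fun t => f t + g t := by
  simp only [PolyFam, map_add]
  exact OpFam.add hf hg

@[fun_prop]
theorem PolyFam.mul {f g : (Par → ℂ) → ℂ[X]} (hf : PolyFam f) (hg : PolyFam g) :
    PolyFam fun t => f t * g t := by
  simp only [PolyFam, map_mul]
  exact OpFam.mul hf hg

@[fun_prop]
theorem PolyFam.C {c : (Par → ℂ) → ℂ} (hc : PolyFun c) : PolyFam fun t => Polynomial.C (c t) := by
  simp only [PolyFam, aeval_C]
  exact opFam_algebraMap hc

@[fun_prop]
theorem PolyFam.X : PolyFam fun _ => Polynomial.X := by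
  simp only [PolyFam, aeval_X]
  exact opFam_theta

@[fun_prop]
theorem PolyFam.sub {f g : (Par → ℂ) → ℂ[X]} (hf : PolyFam f) (hg : PolyFam g) :
    PolyFam fun t => f t - g t := by
  simp only [PolyFam, map_sub]
  exact OpFam.sub hf hg

@[fun_prop]
theorem PolyFam.pow {f : (Par → ℂ) → ℂ[X]} (hf : PolyFam f) (n : ℕ) :
    PolyFam fun t => f t ^ n := by
  induction n with
  | zero =>
    simp only [pow_zero, PolyFam, map_one]
    simpa using OpFam.D_pow (K := paramRing) 0
  | succ n ih =>
    simp only [pow_succ]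
    exact ih.mul hf

theorem PolyFam.const (f : ℂ[X]) : PolyFam fun _ => f := by
  induction f using Polynomial.induction_on' with
  | add p q hp hq => exact hp.add hq
  | monomial n a =>
    have h := PolyFam.pow PolyFam.X n
    simp only [PolyFam, map_pow, aeval_X] at h
    simp only [PolyFam, aeval_monomial]
    exact (opFam_algebraMap (PolyFun.const a)).mul h

theorem OpFam.sum {ι : Type*} (s : Finset ι) {F : ι → (Par → ℂ) → Op}
    (h : ∀ i ∈ s, OpFam paramRing (F i)) : OpFam paramRing fun t => ∑ i ∈ s, F i t := by
  classical
  induction s using Finset.induction_on with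
  | empty => simpa using (OrdLT.zero (K := paramRing) 0).opFam
  | insert i s hi ih =>
    simp only [Finset.sum_insert hi]
    exact (h i (Finset.mem_insert_self i s)).add
      (ih fun j hj => h j (Finset.mem_insert_of_mem hj))

/-- `aeval theta` of a shifted product has the leading coefficient of `θ ^ (d - k)`. -/
theorem lead_shiftProd {s : (Par → ℂ) → ℂ} (hs : PolyFun s) (k n : ℕ) :
    Lead paramRing n (fun _ => RatFunc.X ^ n)
      fun t => aeval theta (shiftProd (s t) k (k + n)) := by
  induction n with
  | zero =>
    refine (Lead.D_pow 0).congr (fun t => pow_zero _) fun t => ?_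
    simp [shiftProd]
  | succ n ih =>
    have h1 : Lead paramRing 1 (fun _ => RatFunc.X)
        fun t => theta + algebraMap ℂ Op (s t + (k + n : ℕ)) := by
      have h2 : PolyFun fun t => s t + (k + n : ℕ) := by fun_prop
      refine (lead_theta.add (Lead.of_ordLT ((OrdLT.single Nat.zero_lt_one h2).congr
        (G := fun t => algebraMap ℂ Op (s t + (k + n : ℕ))) fun t => ?_))).congr
        (fun t => (add_zero _).symm) fun t => rfl
      rw [pow_zero, mul_one, algebraMap_op]
    refine (ih.mul h1).congr (fun t => pow_succ _ _) fun t => ?_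
    rw [shiftProd, ← add_assoc, Finset.prod_Ico_succ_top (by omega), map_mul, map_add, aeval_X,
      aeval_C]
    rfl

theorem OpFam.form {s : (Par → ℂ) → ℂ} (hs : PolyFun s) {c : (Par → ℂ) → ℕ → ℂ[X]}
    (hc : ∀ k, PolyFam fun t => c t k) (d : ℕ) :
    OpFam paramRing fun t => SE6.form d (s t) (c t) := by
  refine OpFam.sum _ fun k hk => ?_
  obtain ⟨n, hn⟩ := Nat.exists_eq_add_of_le (Nat.lt_succ_iff.mp (Finset.mem_range.mp hk))
  have h := (lead_shiftProd hs k n).opFam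
  simp only [map_mul]
  rw [hn]
  exact (h.mul (hc k)).mul (OpFam.D_pow k)

theorem OrdLT.form {s : (Par → ℂ) → ℂ} (hs : PolyFun s) {c : (Par → ℂ) → ℕ → ℂ[X]} {m : ℕ}
    (hc : ∀ k, OrdLT paramRing (m + 1) fun t => aeval theta (c t k)) (d : ℕ) :
    OrdLT paramRing (d + m + 1) fun t => SE6.form d (s t) (c t) := by
  refine OrdLT.sum _ fun k hk => ?_
  obtain ⟨n, rfl⟩ := Nat.exists_eq_add_of_le (Nat.lt_succ_iff.mp (Finset.mem_range.mp hk))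
  have h := ((lead_shiftProd hs k n).ordLT.mul (hc k)).mul_D_pow k
  rw [show k + n + m + 1 = n + 1 + m + k by omega]
  exact h.congr fun t => by rw [map_mul]

/-- If `c_k(θ)` has order at most `m` then the form has order at most `d + m`, and its leading
coefficient is known. -/
theorem Lead.form {s : (Par → ℂ) → ℂ} (hs : PolyFun s) {c : (Par → ℂ) → ℕ → ℂ[X]} {m : ℕ}
    {l : ℕ → RatFunc ℂ} (hc : ∀ k, Lead paramRing m (fun _ => l k) fun t => aeval theta (c t k))
    (d : ℕ) :
    Lead paramRing (d + m) (fun _ => ∑ k ∈ Finset.range (d + 1), RatFunc.X ^ (d - k) * l k)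
      fun t => SE6.form d (s t) (c t) := by
  have hsum : ∀ u : Finset ℕ, (∀ k ∈ u, k ≤ d) →
      Lead paramRing (d + m) (fun _ => ∑ k ∈ u, RatFunc.X ^ (d - k) * l k)
        fun t => ∑ k ∈ u, aeval theta (shiftProd (s t) k d * c t k) * SE6.D ^ k := by
    intro u
    induction u using Finset.induction_on with
    | empty =>
      intro _
      exact Lead.of_ordLT ((OrdLT.zero _).congr fun t => by simp)
    | insert k u hk ih =>
      intro hu
      simp only [Finset.sum_insert hk]
      refine Lead.add ?_ (ih fun j hj => hu j (Finset.mem_insert_of_mem hj))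
      obtain ⟨n, rfl⟩ := Nat.exists_eq_add_of_le (hu k (Finset.mem_insert_self k u))
      have h := ((lead_shiftProd hs k n).mul (hc k)).mul (Lead.D_pow (K := paramRing) k)
      rw [show k + n + m = n + m + k by omega]
      refine h.congr (fun t => ?_) fun t => by rw [map_mul]
      rw [mul_one, Nat.add_sub_cancel_left]
  exact hsum _ fun k hk => Nat.lt_succ_iff.mp (Finset.mem_range.mp hk)

/-! ### The operator in adapted coordinates -/

/-- Half the difference of the outer exponents `e 2` and `e 0` at `x = 0`. -/
noncomputable def gap0 (t : Par → ℂ) : ℂ := t .a + t .c + t .g / 2 + 1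

/-- Half the difference of the outer exponents `e 5` and `e 3` at `x = 1`. -/
noncomputable def gap1 (t : Par → ℂ) : ℂ := t .b + t .c + t .g / 2 + 1

/-- Half the difference of the outer exponents `e 6` and `e 8` at infinity. -/
noncomputable def gapInf (t : Par → ℂ) : ℂ := t .a + t .b + t .g / 2 + 1

/-- Half the parameter `g`; at each singular point the middle exponent is the mean of the outer
ones less `halfG t`. -/
noncomputable def halfG (t : Par → ℂ) : ℂ := t .g / 2

/-- The mean of the outer exponents at `x = 0`, less one. -/
noncomputable def centre (t : Par → ℂ) : ℂ := t .p + t .r + gap0 t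

/-- The sum of `centre t` and of the mean of the outer exponents at infinity, with the opposite
sign. -/
noncomputable def offset (t : Par → ℂ) : ℂ := t .q + t .b + t .c + 1

/-- The variable `θ - centre t`. In this variable the coefficients of the operator depend only on
`offset`, `halfG` and the squares of `gap0`, `gap1`, `gapInf`. -/
noncomputable def var (t : Par → ℂ) : ℂ[X] := X - C (centre t)

/-- A polynomial of degree at most three in the adapted variable. -/
noncomputable def cubic (t : Par → ℂ) (k₃ k₂ k₁ k₀ : ℂ) : ℂ[X] :=
  C k₃ * var t ^ 3 + C k₂ * var t ^ 2 + C k₁ * var t + C k₀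

/-- The coefficients of `opSE6` as a `form`: the polynomials `B0`, `B1`, `B2` and the last
coefficient. -/
noncomputable def coefE (t : Par → ℂ) : ℕ → ℂ[X]
  | 0 => cubic t
      (1)
      (-3 * offset t - halfG t)
      (3 * offset t ^ 2 + 2 * offset t * halfG t - gapInf t ^ 2)
      (-offset t ^ 3 - offset t ^ 2 * halfG t + offset t * gapInf t ^ 2 + gapInf t ^ 2 * halfG t)
  | 1 => cubic t
      (-3)
      (6 * offset t + halfG t - 6)
      (-3 * offset t ^ 2 + gap0 t ^ 2 - gap1 t ^ 2 + 2 * gapInf t ^ 2 + halfG t ^ 2 + 9 * offset t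
        + 2 * halfG t - 5)
      (-offset t ^ 2 * halfG t - offset t * gap0 t ^ 2 + offset t * gap1 t ^ 2
        - offset t * gapInf t ^ 2 - offset t * halfG t ^ 2 - gapInf t ^ 2 * halfG t
        - 3 * offset t ^ 2 - offset t * halfG t + gap0 t ^ 2 / 2 - gap1 t ^ 2 / 2
        + 3 * gapInf t ^ 2 / 2 + halfG t ^ 2 / 2 + 4 * offset t + halfG t - 3 / 2)
  | 2 => cubic t
      (3)
      (-3 * offset t + halfG t + 12)
      (-2 * offset t * halfG t - 2 * gap0 t ^ 2 + gap1 t ^ 2 - gapInf t ^ 2 - halfG t ^ 2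
        - 9 * offset t + 2 * halfG t + 17)
      (offset t * gap0 t ^ 2 - gap0 t ^ 2 * halfG t - 3 * offset t * halfG t - 5 * gap0 t ^ 2 / 2
        + 3 * gap1 t ^ 2 / 2 - 3 * gapInf t ^ 2 / 2 - 3 * halfG t ^ 2 / 2 - 7 * offset t + halfG t
        + 17 / 2)
  | 3 => cubic t
      (-1)
      (-halfG t - 6)
      (gap0 t ^ 2 - 4 * halfG t - 12)
      (gap0 t ^ 2 * halfG t + 2 * gap0 t ^ 2 - 4 * halfG t - 8)
  | _ => 0

theorem sInf_exponents (t : Par → ℂ) : sInf (exponents t) = -t .r := by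
  simp only [sInf, s11, s12, s13, exponents, Matrix.cons_val]
  ring

theorem B0_exponents (t : Par → ℂ) : B0 (exponents t) = coefE t 0 := by
  refine Polynomial.funext fun z => ?_
  simp only [B0, coefE, cubic, var, centre, gap0, gapInf, halfG, offset, exponents,
    Matrix.cons_val, eval_add, eval_mul, eval_pow, eval_sub, eval_X, eval_C]
  ring

theorem B1_exponents (t : Par → ℂ) : B1 (exponents t) = coefE t 1 := by
  refine Polynomial.funext fun z => ?_
  simp only [B1, t12, t11, t10, s11, s12, s13, s21, s22, s23, s31, s32, s33, coefE, cubic, var,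
    centre, gap0, gap1, gapInf, halfG, offset, exponents, Matrix.cons_val, eval_add, eval_mul,
    eval_pow, eval_sub, eval_X, eval_C]
  ring

theorem B2_exponents (t : Par → ℂ) : B2 (exponents t) = coefE t 2 := by
  refine Polynomial.funext fun z => ?_
  simp only [B2, t22, t21, t20, t10, s11, s12, s13, s21, s22, s23, s31, s32, s33, coefE, cubic,
    var, centre, gap0, gap1, gapInf, halfG, offset, exponents, Matrix.cons_val, eval_add, eval_mul,
    eval_pow, eval_sub, eval_X, eval_C]
  ring

theorem T3_exponents (t : Par → ℂ) : T3 (exponents t) = coefE t 3 := by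
  refine Polynomial.funext fun z => ?_
  simp only [T3, coefE, cubic, var, centre, gap0, halfG, exponents, Matrix.cons_val, eval_neg,
    eval_add, eval_mul, eval_pow, eval_sub, eval_X, eval_C]
  ring

theorem opSE6_eq_form (t : Par → ℂ) : opSE6 t = form 3 (-t .r) (coefE t) := by
  have h0 : shiftProd (-t .r) 0 3 =
      (X + C (-t .r + 2)) * (X + C (-t .r + 1)) * (X + C (-t .r)) := by
    simp only [shiftProd, Nat.Ico_zero_eq_range, Finset.prod_range_succ, Finset.prod_range_zero]
    norm_num
    ring
  have h1 : shiftProd (-t .r) 1 3 = (X + C (-t .r + 2)) * (X + C (-t .r + 1)) := by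
    rw [shiftProd, Finset.prod_Ico_succ_top (by norm_num), Nat.Ico_succ_singleton,
      Finset.prod_singleton]
    norm_num
    ring
  have h2 : shiftProd (-t .r) 2 3 = X + C (-t .r + 2) := by
    rw [shiftProd, Nat.Ico_succ_singleton, Finset.prod_singleton]
    norm_num
  have h3 : shiftProd (-t .r) 3 3 = 1 := by rw [shiftProd, Finset.Ico_self, Finset.prod_empty]
  simp only [opSE6, opE6, form, Finset.sum_range_succ, Finset.sum_range_zero, zero_add, T0, T1,
    T2, T3_exponents, sInf_exponents, B0_exponents, B1_exponents, B2_exponents, h0, h1, h2, h3,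
    pow_zero, mul_one, one_mul, pow_one]

theorem eval_cubic (t : Par → ℂ) (k₃ k₂ k₁ k₀ z : ℂ) : (cubic t k₃ k₂ k₁ k₀).eval z =
    k₃ * (z - centre t) ^ 3 + k₂ * (z - centre t) ^ 2 + k₁ * (z - centre t) + k₀ := by
  simp [cubic, var]

@[fun_prop]
theorem PolyFun.gap0 : PolyFun SE6.gap0 := by
  unfold SE6.gap0
  fun_prop

@[fun_prop]
theorem PolyFun.gap1 : PolyFun SE6.gap1 := by
  unfold SE6.gap1
  fun_prop

@[fun_prop]
theorem PolyFun.gapInf : PolyFun SE6.gapInf := by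
  unfold SE6.gapInf
  fun_prop

@[fun_prop]
theorem PolyFun.halfG : PolyFun SE6.halfG := by
  unfold SE6.halfG
  fun_prop

@[fun_prop]
theorem PolyFun.centre : PolyFun SE6.centre := by
  unfold SE6.centre
  fun_prop

@[fun_prop]
theorem PolyFun.offset : PolyFun SE6.offset := by
  unfold SE6.offset
  fun_prop

@[fun_prop]
theorem PolyFam.var : PolyFam SE6.var := by
  unfold SE6.var
  fun_prop

theorem lead_var : Lead paramRing 1 (fun _ => RatFunc.X) fun t => aeval theta (var t) := by
  have h : PolyFun fun t => -centre t := by fun_prop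
  refine (lead_theta.add (Lead.of_ordLT (OrdLT.single Nat.zero_lt_one h))).congr
    (fun t => (add_zero _).symm) fun t => ?_
  rw [var, map_sub, aeval_X, aeval_C, algebraMap_op, map_neg, mulOp_neg, pow_zero, mul_one,
    sub_eq_add_neg]

theorem lead_cubic (k₃ : ℂ) {k₂ k₁ k₀ : (Par → ℂ) → ℂ} (h₂ : PolyFun k₂) (h₁ : PolyFun k₁)
    (h₀ : PolyFun k₀) : Lead paramRing 3 (fun _ => algebraMap ℂ (RatFunc ℂ) k₃ * RatFunc.X ^ 3)
      fun t => aeval theta (cubic t k₃ (k₂ t) (k₁ t) (k₀ t)) := by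
  have hv2 := lead_var.mul lead_var
  have hv3 := hv2.mul lead_var
  have hone : Lead paramRing 0 (fun _ => 1) fun _ : Par → ℂ => (1 : Op) :=
    (Lead.D_pow 0).congr (fun _ => rfl) fun _ => (pow_zero D).symm
  have h := (hv3.mulOp_mul (PolyFun.const k₃)).add (Lead.of_ordLT
    ((((hv2.mulOp_mul h₂).ordLT.mono (by norm_num)).add
      ((lead_var.mulOp_mul h₁).ordLT.mono (by norm_num))).add
      ((hone.mulOp_mul h₀).ordLT.mono (by norm_num))))
  refine h.congr (fun t => by ring) fun t => ?_
  simp only [cubic, map_add, map_mul, map_pow, aeval_C, algebraMap_op, mul_one]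
  noncomm_ring

/-- The leading coefficients of `coefE`, those of `(x - 1) ^ 3`. -/
def leadE : ℕ → ℂ
  | 0 => 1
  | 1 => -3
  | 2 => 3
  | 3 => -1
  | _ => 0

theorem lead_coefE (k : ℕ) :
    Lead paramRing 3 (fun _ => algebraMap ℂ (RatFunc ℂ) (leadE k) * RatFunc.X ^ 3)
      fun t => aeval theta (coefE t k) := by
  match k with
  | 0 => exact lead_cubic 1 (by fun_prop) (by fun_prop) (by fun_prop)
  | 1 => exact lead_cubic (-3) (by fun_prop) (by fun_prop) (by fun_prop)
  | 2 => exact lead_cubic 3 (by fun_prop) (by fun_prop) (by fun_prop)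
  | 3 => exact lead_cubic (-1) (by fun_prop) (by fun_prop) (by fun_prop)
  | n + 4 =>
    exact (Lead.of_ordLT (OrdLT.zero 3)).congr (fun t => by simp [leadE])
      fun t => by simp [coefE]

theorem X_sub_one_ne_zero : (RatFunc.X - 1 : RatFunc ℂ) ≠ 0 := by
  rw [← RatFunc.algebraMap_X, ← map_one (algebraMap ℂ[X] (RatFunc ℂ)), ← map_sub]
  exact RatFunc.algebraMap_ne_zero (X_sub_C_ne_zero (1 : ℂ))

/-- `opSE6` is a family of operators of order six with leading coefficient `x³ (x - 1)³`. -/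
theorem lead_opSE6 :
    Lead paramRing (5 + 1) (fun _ => RatFunc.X ^ 3 * (RatFunc.X - 1) ^ 3) opSE6 := by
  have hr : PolyFun fun t => -t .r := by fun_prop
  refine (Lead.form hr lead_coefE 3).congr (fun t => ?_) opSE6_eq_form
  simp only [Finset.sum_range_succ, Finset.sum_range_zero, leadE, map_neg, map_one, map_ofNat]
  ring

theorem lead_ne_zero : (RatFunc.X ^ 3 * (RatFunc.X - 1) ^ 3 : RatFunc ℂ) ≠ 0 :=
  mul_ne_zero (pow_ne_zero 3 RatFunc.X_ne_zero) (pow_ne_zero 3 X_sub_one_ne_zero)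

/-! ### Symmetries -/

/-- The shift vector with the given components. -/
def vec (a b c g p q r : ℂ) : Par → ℂ
  | .a => a
  | .b => b
  | .c => c
  | .g => g
  | .p => p
  | .q => q
  | .r => r

theorem eval_conv (d d' : ℕ) (c c' : ℕ → ℂ[X]) (m : ℕ) (z : ℂ) : (conv d d' c c' m).eval z =
    ∑ i ∈ Finset.range (d + 1), ∑ j ∈ Finset.range (d' + 1),
      if i + j = m then (c i).eval z * (c' j).eval (z + i) else 0 := by
  simp only [conv, eval_finsetSum]
  refine Finset.sum_congr rfl fun i _ => Finset.sum_congr rfl fun j _ => ?_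
  split_ifs <;> simp

/-- The substitution that exchanges the exponents `e 0`, `e 2` and `e 3`, `e 5`. -/
def symC (t : Par → ℂ) : Par → ℂ :=
  vec (t .b) (t .a) (-(t .a + t .b + t .c) - 2 - t .g) (t .g)
    (t .p + 2 * (t .a + t .c + 1) + t .g) (t .q + 2 * (t .b + t .c + 1) + t .g) (t .r)

/-- The substitution that exchanges the exponents `e 0`, `e 2` and `e 6`, `e 8`. -/
def symA (t : Par → ℂ) : Par → ℂ :=
  vec (-(t .a + t .b + t .c) - 2 - t .g) (t .c) (t .b) (t .g)
    (t .p + 2 * (t .a + t .c + 1) + t .g) (t .q) (t .r)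

theorem opSE6_symC (t : Par → ℂ) : opSE6 (symC t) = opSE6 t := by
  have h_gap0 : gap0 (symC t) = -gap0 t := by
    simp only [gap0, symC, vec]
    ring
  have h_gap1 : gap1 (symC t) = -gap1 t := by
    simp only [gap1, symC, vec]
    ring
  have h_gapInf : gapInf (symC t) = gapInf t := by
    simp only [gapInf, symC, vec]
    ring
  have h_halfG : halfG (symC t) = halfG t := by
    simp only [halfG, symC, vec]
  have h_centre : centre (symC t) = centre t := by
    simp only [centre, gap0, symC, vec]
    ring
  have h_offset : offset (symC t) = offset t := by
    simp only [offset, symC, vec]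
    ring
  have h_var : var (symC t) = var t := by rw [var, var, h_centre]
  rw [opSE6_eq_form, opSE6_eq_form, show (symC t) .r = t .r from rfl]
  refine form_congr fun k hk => ?_
  interval_cases k <;>
    simp only [coefE, cubic, h_var, h_gap0, h_gap1, h_gapInf, h_halfG, h_offset, neg_sq]

theorem symC_symC (t : Par → ℂ) : symC (symC t) = t := by
  funext k
  cases k <;> simp only [symC, vec] <;> ring

theorem polyFun_symC (k : Par) : PolyFun fun t => symC t k := by
  cases k <;> simp only [symC, vec] <;> fun_prop

theorem opSE6_symA (t : Par → ℂ) : opSE6 (symA t) = opSE6 t := by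
  have h_gap0 : gap0 (symA t) = -gap0 t := by
    simp only [gap0, symA, vec]
    ring
  have h_gap1 : gap1 (symA t) = gap1 t := by
    simp only [gap1, symA, vec]
    ring
  have h_gapInf : gapInf (symA t) = -gapInf t := by
    simp only [gapInf, symA, vec]
    ring
  have h_halfG : halfG (symA t) = halfG t := by
    simp only [halfG, symA, vec]
  have h_centre : centre (symA t) = centre t := by
    simp only [centre, gap0, symA, vec]
    ring
  have h_offset : offset (symA t) = offset t := by
    simp only [offset, symA, vec]
    ring
  have h_var : var (symA t) = var t := by rw [var, var, h_centre]
  rw [opSE6_eq_form, opSE6_eq_form, show (symA t) .r = t .r from rfl]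
  refine form_congr fun k hk => ?_
  interval_cases k <;>
    simp only [coefE, cubic, h_var, h_gap0, h_gap1, h_gapInf, h_halfG, h_offset, neg_sq]

theorem polyFun_symA (k : Par) : PolyFun fun t => symA t k := by
  cases k <;> simp only [symA, vec] <;> fun_prop

/-! ### Relations between forms of low degree -/

/-- A polynomial of degree at most two in the adapted variable. -/
noncomputable def quad (t : Par → ℂ) (k₂ k₁ k₀ : ℂ) : ℂ[X] :=
  C k₂ * var t ^ 2 + C k₁ * var t + C k₀

theorem eval_quad (t : Par → ℂ) (k₂ k₁ k₀ z : ℂ) : (quad t k₂ k₁ k₀).eval z =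
    k₂ * (z - centre t) ^ 2 + k₁ * (z - centre t) + k₀ := by
  simp [quad, var]

@[fun_prop]
theorem PolyFam.quad {k₂ k₁ k₀ : (Par → ℂ) → ℂ} (h₂ : PolyFun k₂) (h₁ : PolyFun k₁)
    (h₀ : PolyFun k₀) : PolyFam fun t => SE6.quad t (k₂ t) (k₁ t) (k₀ t) := by
  unfold SE6.quad
  fun_prop

theorem add_sub_add_same (y u e : ℂ) : y + u - (u + e) = y - e := by
  ring

theorem add_add_sub_same (y u i : ℂ) : y + u + i - u = y + i := by
  ring

/-- The relation `E' * P = Q * E` for forms `P`, `Q` of degree two and `E`, `E'` of degree three, in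
terms of the values of the coefficients. -/
theorem form_intertwine_two_three {s : ℂ} {b b' c c' : ℕ → ℂ[X]} (h : ∀ z : ℂ,
    (b' 0).eval z * (c 0).eval z = (c' 0).eval z * (b 0).eval z ∧
    (b' 0).eval z * (c 1).eval z + (b' 1).eval z * (c 0).eval (z + 1) =
      (c' 0).eval z * (b 1).eval z + (c' 1).eval z * (b 0).eval (z + 1) ∧
    (b' 0).eval z * (c 2).eval z + (b' 1).eval z * (c 1).eval (z + 1) +
        (b' 2).eval z * (c 0).eval (z + 2) =
      (c' 0).eval z * (b 2).eval z + (c' 1).eval z * (b 1).eval (z + 1) +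
        (c' 2).eval z * (b 0).eval (z + 2) ∧
    (b' 1).eval z * (c 2).eval (z + 1) + (b' 2).eval z * (c 1).eval (z + 2) +
        (b' 3).eval z * (c 0).eval (z + 3) =
      (c' 0).eval z * (b 3).eval z + (c' 1).eval z * (b 2).eval (z + 1) +
        (c' 2).eval z * (b 1).eval (z + 2) ∧
    (b' 2).eval z * (c 2).eval (z + 2) + (b' 3).eval z * (c 1).eval (z + 3) =
      (c' 1).eval z * (b 3).eval (z + 1) + (c' 2).eval z * (b 2).eval (z + 2) ∧
    (b' 3).eval z * (c 2).eval (z + 3) = (c' 2).eval z * (b 3).eval (z + 2)) :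
    form 3 (s + 2) b' * form 2 s c = form 2 (s + 3) c' * form 3 s b := by
  have key := form_intertwine (d := 2) (e := 3) (s := s) (b := b) (b' := b') (c := c) (c' := c')
    fun m hm => Polynomial.funext fun z => ?_
  · simpa using key
  · obtain ⟨h0, h1, h2, h3, h4, h5⟩ := h z
    simp only [eval_conv, Finset.sum_range_succ, Finset.sum_range_zero, zero_add]
    interval_cases m <;> norm_num
    · exact h0
    · linear_combination h1
    · linear_combination h2
    · linear_combination h3
    · linear_combination h4
    · linear_combination h5

/-! ### Shift operators of order four -/

/-- The coefficients of a shift operator for `a → a + 1`, `r → r - 2`. -/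
noncomputable def coefA (t : Par → ℂ) : ℕ → ℂ[X]
  | 0 => quad t
      (1)
      (-2 * offset t + gapInf t - halfG t)
      (offset t ^ 2 - offset t * gapInf t + offset t * halfG t - gapInf t * halfG t)
  | 1 => quad t
      (-2)
      (2 * offset t + gap0 t - gapInf t - 2)
      (-offset t * gap0 t + offset t * halfG t + gap0 t ^ 2 / 2 + gap0 t * gapInf t
        - gap1 t ^ 2 / 2 + gapInf t ^ 2 / 2 + halfG t ^ 2 / 2 + offset t + gap0 t - 1 / 2)
  | 2 => quad t
      (1)
      (-gap0 t + halfG t + 2)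
      (-gap0 t * halfG t - gap0 t + halfG t + 1)
  | _ => 0

/-- The coefficients of the cofactor of the shift operator given by `coefA`. -/
noncomputable def coefA' (t : Par → ℂ) : ℕ → ℂ[X]
  | 0 => quad t
      (1)
      (-2 * offset t + gapInf t - halfG t + 3)
      (offset t ^ 2 - offset t * gapInf t + offset t * halfG t - gapInf t * halfG t - 3 * offset t
        + gapInf t - 2 * halfG t + 2)
  | 1 => quad t
      (-2)
      (2 * offset t + gap0 t - gapInf t - 8)
      (-offset t * gap0 t + offset t * halfG t + gap0 t ^ 2 / 2 + gap0 t * gapInf t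
        - gap1 t ^ 2 / 2 + gapInf t ^ 2 / 2 + halfG t ^ 2 / 2 + 4 * offset t + 3 * gap0 t
        - gapInf t + halfG t - 15 / 2)
  | 2 => quad t
      (1)
      (-gap0 t + halfG t + 5)
      (-gap0 t * halfG t - 3 * gap0 t + 2 * halfG t + 6)
  | _ => 0

theorem polyFam_coefA' (k : ℕ) : PolyFam fun t => coefA' t k := by
  match k with
  | 0 => simp only [coefA']; fun_prop
  | 1 => simp only [coefA']; fun_prop
  | 2 => simp only [coefA']; fun_prop
  | n + 3 => exact PolyFam.const 0

theorem shift_coefA (t : Par → ℂ) :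
    opSE6 (t + vec 1 0 0 0 0 0 (-2)) * form 2 (-t .r) (coefA t) =
      form 2 (-t .r + 3) (coefA' t) * opSE6 t := by
  have h_r : -(t + vec 1 0 0 0 0 0 (-2)) .r = -t .r + 2 := by
    simp only [Pi.add_apply, vec]
    ring
  have h_gap0 : gap0 (t + vec 1 0 0 0 0 0 (-2)) = gap0 t + 1 := by
    simp only [gap0, Pi.add_apply, vec]
    ring
  have h_gap1 : gap1 (t + vec 1 0 0 0 0 0 (-2)) = gap1 t := by
    simp only [gap1, Pi.add_apply, vec]
    ring
  have h_gapInf : gapInf (t + vec 1 0 0 0 0 0 (-2)) = gapInf t + 1 := by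
    simp only [gapInf, Pi.add_apply, vec]
    ring
  have h_halfG : halfG (t + vec 1 0 0 0 0 0 (-2)) = halfG t := by
    simp only [halfG, Pi.add_apply, vec]
    ring
  have h_centre : centre (t + vec 1 0 0 0 0 0 (-2)) = centre t + (-1) := by
    simp only [centre, gap0, Pi.add_apply, vec]
    ring
  have h_offset : offset (t + vec 1 0 0 0 0 0 (-2)) = offset t := by
    simp only [offset, Pi.add_apply, vec]
    ring
  rw [opSE6_eq_form, opSE6_eq_form, h_r]
  refine form_intertwine_two_three fun z => ?_
  obtain ⟨y, rfl⟩ : ∃ y, z = y + centre t := ⟨z - centre t, by ring⟩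
  simp only [coefE, coefA, coefA', eval_cubic, eval_quad, h_gap0, h_gap1, h_gapInf, h_halfG,
    h_centre, h_offset, add_sub_add_same, add_add_sub_same, add_sub_cancel_right]
  refine ⟨?_, ?_, ?_, ?_, ?_, ?_⟩ <;> ring

/-- The coefficients of a shift operator for `c → c + 1`, `r → r - 2`. -/
noncomputable def coefC (t : Par → ℂ) : ℕ → ℂ[X]
  | 0 => quad t
      (1)
      (-2 * offset t - gap0 t - gap1 t - 1)
      (offset t ^ 2 + offset t * gap0 t + offset t * gap1 t + gap0 t ^ 2 / 2 + gap0 t * gap1 t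
        + gap1 t ^ 2 / 2 - gapInf t ^ 2 / 2 - halfG t ^ 2 / 2 + offset t + gap0 t + gap1 t
        + 1 / 2)
  | 1 => quad t
      (-2)
      (2 * offset t + 2 * gap0 t + gap1 t - halfG t - 1)
      (-offset t * gap0 t + offset t * halfG t - gap0 t ^ 2 / 2 - gap0 t * gap1 t
        + gap0 t * halfG t - gap1 t ^ 2 / 2 + gapInf t ^ 2 / 2 + halfG t ^ 2 / 2 + offset t
        - 1 / 2)
  | 2 => quad t
      (1)
      (-gap0 t + halfG t + 2)
      (-gap0 t * halfG t - gap0 t + halfG t + 1)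
  | _ => 0

/-- The coefficients of the cofactor of the shift operator given by `coefC`. -/
noncomputable def coefC' (t : Par → ℂ) : ℕ → ℂ[X]
  | 0 => quad t
      (1)
      (-2 * offset t - gap0 t - gap1 t - 1)
      (offset t ^ 2 + offset t * gap0 t + offset t * gap1 t + gap0 t ^ 2 / 2 + gap0 t * gap1 t
        + gap1 t ^ 2 / 2 - gapInf t ^ 2 / 2 - halfG t ^ 2 / 2 + offset t + gap0 t + gap1 t
        + 1 / 2)
  | 1 => quad t
      (-2)
      (2 * offset t + 2 * gap0 t + gap1 t - halfG t - 4)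
      (-offset t * gap0 t + offset t * halfG t - gap0 t ^ 2 / 2 - gap0 t * gap1 t
        + gap0 t * halfG t - gap1 t ^ 2 / 2 + gapInf t ^ 2 / 2 + halfG t ^ 2 / 2 + 4 * offset t
        + 2 * gap0 t + gap1 t - 1 / 2)
  | 2 => quad t
      (1)
      (-gap0 t + halfG t + 5)
      (-gap0 t * halfG t - 3 * gap0 t + 2 * halfG t + 6)
  | _ => 0

theorem polyFam_coefC (k : ℕ) : PolyFam fun t => coefC t k := by
  match k with
  | 0 => simp only [coefC]; fun_prop
  | 1 => simp only [coefC]; fun_prop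
  | 2 => simp only [coefC]; fun_prop
  | n + 3 => exact PolyFam.const 0

theorem polyFam_coefC' (k : ℕ) : PolyFam fun t => coefC' t k := by
  match k with
  | 0 => simp only [coefC']; fun_prop
  | 1 => simp only [coefC']; fun_prop
  | 2 => simp only [coefC']; fun_prop
  | n + 3 => exact PolyFam.const 0

theorem shift_coefC (t : Par → ℂ) :
    opSE6 (t + vec 0 0 1 0 0 0 (-2)) * form 2 (-t .r) (coefC t) =
      form 2 (-t .r + 3) (coefC' t) * opSE6 t := by
  have h_r : -(t + vec 0 0 1 0 0 0 (-2)) .r = -t .r + 2 := by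
    simp only [Pi.add_apply, vec]
    ring
  have h_gap0 : gap0 (t + vec 0 0 1 0 0 0 (-2)) = gap0 t + 1 := by
    simp only [gap0, Pi.add_apply, vec]
    ring
  have h_gap1 : gap1 (t + vec 0 0 1 0 0 0 (-2)) = gap1 t + 1 := by
    simp only [gap1, Pi.add_apply, vec]
    ring
  have h_gapInf : gapInf (t + vec 0 0 1 0 0 0 (-2)) = gapInf t := by
    simp only [gapInf, Pi.add_apply, vec]
    ring
  have h_halfG : halfG (t + vec 0 0 1 0 0 0 (-2)) = halfG t := by
    simp only [halfG, Pi.add_apply, vec]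
    ring
  have h_centre : centre (t + vec 0 0 1 0 0 0 (-2)) = centre t + (-1) := by
    simp only [centre, gap0, Pi.add_apply, vec]
    ring
  have h_offset : offset (t + vec 0 0 1 0 0 0 (-2)) = offset t + 1 := by
    simp only [offset, Pi.add_apply, vec]
    ring
  rw [opSE6_eq_form, opSE6_eq_form, h_r]
  refine form_intertwine_two_three fun z => ?_
  obtain ⟨y, rfl⟩ : ∃ y, z = y + centre t := ⟨z - centre t, by ring⟩
  simp only [coefE, coefC, coefC', eval_cubic, eval_quad, h_gap0, h_gap1, h_gapInf, h_halfG,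
    h_centre, h_offset, add_sub_add_same, add_add_sub_same, add_sub_cancel_right]
  refine ⟨?_, ?_, ?_, ?_, ?_, ?_⟩ <;> ring

/-- The coefficients of a shift operator for `(c, g, p, q) → (c - 1, g + 2, p + 1, q + 1)`,
`r → r - 2`. -/
noncomputable def coefG (t : Par → ℂ) : ℕ → ℂ[X]
  | 0 => quad t
      (1)
      (-2 * offset t - 2 * halfG t - 1)
      (offset t ^ 2 + 2 * offset t * halfG t - gapInf t ^ 2 - 2 * gapInf t * halfG t + offset t
        - gapInf t)
  | 1 => quad t
      (-2)
      (2 * offset t + 2 * halfG t - 1)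
      (gap0 t ^ 2 - gap1 t ^ 2 + gapInf t ^ 2 + 2 * gapInf t * halfG t + halfG t ^ 2 + offset t
        + gapInf t + 2 * halfG t)
  | 2 => quad t
      (1)
      (2)
      (-gap0 t ^ 2 + 1)
  | _ => 0

/-- The coefficients of the cofactor of the shift operator given by `coefG`. -/
noncomputable def coefG' (t : Par → ℂ) : ℕ → ℂ[X]
  | 0 => quad t
      (1)
      (-2 * offset t - 2 * halfG t + 1)
      (offset t ^ 2 + 2 * offset t * halfG t - gapInf t ^ 2 - 2 * gapInf t * halfG t - offset t
        - 3 * gapInf t - 4 * halfG t - 2)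
  | 1 => quad t
      (-2)
      (2 * offset t + 2 * halfG t - 7)
      (gap0 t ^ 2 - gap1 t ^ 2 + gapInf t ^ 2 + 2 * gapInf t * halfG t + halfG t ^ 2
        + 5 * offset t + 3 * gapInf t + 8 * halfG t - 3)
  | 2 => quad t
      (1)
      (6)
      (-gap0 t ^ 2 + 9)
  | _ => 0

theorem polyFam_coefG' (k : ℕ) : PolyFam fun t => coefG' t k := by
  match k with
  | 0 => simp only [coefG']; fun_prop
  | 1 => simp only [coefG']; fun_prop
  | 2 => simp only [coefG']; fun_prop
  | n + 3 => exact PolyFam.const 0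

theorem shift_coefG (t : Par → ℂ) :
    opSE6 (t + vec 0 0 (-1) 2 1 1 (-2)) * form 2 (-t .r) (coefG t) =
      form 2 (-t .r + 3) (coefG' t) * opSE6 t := by
  have h_r : -(t + vec 0 0 (-1) 2 1 1 (-2)) .r = -t .r + 2 := by
    simp only [Pi.add_apply, vec]
    ring
  have h_gap0 : gap0 (t + vec 0 0 (-1) 2 1 1 (-2)) = gap0 t := by
    simp only [gap0, Pi.add_apply, vec]
    ring
  have h_gap1 : gap1 (t + vec 0 0 (-1) 2 1 1 (-2)) = gap1 t := by
    simp only [gap1, Pi.add_apply, vec]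
    ring
  have h_gapInf : gapInf (t + vec 0 0 (-1) 2 1 1 (-2)) = gapInf t + 1 := by
    simp only [gapInf, Pi.add_apply, vec]
    ring
  have h_halfG : halfG (t + vec 0 0 (-1) 2 1 1 (-2)) = halfG t + 1 := by
    simp only [halfG, Pi.add_apply, vec]
    ring
  have h_centre : centre (t + vec 0 0 (-1) 2 1 1 (-2)) = centre t + (-1) := by
    simp only [centre, gap0, Pi.add_apply, vec]
    ring
  have h_offset : offset (t + vec 0 0 (-1) 2 1 1 (-2)) = offset t := by
    simp only [offset, Pi.add_apply, vec]
    ring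
  rw [opSE6_eq_form, opSE6_eq_form, h_r]
  refine form_intertwine_two_three fun z => ?_
  obtain ⟨y, rfl⟩ : ∃ y, z = y + centre t := ⟨z - centre t, by ring⟩
  simp only [coefE, coefG, coefG', eval_cubic, eval_quad, h_gap0, h_gap1, h_gapInf, h_halfG,
    h_centre, h_offset, add_sub_add_same, add_add_sub_same, add_sub_cancel_right]
  refine ⟨?_, ?_, ?_, ?_, ?_, ?_⟩ <;> ring

/-- The coefficients of a shift operator for `(c, g) → (c + 1, g - 2)`, `r → r - 2`. -/
noncomputable def coefH (t : Par → ℂ) : ℕ → ℂ[X]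
  | 0 => quad t
      (gapInf t + halfG t - 1)
      (-2 * offset t * gapInf t - 2 * offset t * halfG t - gapInf t ^ 2 - 2 * gapInf t * halfG t
        - halfG t ^ 2 + 2 * offset t + gapInf t + halfG t)
      (offset t ^ 2 * gapInf t + offset t ^ 2 * halfG t + offset t * gapInf t ^ 2
        + 2 * offset t * gapInf t * halfG t + offset t * halfG t ^ 2 + gapInf t ^ 2 * halfG t
        + gapInf t * halfG t ^ 2 - offset t ^ 2 - offset t * gapInf t - offset t * halfG t
        - gapInf t * halfG t)
  | 1 => quad t
      (-2 * gapInf t - 2 * halfG t + 2)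
      (2 * offset t * gapInf t + 2 * offset t * halfG t + gap0 t ^ 2 / 2 - gap1 t ^ 2 / 2
        + 3 * gapInf t ^ 2 / 2 + 2 * gapInf t * halfG t + halfG t ^ 2 / 2 - 2 * offset t
        - 4 * gapInf t - 3 * halfG t + 5 / 2)
      (-offset t * gap0 t ^ 2 / 2 + offset t * gap1 t ^ 2 / 2 - offset t * gapInf t ^ 2 / 2
        + offset t * halfG t ^ 2 / 2 + gap0 t ^ 2 * halfG t / 2 - gap1 t ^ 2 * halfG t / 2
        - gapInf t ^ 2 * halfG t / 2 + halfG t ^ 3 / 2 + 2 * offset t * gapInf t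
        + offset t * halfG t + gapInf t ^ 2 + 2 * gapInf t * halfG t - 3 * offset t / 2
        - 2 * gapInf t - 3 * halfG t / 2 + 1)
  | 2 => quad t
      (gapInf t + halfG t - 1)
      (-gap0 t ^ 2 / 2 + gap1 t ^ 2 / 2 - gapInf t ^ 2 / 2 + halfG t ^ 2 / 2 + 3 * gapInf t
        + 2 * halfG t - 5 / 2)
      (-gap0 t ^ 2 * halfG t / 2 + gap1 t ^ 2 * halfG t / 2 - gapInf t ^ 2 * halfG t / 2
        - gapInf t * halfG t ^ 2 - halfG t ^ 3 / 2 - gap0 t ^ 2 / 2 + gap1 t ^ 2 / 2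
        - gapInf t ^ 2 / 2 + gapInf t * halfG t + 3 * halfG t ^ 2 / 2 + 2 * gapInf t + halfG t / 2
        - 3 / 2)
  | _ => 0

/-- The coefficients of the cofactor of the shift operator given by `coefH`. -/
noncomputable def coefH' (t : Par → ℂ) : ℕ → ℂ[X]
  | 0 => quad t
      (gapInf t + halfG t - 1)
      (-2 * offset t * gapInf t - 2 * offset t * halfG t - gapInf t ^ 2 - 2 * gapInf t * halfG t
        - halfG t ^ 2 + 2 * offset t + 5 * gapInf t + 5 * halfG t - 4)
      (offset t ^ 2 * gapInf t + offset t ^ 2 * halfG t + offset t * gapInf t ^ 2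
        + 2 * offset t * gapInf t * halfG t + offset t * halfG t ^ 2 + gapInf t ^ 2 * halfG t
        + gapInf t * halfG t ^ 2 - offset t ^ 2 - 5 * offset t * gapInf t - 5 * offset t * halfG t
        - 2 * gapInf t ^ 2 - 5 * gapInf t * halfG t - 2 * halfG t ^ 2 + 4 * offset t
        + 6 * gapInf t + 6 * halfG t - 4)
  | 1 => quad t
      (-2 * gapInf t - 2 * halfG t + 2)
      (2 * offset t * gapInf t + 2 * offset t * halfG t + gap0 t ^ 2 / 2 - gap1 t ^ 2 / 2
        + 3 * gapInf t ^ 2 / 2 + 2 * gapInf t * halfG t + halfG t ^ 2 / 2 - 2 * offset t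
        - 13 * gapInf t - 12 * halfG t + 23 / 2)
      (-offset t * gap0 t ^ 2 / 2 + offset t * gap1 t ^ 2 / 2 - offset t * gapInf t ^ 2 / 2
        + offset t * halfG t ^ 2 / 2 + gap0 t ^ 2 * halfG t / 2 - gap1 t ^ 2 * halfG t / 2
        - gapInf t ^ 2 * halfG t / 2 + halfG t ^ 3 / 2 + 7 * offset t * gapInf t
        + 6 * offset t * halfG t + gap0 t ^ 2 / 2 - gap1 t ^ 2 / 2 + 9 * gapInf t ^ 2 / 2
        + 7 * gapInf t * halfG t + 3 * halfG t ^ 2 / 2 - 13 * offset t / 2 - 21 * gapInf t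
        - 37 * halfG t / 2 + 33 / 2)
  | 2 => quad t
      (gapInf t + halfG t - 1)
      (-gap0 t ^ 2 / 2 + gap1 t ^ 2 / 2 - gapInf t ^ 2 / 2 + halfG t ^ 2 / 2 + 8 * gapInf t
        + 7 * halfG t - 15 / 2)
      (-gap0 t ^ 2 * halfG t / 2 + gap1 t ^ 2 * halfG t / 2 - gapInf t ^ 2 * halfG t / 2
        - gapInf t * halfG t ^ 2 - halfG t ^ 3 / 2 - 3 * gap0 t ^ 2 / 2 + 3 * gap1 t ^ 2 / 2
        - 3 * gapInf t ^ 2 / 2 + 2 * gapInf t * halfG t + 7 * halfG t ^ 2 / 2 + 15 * gapInf t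
        + 21 * halfG t / 2 - 27 / 2)
  | _ => 0

theorem polyFam_coefH' (k : ℕ) : PolyFam fun t => coefH' t k := by
  match k with
  | 0 => simp only [coefH']; fun_prop
  | 1 => simp only [coefH']; fun_prop
  | 2 => simp only [coefH']; fun_prop
  | n + 3 => exact PolyFam.const 0

theorem shift_coefH (t : Par → ℂ) :
    opSE6 (t + vec 0 0 1 (-2) 0 0 (-2)) * form 2 (-t .r) (coefH t) =
      form 2 (-t .r + 3) (coefH' t) * opSE6 t := by
  have h_r : -(t + vec 0 0 1 (-2) 0 0 (-2)) .r = -t .r + 2 := by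
    simp only [Pi.add_apply, vec]
    ring
  have h_gap0 : gap0 (t + vec 0 0 1 (-2) 0 0 (-2)) = gap0 t := by
    simp only [gap0, Pi.add_apply, vec]
    ring
  have h_gap1 : gap1 (t + vec 0 0 1 (-2) 0 0 (-2)) = gap1 t := by
    simp only [gap1, Pi.add_apply, vec]
    ring
  have h_gapInf : gapInf (t + vec 0 0 1 (-2) 0 0 (-2)) = gapInf t + (-1) := by
    simp only [gapInf, Pi.add_apply, vec]
    ring
  have h_halfG : halfG (t + vec 0 0 1 (-2) 0 0 (-2)) = halfG t + (-1) := by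
    simp only [halfG, Pi.add_apply, vec]
    ring
  have h_centre : centre (t + vec 0 0 1 (-2) 0 0 (-2)) = centre t + (-2) := by
    simp only [centre, gap0, Pi.add_apply, vec]
    ring
  have h_offset : offset (t + vec 0 0 1 (-2) 0 0 (-2)) = offset t + 1 := by
    simp only [offset, Pi.add_apply, vec]
    ring
  rw [opSE6_eq_form, opSE6_eq_form, h_r]
  refine form_intertwine_two_three fun z => ?_
  obtain ⟨y, rfl⟩ : ∃ y, z = y + centre t := ⟨z - centre t, by ring⟩
  simp only [coefE, coefH, coefH', eval_cubic, eval_quad, h_gap0, h_gap1, h_gapInf, h_halfG,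
    h_centre, h_offset, add_sub_add_same, add_add_sub_same, add_sub_cancel_right]
  refine ⟨?_, ?_, ?_, ?_, ?_, ?_⟩ <;> ring

/-! ### Shift operators of order one -/

/-- The coefficients of the operator `θ + s` as a form of degree one. -/
noncomputable def coefP : ℕ → ℂ[X]
  | 0 => 1
  | _ => 0

/-- The coefficients of the operator `θ + s - ∂` as a form of degree one. -/
noncomputable def coefQ : ℕ → ℂ[X]
  | 0 => 1
  | 1 => -1
  | _ => 0

theorem form_coefP (s : ℂ) :
    form 1 s coefP = mulOp RatFunc.X * D + mulOp (algebraMap ℂ (RatFunc ℂ) s) := by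
  simp [form, Finset.sum_range_succ, shiftProd, coefP, algebraMap_op, theta]

theorem form_coefQ (s : ℂ) :
    form 1 s coefQ = mulOp (RatFunc.X - 1) * D + mulOp (algebraMap ℂ (RatFunc ℂ) s) := by
  simp only [form, Finset.sum_range_succ, shiftProd, coefQ, theta]
  simp [mulOp_sub, sub_mul, algebraMap_op]
  abel

theorem form_intertwine_one_three {s : ℂ} {b b' c c' : ℕ → ℂ[X]} (h : ∀ z : ℂ,
    (b' 0).eval z * (c 0).eval z = (c' 0).eval z * (b 0).eval z ∧
    (b' 0).eval z * (c 1).eval z + (b' 1).eval z * (c 0).eval (z + 1) =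
      (c' 0).eval z * (b 1).eval z + (c' 1).eval z * (b 0).eval (z + 1) ∧
    (b' 1).eval z * (c 1).eval (z + 1) + (b' 2).eval z * (c 0).eval (z + 2) =
      (c' 0).eval z * (b 2).eval z + (c' 1).eval z * (b 1).eval (z + 1) ∧
    (b' 2).eval z * (c 1).eval (z + 2) + (b' 3).eval z * (c 0).eval (z + 3) =
      (c' 0).eval z * (b 3).eval z + (c' 1).eval z * (b 2).eval (z + 1) ∧
    (b' 3).eval z * (c 1).eval (z + 3) = (c' 1).eval z * (b 3).eval (z + 1)) :
    form 3 (s + 1) b' * form 1 s c = form 1 (s + 3) c' * form 3 s b := by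
  have key := form_intertwine (d := 1) (e := 3) (s := s) (b := b) (b' := b') (c := c) (c' := c')
    fun m hm => Polynomial.funext fun z => ?_
  · simpa using key
  · obtain ⟨h0, h1, h2, h3, h4⟩ := h z
    simp only [eval_conv, Finset.sum_range_succ, Finset.sum_range_zero, zero_add]
    interval_cases m <;> norm_num
    · exact h0
    · linear_combination h1
    · linear_combination h2
    · linear_combination h3
    · linear_combination h4

theorem shift_coefP (t : Par → ℂ) :
    opSE6 (t + vec 0 0 0 0 1 0 (-1)) * form 1 (-t .r) coefP =
      form 1 (-t .r + 3) coefP * opSE6 t := by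
  have h_r : -(t + vec 0 0 0 0 1 0 (-1)) .r = -t .r + 1 := by
    simp only [Pi.add_apply, vec]
    ring
  have h_coef : coefE (t + vec 0 0 0 0 1 0 (-1)) = coefE t := by
    have h_centre : centre (t + vec 0 0 0 0 1 0 (-1)) = centre t := by
      simp only [centre, gap0, Pi.add_apply, vec]
      ring
    funext k
    match k with
    | 0 | 1 | 2 | 3 =>
      simp only [coefE, cubic, var, h_centre, gap0, gap1, gapInf, halfG, offset, Pi.add_apply, vec,
        add_zero]
    | n + 4 => simp only [coefE]
  rw [opSE6_eq_form, opSE6_eq_form, h_r, h_coef]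
  refine form_intertwine_one_three fun z => ?_
  simp only [coefP, eval_one, eval_zero]
  refine ⟨?_, ?_, ?_, ?_, ?_⟩ <;> ring

theorem shift_coefQ (t : Par → ℂ) :
    opSE6 (t + vec 0 0 0 0 0 1 (-1)) * form 1 (-t .r) coefQ =
      form 1 (-t .r + 3) coefQ * opSE6 t := by
  have h_r : -(t + vec 0 0 0 0 0 1 (-1)) .r = -t .r + 1 := by
    simp only [Pi.add_apply, vec]
    ring
  have h_gap0 : gap0 (t + vec 0 0 0 0 0 1 (-1)) = gap0 t := by
    simp only [gap0, Pi.add_apply, vec, add_zero]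
  have h_gap1 : gap1 (t + vec 0 0 0 0 0 1 (-1)) = gap1 t := by
    simp only [gap1, Pi.add_apply, vec, add_zero]
  have h_gapInf : gapInf (t + vec 0 0 0 0 0 1 (-1)) = gapInf t := by
    simp only [gapInf, Pi.add_apply, vec, add_zero]
  have h_halfG : halfG (t + vec 0 0 0 0 0 1 (-1)) = halfG t := by
    simp only [halfG, Pi.add_apply, vec, add_zero]
  have h_centre : centre (t + vec 0 0 0 0 0 1 (-1)) = centre t + (-1) := by
    simp only [centre, gap0, Pi.add_apply, vec]
    ring
  have h_offset : offset (t + vec 0 0 0 0 0 1 (-1)) = offset t + 1 := by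
    simp only [offset, Pi.add_apply, vec]
    ring
  rw [opSE6_eq_form, opSE6_eq_form, h_r]
  refine form_intertwine_one_three fun z => ?_
  obtain ⟨y, rfl⟩ : ∃ y, z = y + centre t := ⟨z - centre t, by ring⟩
  simp only [coefE, coefQ, eval_one, eval_neg, eval_cubic, h_gap0, h_gap1, h_gapInf, h_halfG,
    h_centre, h_offset, add_sub_add_same, add_add_sub_same, add_sub_cancel_right]
  refine ⟨?_, ?_, ?_, ?_, ?_⟩ <;> ring

theorem shift_D (t : Par → ℂ) : opSE6 (t + vec 0 0 0 0 0 0 (-1)) * D = D * opSE6 t := by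
  have h_r : -(t + vec 0 0 0 0 0 0 (-1)) .r = -t .r + 1 := by
    simp only [Pi.add_apply, vec]
    ring
  rw [opSE6_eq_form, opSE6_eq_form, h_r, D_mul_form]
  congr 1
  refine form_congr fun k hk => Polynomial.funext fun z => ?_
  have h_centre : centre (t + vec 0 0 0 0 0 0 (-1)) = centre t + (-1) := by
    simp only [centre, gap0, Pi.add_apply, vec]
    ring
  interval_cases k <;>
  · simp only [coefE, eval_comp, eval_add, eval_X, eval_C, eval_cubic, h_centre, gap0, gap1, gapInf,
      halfG, offset, Pi.add_apply, vec, add_zero]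
    ring

/-- The parameters `r = 3` and `a = b = c = g = p = q = 0`, at which the kernels of the operators
of order one consist of polynomials. -/
def testPoint : Par → ℂ := vec 0 0 0 0 0 0 3

theorem coefE_testPoint : (coefE testPoint 0).eval 0 = -120 ∧ (coefE testPoint 1).eval 0 = 180 ∧
    (coefE testPoint 2).eval 0 = -72 ∧ (coefE testPoint 3).eval 0 = 6 := by
  simp only [coefE, eval_cubic, centre, gap0, gap1, gapInf, halfG, offset, testPoint, vec]
  norm_num

theorem opSE6_testPoint_X_pow : opSE6 testPoint 1 = algebraMap ℂ (RatFunc ℂ) 720 ∧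
    opSE6 testPoint RatFunc.X = algebraMap ℂ (RatFunc ℂ) 360 ∧
    opSE6 testPoint (RatFunc.X ^ 2) = algebraMap ℂ (RatFunc ℂ) 144 ∧
    opSE6 testPoint (RatFunc.X ^ 3) = algebraMap ℂ (RatFunc ℂ) 36 := by
  obtain ⟨h0, h1, h2, h3⟩ := coefE_testPoint
  have h : ∀ n, opSE6 testPoint (RatFunc.X ^ n) = _ := fun n => by
    rw [← RatFunc.algebraMap_X, ← map_pow, opSE6_eq_form, form_X_pow]
  have hr : testPoint .r = 3 := rfl
  refine ⟨?_, ?_, ?_, ?_⟩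
  · rw [← pow_zero RatFunc.X, h]
    simp [Finset.sum_range_succ, Finset.prod_range_succ, Finset.prod_Ico_succ_top, h0, hr,
      Algebra.smul_def, map_ofNat RatFunc.C]
    norm_num
  · rw [← pow_one RatFunc.X, h]
    simp [Finset.sum_range_succ, Finset.prod_range_succ, Finset.prod_Ico_succ_top, h1, hr,
      Algebra.smul_def, map_ofNat RatFunc.C]
    norm_num
  · rw [h]
    simp [Finset.sum_range_succ, Finset.prod_range_succ, Finset.prod_Ico_succ_top, h2, hr,
      Algebra.smul_def, map_ofNat RatFunc.C]
    norm_num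
  · rw [h]
    simp [Finset.sum_range_succ, Finset.prod_range_succ, Finset.prod_Ico_succ_top, h3, hr,
      Algebra.smul_def, map_ofNat RatFunc.C]
    norm_num

theorem polyFun_neg_r : PolyFun fun t => -t .r := by fun_prop

/-- An operator `g ∂ + s` with `g' = 1` satisfies `(g ∂ + s) g³ = g³ (g ∂ + s + 3)`. -/
theorem firstOrder_mul_mulOp {g : RatFunc ℂ} (hg : ratDeriv g = 1) (s : ℂ) :
    (mulOp g * D + mulOp (algebraMap ℂ (RatFunc ℂ) s)) * mulOp (g ^ 3) =
      mulOp (g ^ 3) * (mulOp g * D + mulOp (algebraMap ℂ (RatFunc ℂ) (s + 3))) := by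
  have h : ratDeriv (g ^ 3) = 3 * g ^ 2 := by
    rw [pow_succ, pow_succ, pow_one, ratDeriv_mul, ratDeriv_mul, hg]
    ring
  have h1 : mulOp g * mulOp (3 * g ^ 2) = mulOp (g ^ 3) * mulOp 3 := by
    rw [← mulOp_mul, ← mulOp_mul]
    congr 1
    ring
  rw [add_mul, mul_assoc, D_mul_mulOp, h, mul_add, mul_add, h1, map_add, mulOp_add, mul_add,
    ← mul_assoc, mulOp_comm g, mulOp_comm (algebraMap ℂ (RatFunc ℂ) s), map_ofNat, mul_assoc]
  abel

theorem lead_firstOrder (g : RatFunc ℂ) {s : (Par → ℂ) → ℂ} (hs : PolyFun s) :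
    Lead paramRing 1 (fun _ => g)
      fun t => mulOp g * D + mulOp (algebraMap ℂ (RatFunc ℂ) (s t)) := by
  refine ((Lead.D_pow 1).mulOp_mul (const_mem_paramRing g)).add
    (Lead.of_ordLT (OrdLT.single Nat.zero_lt_one hs)) |>.congr (fun t => by simp)
      fun t => by simp

/-- An operator `g ∂ + s` of order one with `g' = 1` is an invertible shift operator. -/
theorem hasInvShift_firstOrder {g : RatFunc ℂ} (hg0 : g ≠ 0) (hg : ratDeriv g = 1)
    (hE : opSE6 testPoint (g ^ 3) ≠ 0) {v : Par → ℂ}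
    (h : ∀ t, opSE6 (t + v) * (mulOp g * D + mulOp (algebraMap ℂ (RatFunc ℂ) (-t .r))) =
      (mulOp g * D + mulOp (algebraMap ℂ (RatFunc ℂ) (-t .r + 3))) * opSE6 t) :
    InvShift opSE6 v (fun t => mulOp g * D + mulOp (algebraMap ℂ (RatFunc ℂ) (-t .r))) ∧
      HasInvShift opSE6 (-v) := by
  refine hasInvShift_of_first_order hg0 (pow_ne_zero 3 hg0) lead_opSE6
    (lead_firstOrder g polyFun_neg_r) (fun t => ?_) (t₀ := testPoint) (f := g ^ 3) ?_ hE
  · rw [mul_assoc, h, ← mul_assoc, ← mul_assoc, firstOrder_mul_mulOp hg]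
  · have h1 := LinearMap.congr_fun (firstOrder_mul_mulOp hg (-testPoint .r)) 1
    have h2 : -testPoint .r + 3 = 0 := by
      change (-3 + 3 : ℂ) = 0
      norm_num
    have h3 : D 1 = 0 := by
      simpa using (show D _ = 0 from ratDeriv_algebraMap_const 1)
    rw [h2, map_zero, mulOp_zero, add_zero] at h1
    simpa [mulOp, h3] using h1

theorem ratDeriv_X : ratDeriv RatFunc.X = 1 := by
  rw [← RatFunc.algebraMap_X, ratDeriv_algebraMap]
  simp

theorem hasInvShift_coefP : InvShift opSE6 (vec 0 0 0 0 1 0 (-1)) (fun t => form 1 (-t .r) coefP) ∧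
    HasInvShift opSE6 (-vec 0 0 0 0 1 0 (-1)) := by
  simp only [form_coefP]
  refine hasInvShift_firstOrder RatFunc.X_ne_zero ratDeriv_X ?_ fun t => ?_
  · rw [opSE6_testPoint_X_pow.2.2.2]
    norm_num
  · rw [← form_coefP, ← form_coefP, shift_coefP]

theorem hasInvShift_coefQ : InvShift opSE6 (vec 0 0 0 0 0 1 (-1)) (fun t => form 1 (-t .r) coefQ) ∧
    HasInvShift opSE6 (-vec 0 0 0 0 0 1 (-1)) := by
  simp only [form_coefQ]
  refine hasInvShift_firstOrder X_sub_one_ne_zero ?_ ?_ fun t => ?_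
  · change D _ = 1
    rw [map_sub]
    change ratDeriv _ - ratDeriv 1 = 1
    rw [ratDeriv_X, ← map_one (algebraMap ℂ (RatFunc ℂ)), ratDeriv_algebraMap_const, sub_zero,
      map_one]
  · obtain ⟨h0, h1, h2, h3⟩ := opSE6_testPoint_X_pow
    have h : (RatFunc.X - 1 : RatFunc ℂ) ^ 3 =
        RatFunc.X ^ 3 - (3 : ℂ) • RatFunc.X ^ 2 + (3 : ℂ) • RatFunc.X - 1 := by
      simp only [Algebra.smul_def, map_ofNat]
      ring
    rw [h, map_sub, map_add, map_sub, map_smul, map_smul, h0, h1, h2, h3, Algebra.smul_def,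
      Algebra.smul_def, ← map_mul, ← map_mul, ← map_sub, ← map_add, ← map_sub]
    norm_num
  · rw [← form_coefQ, ← form_coefQ, shift_coefQ]

theorem hasInvShift_D : HasInvShift opSE6 (vec 0 0 0 0 0 0 (-1)) ∧
    HasInvShift opSE6 (-vec 0 0 0 0 0 0 (-1)) := by
  have h := hasInvShift_of_first_order (v := vec 0 0 0 0 0 0 (-1)) (u := 1) (m := 1) one_ne_zero
    one_ne_zero lead_opSE6 (F := fun _ => D) (by simpa using Lead.D_pow (K := paramRing) 1)
    (fun t => by rw [mulOp_one, one_mul, one_mul, shift_D]) (t₀ := testPoint) (f := 1)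
    (by simpa using (show D _ = 0 from ratDeriv_algebraMap_const 1))
    (by rw [opSE6_testPoint_X_pow.1]; norm_num)
  exact ⟨⟨_, h.1⟩, h.2⟩

/-- All integral shifts of `p`, `q`, `r` are invertible. -/
theorem hasInvShift_pqr (l m n : ℤ) : HasInvShift opSE6 (vec 0 0 0 0 l m n) := by
  have h := ((HasInvShift.zsmul ⟨_, hasInvShift_coefP.1⟩ hasInvShift_coefP.2 l).add
    (HasInvShift.zsmul ⟨_, hasInvShift_coefQ.1⟩ hasInvShift_coefQ.2 m)).add
    (HasInvShift.zsmul hasInvShift_D.1 hasInvShift_D.2 (-l - m - n))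
  convert h using 1
  funext k
  cases k <;> simp [vec]
  ring

/-! ### Invertible shifts of `c` -/

/-- The coefficients of the operator `(θ + s + 1 - ∂) (θ + s - ∂)` as a form of degree two. -/
noncomputable def coefQQ : ℕ → ℂ[X]
  | 0 => 1
  | 1 => -2
  | 2 => 1
  | _ => 0

theorem form_coefP_mul (s : ℂ) : form 1 (s + 1) coefP * form 1 s coefP = form 2 s coefP := by
  have h := form_mul 1 1 s coefP coefP
  rw [Nat.cast_one] at h
  rw [h]
  refine form_congr fun k hk => ?_
  interval_cases k <;> simp [conv, Finset.sum_range_succ, coefP]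

theorem form_coefQ_mul (s : ℂ) : form 1 (s + 1) coefQ * form 1 s coefQ = form 2 s coefQQ := by
  have h := form_mul 1 1 s coefQ coefQ
  rw [Nat.cast_one] at h
  rw [h]
  refine form_congr fun k hk => ?_
  interval_cases k <;> simp [conv, Finset.sum_range_succ, coefQ, coefQQ]
  norm_num

/-- The relation `N₂ * N₁ = κ * Z + U * E` for forms `N₁`, `N₂` of degree two, `U` of degree one and
`E` of degree three, where `Z` is the product of the operators `θ + s + 3 - ∂`, `θ + s + 2 - ∂`,
`θ + s + 1` and `θ + s`, in terms of the values of the coefficients. -/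
theorem form_mul_eq_of_eval {s κ : ℂ} {n₁ n₂ e u : ℕ → ℂ[X]} (h : ∀ z : ℂ,
    (n₂ 0).eval z * (n₁ 0).eval z = κ + (u 0).eval z * (e 0).eval z ∧
    (n₂ 0).eval z * (n₁ 1).eval z + (n₂ 1).eval z * (n₁ 0).eval (z + 1) =
      -2 * κ + ((u 0).eval z * (e 1).eval z + (u 1).eval z * (e 0).eval (z + 1)) ∧
    (n₂ 0).eval z * (n₁ 2).eval z + (n₂ 1).eval z * (n₁ 1).eval (z + 1) +
        (n₂ 2).eval z * (n₁ 0).eval (z + 2) =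
      κ + ((u 0).eval z * (e 2).eval z + (u 1).eval z * (e 1).eval (z + 1)) ∧
    (n₂ 1).eval z * (n₁ 2).eval (z + 1) + (n₂ 2).eval z * (n₁ 1).eval (z + 2) =
      (u 0).eval z * (e 3).eval z + (u 1).eval z * (e 2).eval (z + 1) ∧
    (n₂ 2).eval z * (n₁ 2).eval (z + 2) = (u 1).eval z * (e 3).eval (z + 1)) :
    form 2 (s + 2) n₂ * form 2 s n₁ = mulOp (algebraMap ℂ (RatFunc ℂ) κ) *
      (form 2 (s + 2) coefQQ * form 2 s coefP) + form 1 (s + 3) u * form 3 s e := by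
  have h1 := form_mul 2 2 s n₂ n₁
  have h2 := form_mul 2 2 s coefQQ coefP
  have h3 := form_mul 1 3 s u e
  rw [Nat.cast_ofNat] at h1 h2 h3
  rw [h1, h2, h3, mulOp_mul_form, form_add]
  refine form_congr fun m hm => Polynomial.funext fun z => ?_
  obtain ⟨h0, h1, h2, h3, h4⟩ := h z
  simp only [eval_add, eval_mul, eval_C, eval_conv, Finset.sum_range_succ, Finset.sum_range_zero,
    zero_add]
  interval_cases m <;> norm_num [coefQQ, coefP]
  · exact h0
  · linear_combination h1
  · linear_combination h2
  · linear_combination h3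
  · linear_combination h4

/-- The left factor of `opSE6 t` in the composition of the shift operators for `c + 1` and
`c - 1`. -/
noncomputable def coefU (t : Par → ℂ) : ℕ → ℂ[X]
  | 0 => quad t 0 1 (halfG t - offset t)
  | 1 => quad t 0 (-1) (-halfG t - 2)
  | _ => 0

theorem polyFam_coefU (k : ℕ) : PolyFam fun t => coefU t k := by
  match k with
  | 0 => simp only [coefU]; fun_prop
  | 1 => simp only [coefU]; fun_prop
  | n + 2 => exact PolyFam.const 0

/-- The constant that the composition of the shift operators for `c + 1` and `c - 1` leaves modulo
`opSE6`; up to the factor `1 / 4`, a product of four linear polynomials in the parameters. -/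
noncomputable def obstruction (t : Par → ℂ) : ℂ :=
  ((gap0 t + gap1 t + 1 - gapInf t) ^ 2 - halfG t ^ 2) *
    ((gap0 t + gap1 t + 1 + gapInf t) ^ 2 - halfG t ^ 2) / 4

/-- The composition of the shift operators for `c + 1` and, up to shifts of `p` and `q`, for
`c - 1`. -/
theorem coefC_mul_coefC (t : Par → ℂ) :
    form 2 (-(t + vec 0 0 1 0 0 0 (-2)) .r) (coefC (symC (t + vec 0 0 1 0 0 0 (-2)))) *
        form 2 (-t .r) (coefC t) =
      mulOp (algebraMap ℂ (RatFunc ℂ) (obstruction t)) *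
        (form 2 (-t .r + 2) coefQQ * form 2 (-t .r) coefP) +
      form 1 (-t .r + 3) (coefU t) * opSE6 t := by
  have h_r : -(t + vec 0 0 1 0 0 0 (-2)) .r = -t .r + 2 := by
    simp only [Pi.add_apply, vec]
    ring
  have h_gap0 : gap0 (symC (t + vec 0 0 1 0 0 0 (-2))) = -(gap0 t + 1) := by
    simp only [gap0, symC, Pi.add_apply, vec]
    ring
  have h_gap1 : gap1 (symC (t + vec 0 0 1 0 0 0 (-2))) = -(gap1 t + 1) := by
    simp only [gap1, symC, Pi.add_apply, vec]
    ring
  have h_gapInf : gapInf (symC (t + vec 0 0 1 0 0 0 (-2))) = gapInf t := by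
    simp only [gapInf, symC, Pi.add_apply, vec]
    ring
  have h_halfG : halfG (symC (t + vec 0 0 1 0 0 0 (-2))) = halfG t := by
    simp only [halfG, symC, Pi.add_apply, vec]
    ring
  have h_centre : centre (symC (t + vec 0 0 1 0 0 0 (-2))) = centre t + (-1) := by
    simp only [centre, gap0, symC, Pi.add_apply, vec]
    ring
  have h_offset : offset (symC (t + vec 0 0 1 0 0 0 (-2))) = offset t + 1 := by
    simp only [offset, symC, Pi.add_apply, vec]
    ring
  rw [opSE6_eq_form, h_r]
  refine form_mul_eq_of_eval fun z => ?_
  obtain ⟨y, rfl⟩ : ∃ y, z = y + centre t := ⟨z - centre t, by ring⟩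
  simp only [coefE, coefC, coefU, obstruction, eval_cubic, eval_quad, h_gap0, h_gap1, h_gapInf,
    h_halfG, h_centre, h_offset, add_sub_add_same, add_add_sub_same, add_sub_cancel_right]
  refine ⟨?_, ?_, ?_, ?_, ?_⟩ <;> ring

theorem opFam_form_coefC : OpFam paramRing fun t => form 2 (-t .r) (coefC t) :=
  OpFam.form polyFun_neg_r polyFam_coefC 2

theorem polyFun_neg_r_add_three : PolyFun fun t => -t .r + 3 := by fun_prop

theorem opFam_form_coefC' : OpFam paramRing fun t => form 2 (-t .r + 3) (coefC' t) :=
  OpFam.form polyFun_neg_r_add_three polyFam_coefC' 2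

theorem symC_add (t : Par → ℂ) :
    symC (t + vec 0 0 (-1) 0 2 2 (-2)) = symC t + vec 0 0 1 0 0 0 (-2) := by
  funext k
  cases k <;> simp only [symC, Pi.add_apply, vec] <;> ring

theorem symC_add' (t : Par → ℂ) :
    symC (t + vec 0 0 1 0 0 0 (-2)) = symC t + vec 0 0 (-1) 0 2 2 (-2) := by
  funext k
  cases k <;> simp only [symC, Pi.add_apply, vec] <;> ring

/-- The shift of `c` by `-1`, up to shifts of `p`, `q`, `r`, is invertible: its composition with the
shift operator for `c + 1` is a constant times the invertible shift operator for `(p, q, r)` by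
`(2, 2, -4)`. -/
theorem hasInvShift_neg_c : HasInvShift opSE6 (vec 0 0 (-1) 0 2 2 (-2)) := by
  have hZ : InvShift opSE6 (vec 0 0 1 0 0 0 (-2) + vec 0 0 (-1) 0 2 2 (-2))
      (fun t => form 2 (-t .r + 2) coefQQ * form 2 (-t .r) coefP) := by
    have h := (hasInvShift_coefP.1.mul hasInvShift_coefP.1).mul
      (hasInvShift_coefQ.1.mul hasInvShift_coefQ.1)
    convert h using 1
    · funext k
      cases k <;> simp only [Pi.add_apply, vec] <;> norm_num
    · funext t
      have h1 : -(t + vec 0 0 0 0 1 0 (-1)) .r = -t .r + 1 := by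
        simp only [Pi.add_apply, vec]
        ring
      have h2 : -(t + (vec 0 0 0 0 1 0 (-1) + vec 0 0 0 0 1 0 (-1))) .r = -t .r + 2 := by
        simp only [Pi.add_apply, vec]
        ring
      have h3 : -(t + (vec 0 0 0 0 1 0 (-1) + vec 0 0 0 0 1 0 (-1)) + vec 0 0 0 0 0 1 (-1)) .r =
          -t .r + 2 + 1 := by
        simp only [Pi.add_apply, vec]
        ring
      rw [h1, h2, h3, form_coefP_mul, form_coefQ_mul]
  have hfam := comp_mem_paramRing polyFun_symC
  refine hasInvShift_of_mul_eq hZ opFam_form_coefC opFam_form_coefC'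
    (opFam_form_coefC.comp hfam) (opFam_form_coefC'.comp hfam)
    (OpFam.form polyFun_neg_r_add_three polyFam_coefU 1)
    (κ := fun t => algebraMap ℂ (RatFunc ℂ) (obstruction t)) ?_ (fun h0 => ?_)
    (fun t => ratDeriv_algebraMap_const _) shift_coefC
    (shift_of_symm opSE6_symC symC_add shift_coefC) coefC_mul_coefC
  · have h : PolyFun obstruction := by
      unfold obstruction
      fun_prop
    exact h
  · have h := h0 (vec 0 0 0 0 0 0 0)
    simp only [obstruction, gap0, gap1, gapInf, halfG, vec] at h
    norm_num at h

/-- All integral shifts of `c`, `p`, `q`, `r` are invertible. -/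
theorem hasInvShift_cpqr (k l m n : ℤ) : HasInvShift opSE6 (vec 0 0 k 0 l m n) := by
  have h1 : HasInvShift opSE6 (vec 0 0 1 0 0 0 0) := by
    have h := (hasInvShift_neg_c.of_symm polyFun_symC symC_symC opSE6_symC symC_add').add
      (hasInvShift_pqr 0 0 2)
    convert h using 1
    funext k
    cases k <;> simp [vec]
  have h2 : HasInvShift opSE6 (-vec 0 0 1 0 0 0 0) := by
    have h := hasInvShift_neg_c.add (hasInvShift_pqr (-2) (-2) 2)
    convert h using 1
    funext k
    cases k <;> simp [vec]
  have h := (h1.zsmul h2 k).add (hasInvShift_pqr l m n)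
  convert h using 1
  funext k
  cases k <;> simp [vec]

/-! ### All shifts -/

theorem ordLT_quad {k₂ k₁ k₀ : (Par → ℂ) → ℂ} (h₂ : PolyFun k₂) (h₁ : PolyFun k₁)
    (h₀ : PolyFun k₀) :
    OrdLT paramRing (2 + 1) fun t => aeval theta (quad t (k₂ t) (k₁ t) (k₀ t)) := by
  have hone : Lead paramRing 0 (fun _ => 1) fun _ : Par → ℂ => (1 : Op) :=
    (Lead.D_pow 0).congr (fun _ => rfl) fun _ => (pow_zero D).symm
  refine (((((lead_var.mul lead_var).mulOp_mul h₂).ordLT).add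
    ((lead_var.mulOp_mul h₁).ordLT.mono (by norm_num))).add
    ((hone.mulOp_mul h₀).ordLT.mono (by norm_num))).congr fun t => ?_
  simp only [quad, map_add, map_mul, aeval_C, algebraMap_op, mul_one, pow_two]

/-- A shift operator of order four gives shift operators for the shifts which differ from its own
by integral shifts of `c`, `p`, `q`, `r`. -/
theorem hasShift_of_form {w : Par → ℂ} {c c' : (Par → ℂ) → ℕ → ℂ[X]}
    (h : ∀ t, opSE6 (t + w) * form 2 (-t .r) (c t) = form 2 (-t .r + 3) (c' t) * opSE6 t)
    (hc : ∀ k, OrdLT paramRing (2 + 1) fun t => aeval theta (c t k))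
    (hc' : ∀ k, PolyFam fun t => c' t k) {t₀ : Par → ℂ}
    (h0 : -t₀ .r * (-t₀ .r + 1) * (c t₀ 0).eval 0 ≠ 0) {v : Par → ℂ} {k l m n : ℤ}
    (hv : vec 0 0 k 0 l m n + w = v) : HasShift opSE6 v := by
  rw [← hv]
  refine (hasInvShift_cpqr k l m n).add_hasShift lead_ne_zero lead_opSE6
    ((OrdLT.form polyFun_neg_r hc 2).mono (by norm_num))
    (OpFam.form polyFun_neg_r_add_three hc' 2) (fun hz => h0 ?_) h
  have h1 := LinearMap.congr_fun (hz t₀) 1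
  rw [form_one, LinearMap.zero_apply, map_eq_zero] at h1
  simpa only [Finset.prod_range_succ, Finset.prod_range_zero, Nat.cast_zero, add_zero, one_mul,
    Nat.cast_one] using h1

theorem ordLT_coefA (k : ℕ) : OrdLT paramRing (2 + 1) fun t => aeval theta (coefA t k) := by
  match k with
  | 0 | 1 | 2 => exact ordLT_quad (by fun_prop) (by fun_prop) (by fun_prop)
  | n + 3 => exact (OrdLT.zero 3).congr fun t => by simp only [coefA, map_zero]

theorem ordLT_coefG (k : ℕ) : OrdLT paramRing (2 + 1) fun t => aeval theta (coefG t k) := by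
  match k with
  | 0 | 1 | 2 => exact ordLT_quad (by fun_prop) (by fun_prop) (by fun_prop)
  | n + 3 => exact (OrdLT.zero 3).congr fun t => by simp only [coefG, map_zero]

theorem ordLT_coefH (k : ℕ) : OrdLT paramRing (2 + 1) fun t => aeval theta (coefH t k) := by
  match k with
  | 0 | 1 | 2 => exact ordLT_quad (by fun_prop) (by fun_prop) (by fun_prop)
  | n + 3 => exact (OrdLT.zero 3).congr fun t => by simp only [coefH, map_zero]

/-- The shifts obtained from the operator `coefA` by a symmetry `σ` of the family. -/
theorem hasShift_of_coefA {σ : (Par → ℂ) → Par → ℂ} (hσ : ∀ k, PolyFun fun t => σ t k)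
    (hE : ∀ t, opSE6 (σ t) = opSE6 t) (hr : ∀ t, σ t .r = t .r) {w v : Par → ℂ}
    (hw : ∀ t, σ (t + w) = σ t + vec 1 0 0 0 0 0 (-2)) {t₀ : Par → ℂ}
    (h0 : -t₀ .r * (-t₀ .r + 1) * (coefA (σ t₀) 0).eval 0 ≠ 0) {k l m n : ℤ}
    (hv : vec 0 0 k 0 l m n + w = v) : HasShift opSE6 v := by
  have h := shift_of_symm hE hw shift_coefA
  simp only [hr] at h
  have hfam := comp_mem_paramRing hσ
  exact hasShift_of_form h (fun k => (ordLT_coefA k).comp hfam)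
    (fun k => OpFam.comp hfam (polyFam_coefA' k)) h0 hv

theorem hasShift_a : HasShift opSE6 (vec 1 0 0 0 0 0 0) := by
  refine hasShift_of_coefA (σ := fun t => t) (w := vec 1 0 0 0 0 0 (-2)) (t₀ := testPoint)
    PolyFun.coord (fun _ => rfl) (fun _ => rfl) (fun _ => rfl) ?_ (k := 0) (l := 0) (m := 0)
    (n := 2) ?_
  · simp only [coefA, eval_quad, centre, gap0, gapInf, halfG, offset, testPoint, vec]
    norm_num
  · funext k
    cases k <;> simp [vec]

theorem hasShift_neg_a : HasShift opSE6 (vec (-1) 0 0 0 0 0 0) := by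
  refine hasShift_of_coefA (σ := symA) (w := vec (-1) 0 0 0 2 0 (-2)) (t₀ := testPoint)
    polyFun_symA opSE6_symA (fun _ => rfl) (fun t => ?_) ?_ (k := 0) (l := -2) (m := 0)
    (n := 2) ?_
  · funext k
    cases k <;> simp only [symA, Pi.add_apply, vec] <;> ring
  · simp only [coefA, eval_quad, centre, gap0, gapInf, halfG, offset, testPoint, symA, vec]
    norm_num
  · funext k
    cases k <;> simp [vec]

theorem hasShift_b : HasShift opSE6 (vec 0 1 0 0 0 0 0) := by
  refine hasShift_of_coefA (σ := symC) (w := vec 0 1 (-1) 0 2 0 (-2)) (t₀ := testPoint)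
    polyFun_symC opSE6_symC (fun _ => rfl) (fun t => ?_) ?_ (k := 1) (l := -2) (m := 0)
    (n := 2) ?_
  · funext k
    cases k <;> simp only [symC, Pi.add_apply, vec] <;> ring
  · simp only [coefA, eval_quad, centre, gap0, gapInf, halfG, offset, testPoint, symC, vec]
    norm_num
  · funext k
    cases k <;> simp [vec]

theorem hasShift_neg_b : HasShift opSE6 (vec 0 (-1) 0 0 0 0 0) := by
  refine hasShift_of_coefA (σ := fun t => symA (symC t)) (w := vec 0 (-1) 1 0 0 0 (-2))
    (t₀ := testPoint) (fun k => ?_) (fun t => by rw [opSE6_symA, opSE6_symC]) (fun _ => rfl)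
    (fun t => ?_) ?_ (k := -1) (l := 0) (m := 0) (n := 2) ?_
  · exact comp_mem_paramRing polyFun_symC _ (polyFun_symA k)
  · funext k
    cases k <;> simp only [symA, symC, Pi.add_apply, vec] <;> ring
  · simp only [coefA, eval_quad, centre, gap0, gapInf, halfG, offset, testPoint, symA, symC, vec]
    norm_num
  · funext k
    cases k <;> simp [vec]

theorem hasShift_g (k : ℤ) : HasShift opSE6 (vec 0 0 (k - 1) 2 0 0 0) := by
  refine hasShift_of_form (t₀ := testPoint) shift_coefG ordLT_coefG polyFam_coefG' ?_ (k := k)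
    (l := -1) (m := -1) (n := 2) ?_
  · simp only [coefG, eval_quad, centre, gap0, gapInf, halfG, offset, testPoint, vec]
    norm_num
  · funext k
    cases k <;> simp [vec]
    ring

theorem hasShift_neg_g (k : ℤ) : HasShift opSE6 (vec 0 0 (k + 1) (-2) 0 0 0) := by
  refine hasShift_of_form (t₀ := vec 1 0 0 0 0 0 3) shift_coefH ordLT_coefH polyFam_coefH' ?_
    (k := k) (l := 0) (m := 0) (n := 2) ?_
  · simp only [coefH, eval_quad, centre, gap0, gapInf, halfG, offset, vec]
    norm_num
  · funext k
    cases k <;> simp [vec]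

theorem hasShift_cpqr (k l m n : ℤ) : HasShift opSE6 (vec 0 0 k 0 l m n) :=
  (hasInvShift_cpqr k l m n).hasShift lead_ne_zero lead_opSE6

end SE6

theorem mainTheorem2 (v : SE6.Par → ℂ)
    (hv : v ∈ ({Pi.single .a 1, Pi.single .b 1, Pi.single .c 1, Pi.single .g 2,
      Pi.single .p 1, Pi.single .q 1, Pi.single .r 1,
      Pi.single .c 1 - Pi.single .p 1 - Pi.single .q 1,
      Pi.single .c 1 - Pi.single .g 2} : Set (SE6.Par → ℂ))) :
    SE6.AdmitsShift 6 SE6.opSE6 v ∧ SE6.AdmitsShift 6 SE6.opSE6 (-v) := by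
  have key : ∀ {w w' : SE6.Par → ℂ}, SE6.HasShift SE6.opSE6 w' → w = w' →
      SE6.AdmitsShift 6 SE6.opSE6 w := by
    rintro w _ h rfl
    exact h.admitsShift SE6.lead_ne_zero SE6.lead_opSE6
  simp only [Set.mem_insert_iff, Set.mem_singleton_iff] at hv
  obtain rfl | rfl | rfl | rfl | rfl | rfl | rfl | rfl | rfl := hv
  · refine ⟨key SE6.hasShift_a ?_, key SE6.hasShift_neg_a ?_⟩ <;>
    · funext k
      cases k <;> simp [SE6.vec]
  · refine ⟨key SE6.hasShift_b ?_, key SE6.hasShift_neg_b ?_⟩ <;>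
    · funext k
      cases k <;> simp [SE6.vec]
  · refine ⟨key (SE6.hasShift_cpqr 1 0 0 0) ?_, key (SE6.hasShift_cpqr (-1) 0 0 0) ?_⟩ <;>
    · funext k
      cases k <;> simp [SE6.vec]
  · refine ⟨key (SE6.hasShift_g 1) ?_, key (SE6.hasShift_neg_g (-1)) ?_⟩ <;>
    · funext k
      cases k <;> simp [SE6.vec]
  · refine ⟨key (SE6.hasShift_cpqr 0 1 0 0) ?_, key (SE6.hasShift_cpqr 0 (-1) 0 0) ?_⟩ <;>
    · funext k
      cases k <;> simp [SE6.vec]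
  · refine ⟨key (SE6.hasShift_cpqr 0 0 1 0) ?_, key (SE6.hasShift_cpqr 0 0 (-1) 0) ?_⟩ <;>
    · funext k
      cases k <;> simp [SE6.vec]
  · refine ⟨key (SE6.hasShift_cpqr 0 0 0 1) ?_, key (SE6.hasShift_cpqr 0 0 0 (-1)) ?_⟩ <;>
    · funext k
      cases k <;> simp [SE6.vec]
  · refine ⟨key (SE6.hasShift_cpqr 1 (-1) (-1) 0) ?_, key (SE6.hasShift_cpqr (-1) 1 1 0) ?_⟩ <;>
    · funext k
      cases k <;> simp [SE6.vec]
  · refine ⟨key (SE6.hasShift_neg_g 0) ?_, key (SE6.hasShift_g 0) ?_⟩ <;>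
    · funext k
      cases k <;> simp [SE6.vec]
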